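/- Let $k$ be an algebraically closed field and let $b_0>0$ be an integer. Let $X\subset\mathbf P^3_k$ be the (scheme-theoretic) image of the morphism $\mathbf P^1_k\to\mathbf P^3_k$, $$[S,T]\mapsto[S^{3b_0+5},\,S^{3b_0+2}T^3,\,T^{3b_0+5},\,ST^{3b_0+4}],$$ let $x_0=[1,0,0,0]\in X$, and let $\omega$ be the dualizing sheaf of $X$, that is, a coherent sheaf with a trace map $H^1(X,\omega)\to k$ such that for every coherent sheaf $F$ the pairing $\operatorname{Hom}(F,\omega)\times H^1(X,F)\to H^1(X,\omega)\to k$ induces a bijection $\operatorname{Hom}(F,\omega)\cong H^1(X,F)^\vee$. Let $\beta\colon\mathbf P\omega=\operatorname{Proj}(\operatorname{Sym}_{\mathcal O_X}\omega)\to X$ be the projectivization of $\omega$. Then: 1. There are a nonempty open subset $W\subset\mathbf P\omega$, contained (as a set) in the fiber $\beta^{-1}(x_0)$, and a regular function $f\in H^0(W,\mathcal O_{\mathbf P\omega})$ such that $f^{b_0+1}=0$ and the support of $f^{b_0}$ is all of $W$ (the germ of $f^{b_0}$ is nonzero at every point of $W$). 2. Let $X_1\subset X$ be the open subset where the first coordinate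 of $\mathbf P^3_k$ does not vanish, and let $x,y,z$ be the second, third and fourth coordinates divided by the first, as functions on $X_1$. There is an open immersion over $k$ of $\operatorname{Spec}k[x,v]/(x^{b_0+1}(x+v^3))$ into $\mathbf P\omega$ whose image lies in $\beta^{-1}(X_1)$; under it the functions $x,y,z$ on $X_1$ pull back to $x$, $v^2x^{b_0+1}$, $-v\,x^{b_0+1}$. 3. $X_1$ is affine, and $x,y,z$ identify it with the closed subscheme of $\mathbf A^3_k=\operatorname{Spec}k[x,y,z]$ defined by the ideal of maximal ($2\times2$) minors of $$\begin{pmatrix} z & x^{b_0+1}\\ y & z\\ x^{b_0+2} & y\end{pmatrix}.$$ -/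

import Mathlib

open CategoryTheory AlgebraicGeometry HomogeneousLocalization
open scoped DirectSum

universe u

noncomputable section

namespace ProjDeg

variable {A B : Type u} [CommRing A] [CommRing B] {σ τ : Type u} [SetLike σ A]
  [AddSubgroupClass σ A] [SetLike τ B] [AddSubgroupClass τ B]
  (𝒜 : ℕ → σ) (ℬ : ℕ → τ) [GradedRing 𝒜] [GradedRing ℬ]
  (f : A →+* B) (d : ℕ)

theorem powers_le_comap (s : A) :
    Submonoid.powers s ≤ (Submonoid.powers (f s)).comap f := by
  rintro _ ⟨n, rfl⟩; exact ⟨n, by simp⟩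

/-- `a / s ^ n ↦ f a / f s ^ n`, as a function. -/
def awayFun (hf : ∀ i a, a ∈ 𝒜 i → f a ∈ ℬ (d * i)) (s : A) : Away 𝒜 s → Away ℬ (f s) :=
  Quotient.map'
    (fun x ↦ ⟨d * x.1, ⟨f x.2, hf _ _ x.2.2⟩, ⟨f x.3, hf _ _ x.3.2⟩,
      powers_le_comap f s x.4⟩)
    fun x y (e : x.embedding = y.embedding) ↦ by
      apply_fun IsLocalization.map (Localization (Submonoid.powers (f s))) f
        (powers_le_comap f s) at e
      simp_rw [HomogeneousLocalization.NumDenSameDeg.embedding, Localization.mk_eq_mk',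
        IsLocalization.map_mk', ← Localization.mk_eq_mk'] at e
      exact e

theorem val_awayFun (hf : ∀ i a, a ∈ 𝒜 i → f a ∈ ℬ (d * i)) (s : A) (x : Away 𝒜 s) :
    (awayFun 𝒜 ℬ f d hf s x).val =
      IsLocalization.map (Localization (Submonoid.powers (f s))) f (powers_le_comap f s) x.val := by
  obtain ⟨c, rfl⟩ := HomogeneousLocalization.mk_surjective x
  rw [val_mk, Localization.mk_eq_mk', IsLocalization.map_mk', ← Localization.mk_eq_mk']
  rfl

/-- The map `(A_s)₀ → (B_{f s})₀` induced by a ring homomorphism `f` that multiplies degrees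
by `d`. -/
def awayMap (hf : ∀ i a, a ∈ 𝒜 i → f a ∈ ℬ (d * i)) (s : A) : Away 𝒜 s →+* Away ℬ (f s) where
  toFun := awayFun 𝒜 ℬ f d hf s
  map_add' x y := HomogeneousLocalization.val_injective _ (by
    simp only [val_awayFun, val_add, map_add])
  map_mul' x y := HomogeneousLocalization.val_injective _ (by
    simp only [val_awayFun, val_mul, map_mul])
  map_zero' := HomogeneousLocalization.val_injective _ (by
    simp only [val_awayFun, val_zero, map_zero])
  map_one' := HomogeneousLocalization.val_injective _ (by
    simp only [val_awayFun, val_one, map_one])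

theorem awayMap_comp (hf : ∀ i a, a ∈ 𝒜 i → f a ∈ ℬ (d * i)) {s t x : A} {m : ℕ}
    (ht : t ∈ 𝒜 m) (hx : x = s * t) :
    (awayMap 𝒜 ℬ f d hf x).comp (HomogeneousLocalization.awayMap 𝒜 ht hx) =
      (HomogeneousLocalization.awayMap ℬ (hf _ _ ht) (by rw [hx, map_mul])).comp
        (awayMap 𝒜 ℬ f d hf s) := by
  ext z
  change (awayFun 𝒜 ℬ f d hf x _).val = _
  rw [val_awayFun, RingHom.comp_apply, val_awayMap, val_awayMap]
  change _ = Localization.awayLift (algebraMap B _) _ _ (awayFun 𝒜 ℬ f d hf s z).val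
  rw [val_awayFun]
  generalize z.val = w
  simp only [← RingHom.comp_apply]
  congr 1
  apply IsLocalization.ringHom_ext (Submonoid.powers s)
  ext a
  simp [IsLocalization.map_eq, Localization.awayLift]

/-- If the homogeneous elements `g i` have no common zero on `Proj B`, the `D₊(g i)` form an affine
open cover. -/
def affineCover {ι : Type*} (g : ι → B) (m : ι → ℕ) (hg : ∀ i, g i ∈ ℬ (m i)) (hm : ∀ i, 0 < m i)
    (hcov : ∀ p : ProjectiveSpectrum ℬ, ∃ i, g i ∉ p.asHomogeneousIdeal) :
    (Proj ℬ).AffineOpenCover where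
  I₀ := ι
  X i := .of (Away ℬ (g i))
  f i := Proj.awayι ℬ (g i) (hg i) (hm i)
  idx x := (hcov x).choose
  covers x := by
    change x ∈ (Proj.awayι ℬ _ _ _).opensRange
    rw [Proj.opensRange_awayι]
    exact (hcov x).choose_spec

theorem awayι_compat (hf : ∀ i a, a ∈ 𝒜 i → f a ∈ ℬ (d * i)) (hd : 0 < d) {s t : A}
    {m n : ℕ} (hs : s ∈ 𝒜 m) (hm : 0 < m) (ht : t ∈ 𝒜 n) (hn : 0 < n) :
    Limits.pullback.fst (Proj.awayι ℬ (f s) (hf _ _ hs) (Nat.mul_pos hd hm))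
        (Proj.awayι ℬ (f t) (hf _ _ ht) (Nat.mul_pos hd hn)) ≫
      Spec.map (CommRingCat.ofHom (awayMap 𝒜 ℬ f d hf s)) ≫ Proj.awayι 𝒜 s hs hm =
    Limits.pullback.snd (Proj.awayι ℬ (f s) (hf _ _ hs) (Nat.mul_pos hd hm))
        (Proj.awayι ℬ (f t) (hf _ _ ht) (Nat.mul_pos hd hn)) ≫
      Spec.map (CommRingCat.ofHom (awayMap 𝒜 ℬ f d hf t)) ≫ Proj.awayι 𝒜 t ht hn := by
  have key : ∀ (s t x : A) (m n : ℕ) (hs : s ∈ 𝒜 m) (hm : 0 < m) (ht : t ∈ 𝒜 n) (hx : x = s * t),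
      Spec.map (CommRingCat.ofHom (HomogeneousLocalization.awayMap ℬ (hf _ _ ht)
        (show f x = f s * f t by rw [hx, map_mul]))) ≫
      Spec.map (CommRingCat.ofHom (awayMap 𝒜 ℬ f d hf s)) ≫ Proj.awayι 𝒜 s hs hm =
      Spec.map (CommRingCat.ofHom (awayMap 𝒜 ℬ f d hf x)) ≫
        Proj.awayι 𝒜 x (hx ▸ SetLike.mul_mem_graded hs ht) (hm.trans_le (m.le_add_right n)) := by
    intro s t x m n hs hm ht hx
    rw [← Proj.SpecMap_awayMap_awayι 𝒜 hs hm ht hx, ← Category.assoc, ← Category.assoc,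
      ← Spec.map_comp, ← Spec.map_comp, ← CommRingCat.ofHom_comp, ← CommRingCat.ofHom_comp,
      awayMap_comp]
  rw [← cancel_epi (Proj.pullbackAwayιIso ℬ (hf _ _ hs) (Nat.mul_pos hd hm)
    (hf _ _ ht) (Nat.mul_pos hd hn) (map_mul f s t)).inv,
    Proj.pullbackAwayιIso_inv_fst_assoc, Proj.pullbackAwayιIso_inv_snd_assoc]
  exact (key s t (s * t) _ _ hs hm ht rfl).trans (key t s (s * t) _ _ ht hn hs (mul_comm _ _)).symm

/-- The morphism `Proj B ⟶ Proj A` induced by a ring homomorphism `f : A → B` multiplying degrees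
by `d`, where the `s i` are homogeneous elements of positive degree such that the `f (s i)` have
no common zero on `Proj B`: on `D₊(f (s i))` it is the map
`Spec (B_{f (s i)})₀ ⟶ Spec (A_{s i})₀` given by `a / s i ^ n ↦ f a / f (s i) ^ n`. -/
def projMap (hf : ∀ i a, a ∈ 𝒜 i → f a ∈ ℬ (d * i)) (hd : 0 < d) {ι : Type*} (s : ι → A)
    (m : ι → ℕ) (hs : ∀ i, s i ∈ 𝒜 (m i)) (hm : ∀ i, 0 < m i)
    (hcov : ∀ p : ProjectiveSpectrum ℬ, ∃ i, f (s i) ∉ p.asHomogeneousIdeal) :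
    Proj ℬ ⟶ Proj 𝒜 :=
  (affineCover ℬ (fun i ↦ f (s i)) (fun i ↦ d * m i) (fun i ↦ hf _ _ (hs i))
    (fun i ↦ Nat.mul_pos hd (hm i)) hcov).openCover.glueMorphisms
    (fun i ↦ Spec.map (CommRingCat.ofHom (awayMap 𝒜 ℬ f d hf (s i))) ≫
      Proj.awayι 𝒜 (s i) (hs i) (hm i))
    (fun i j ↦ awayι_compat 𝒜 ℬ f d hf hd (hs i) (hm i) (hs j) (hm j))

theorem awayι_projMap (hf : ∀ i a, a ∈ 𝒜 i → f a ∈ ℬ (d * i)) (hd : 0 < d) {ι : Type*} (s : ι → A)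
    (m : ι → ℕ) (hs : ∀ i, s i ∈ 𝒜 (m i)) (hm : ∀ i, 0 < m i)
    (hcov : ∀ p : ProjectiveSpectrum ℬ, ∃ i, f (s i) ∉ p.asHomogeneousIdeal) (i : ι) :
    Proj.awayι ℬ (f (s i)) (hf _ _ (hs i)) (Nat.mul_pos hd (hm i)) ≫
      projMap 𝒜 ℬ f d hf hd s m hs hm hcov =
    Spec.map (CommRingCat.ofHom (awayMap 𝒜 ℬ f d hf (s i))) ≫
      Proj.awayι 𝒜 (s i) (hs i) (hm i) :=
  Scheme.Cover.ι_glueMorphisms (affineCover ℬ (fun i ↦ f (s i)) (fun i ↦ d * m i)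
    (fun i ↦ hf _ _ (hs i)) (fun i ↦ Nat.mul_pos hd (hm i)) hcov).openCover _ _ i
end ProjDeg

namespace SymGrading
variable (R M : Type*) [CommRing R] [AddCommGroup M] [Module R M]

/-- The degree `i` part `Symⁱ M` of the symmetric algebra. -/
def symPart (i : ℕ) : Submodule R (SymmetricAlgebra R M) :=
  LinearMap.range (SymmetricAlgebra.ι R M) ^ i

/-- The map from `M` to the degree one part, inside the direct sum. -/
def gι : M →ₗ[R] ⨁ i : ℕ, symPart R M i :=
  DirectSum.lof R ℕ (fun i => symPart R M i) 1 ∘ₗ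
    (SymmetricAlgebra.ι R M).codRestrict _ fun m => by
      simpa only [symPart, pow_one] using LinearMap.mem_range_self _ m

theorem gι_apply (m : M) : gι R M m = DirectSum.of (fun i : ℕ => symPart R M i) 1
    ⟨SymmetricAlgebra.ι R M m, by
      simpa only [symPart, pow_one] using LinearMap.mem_range_self _ m⟩ := rfl

instance gradedMonoid : SetLike.GradedMonoid (symPart R M) :=
  inferInstanceAs (SetLike.GradedMonoid
    ((LinearMap.range (SymmetricAlgebra.ι R M) ^ ·) : ℕ → Submodule R _))

instance gradedAlgebra : GradedAlgebra (symPart R M) :=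
  GradedAlgebra.ofAlgHom _ (SymmetricAlgebra.lift (gι R M))
    (by
      ext m
      change DirectSum.coeAlgHom (symPart R M) (SymmetricAlgebra.lift (gι R M) _) = _
      rw [SymmetricAlgebra.lift_ι_apply, gι_apply R M, DirectSum.coeAlgHom_of]
      rfl)
    fun i x => by
    obtain ⟨x, hx⟩ := x
    dsimp only [Subtype.coe_mk, DirectSum.lof_eq_of]
    unfold symPart at hx
    induction hx using Submodule.pow_induction_on_left' with
    | algebraMap r =>
      rw [AlgHom.commutes, DirectSum.algebraMap_apply]; rfl
    | add x y i hx hy ihx ihy =>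
      rw [map_add, ihx, ihy, ← map_add]
      rfl
    | mem_mul m hm i x hx ih =>
      obtain ⟨_, rfl⟩ := hm
      rw [map_mul, ih, SymmetricAlgebra.lift_ι_apply, gι_apply R M, DirectSum.of_mul_of]
      exact DirectSum.of_eq_of_gradedMonoid_eq (Sigma.subtype_ext (add_comm _ _) rfl)

variable {R M} {R' M' R'' M'' : Type*} [CommRing R'] [AddCommGroup M'] [Module R' M']
  [CommRing R''] [AddCommGroup M''] [Module R'' M'']

theorem ι_mem (m : M) : SymmetricAlgebra.ι R M m ∈ symPart R M 1 := by
  simpa only [symPart, pow_one] using LinearMap.mem_range_self _ m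

theorem ringHom_ext {B : Type*} [CommRing B] {F G : SymmetricAlgebra R M →+* B}
    (h1 : ∀ r, F (algebraMap R _ r) = G (algebraMap R _ r))
    (h2 : ∀ m, F (SymmetricAlgebra.ι R M m) = G (SymmetricAlgebra.ι R M m)) : F = G := by
  refine RingHom.ext fun x ↦ ?_
  induction x using SymmetricAlgebra.induction with
  | algebraMap r => exact h1 r
  | ι x => exact h2 x
  | mul a b ha hb => rw [map_mul, map_mul, ha, hb]
  | add a b ha hb => rw [map_add, map_add, ha, hb]

/-- The ring homomorphism `Sym_R M → Sym_R' M'` induced by a semilinear map. -/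
def symMap {σ : R →+* R'} (g : M →ₛₗ[σ] M') : SymmetricAlgebra R M →+* SymmetricAlgebra R' M' :=
  letI : Algebra R (SymmetricAlgebra R' M') := ((algebraMap R' _).comp σ).toAlgebra
  (SymmetricAlgebra.lift (R := R) (A := SymmetricAlgebra R' M')
    { toFun := fun m ↦ SymmetricAlgebra.ι R' M' (g m)
      map_add' := fun x y ↦ by rw [map_add, map_add]
      map_smul' := fun r x ↦ by
        rw [map_smulₛₗ, map_smul, Algebra.smul_def, RingHom.id_apply, Algebra.smul_def]
        rfl }).toRingHom

theorem symMap_ι {σ : R →+* R'} (g : M →ₛₗ[σ] M') (m : M) :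
    symMap g (SymmetricAlgebra.ι R M m) = SymmetricAlgebra.ι R' M' (g m) :=
  letI : Algebra R (SymmetricAlgebra R' M') := ((algebraMap R' _).comp σ).toAlgebra
  SymmetricAlgebra.lift_ι_apply _ _

theorem symMap_algebraMap {σ : R →+* R'} (g : M →ₛₗ[σ] M') (r : R) :
    symMap g (algebraMap R _ r) = algebraMap R' _ (σ r) :=
  letI : Algebra R (SymmetricAlgebra R' M') := ((algebraMap R' _).comp σ).toAlgebra
  AlgHom.commutes _ _

theorem symMap_mem {σ : R →+* R'} (g : M →ₛₗ[σ] M') {i : ℕ} {x : SymmetricAlgebra R M}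
    (hx : x ∈ symPart R M i) : symMap g x ∈ symPart R' M' i := by
  unfold symPart at hx
  induction hx using Submodule.pow_induction_on_left' with
  | algebraMap r =>
    rw [symMap_algebraMap]
    exact SetLike.algebraMap_mem_graded (symPart R' M') _
  | add x y i hx hy ihx ihy => rw [map_add]; exact add_mem ihx ihy
  | mem_mul m hm i x hx ih =>
    obtain ⟨m, rfl⟩ := hm
    rw [map_mul, symMap_ι, Nat.succ_eq_one_add]
    exact SetLike.mul_mem_graded (ι_mem _) ih

/-- `symMap` as a homomorphism of graded rings. -/
def symGradedMap {σ : R →+* R'} (g : M →ₛₗ[σ] M') : symPart R M →+*ᵍ symPart R' M' where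
  __ := symMap g
  map_mem hx := symMap_mem g hx

theorem symGradedMap_apply {σ : R →+* R'} (g : M →ₛₗ[σ] M') (x : SymmetricAlgebra R M) :
    symGradedMap g x = symMap g x := rfl

theorem symGradedMap_mem {σ : R →+* R'} (g : M →ₛₗ[σ] M') {i : ℕ} {x : SymmetricAlgebra R M}
    (hx : x ∈ symPart R M i) : symGradedMap g x ∈ symPart R' M' i := symMap_mem g hx

theorem irrelevant_le {σ : R →+* R'} (g : M →ₛₗ[σ] M')
    (hg : Submodule.span R' (Set.range g) = ⊤) :
    HomogeneousIdeal.irrelevant (symPart R' M') ≤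
      (HomogeneousIdeal.irrelevant (symPart R M)).map (symGradedMap g) := by
  rw [HomogeneousIdeal.irrelevant_le]
  have h1 : ∀ m : M', SymmetricAlgebra.ι R' M' m ∈
      (HomogeneousIdeal.irrelevant (symPart R M)).map (symGradedMap g) := by
    intro m
    have hm : m ∈ Submodule.span R' (Set.range g) := hg ▸ Submodule.mem_top
    induction hm using Submodule.span_induction with
    | mem x hx =>
      obtain ⟨m, rfl⟩ := hx
      rw [← symMap_ι]
      exact Ideal.mem_map_of_mem _ (HomogeneousIdeal.mem_irrelevant_of_mem _ Nat.one_pos (ι_mem m))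
    | zero => rw [map_zero]; exact zero_mem _
    | add x y _ _ hx hy => rw [map_add]; exact add_mem hx hy
    | smul r x _ hx => rw [map_smul, Algebra.smul_def]; exact Ideal.mul_mem_left _ _ hx
  intro i hi x hx
  obtain ⟨i, rfl⟩ : ∃ j, i = j + 1 := ⟨i - 1, by omega⟩
  have hx' : x ∈ LinearMap.range (SymmetricAlgebra.ι R' M') *
      LinearMap.range (SymmetricAlgebra.ι R' M') ^ i := by
    rw [← pow_succ']; exact hx
  induction hx' using Submodule.mul_induction_on' with
  | mem_mul_mem a ha b hb => 
    obtain ⟨m, rfl⟩ := ha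
    exact Ideal.mul_mem_right _ _ (h1 m)
  | add a ha b hb h1 h2 =>
    refine add_mem (h1 ?_) (h2 ?_)
    · rw [← pow_succ'] at ha; exact ha
    · rw [← pow_succ'] at hb; exact hb


section localization
variable [Algebra R R'] [Module R M'] [IsScalarTower R R' M']

/-- A linear map into a module over a larger ring, as a semilinear map. -/
def toSemilinear (g : M →ₗ[R] M') : M →ₛₗ[algebraMap R R'] M' where
  toFun := g
  map_add' := map_add g
  map_smul' r m := by rw [map_smul, algebraMap_smul]

theorem symMap_surj (f : R) (g : M →ₗ[R] M') [IsLocalization.Away f R']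
    [IsLocalizedModule (.powers f) g] (x : SymmetricAlgebra R' M') :
    ∃ (n : ℕ) (y : SymmetricAlgebra R M),
      algebraMap R' _ (algebraMap R R' f) ^ n * x = symMap (toSemilinear (R' := R') g) y := by
  induction x using SymmetricAlgebra.induction with
  | algebraMap r =>
    obtain ⟨⟨a, ⟨_, n, rfl⟩⟩, h⟩ := IsLocalization.surj (Submonoid.powers f) r
    refine ⟨n, algebraMap R _ a, ?_⟩
    rw [symMap_algebraMap, ← h, ← map_pow, ← map_pow, ← map_mul, mul_comm]
  | ι m =>
    obtain ⟨⟨a, ⟨_, n, rfl⟩⟩, h⟩ := IsLocalizedModule.surj (Submonoid.powers f) g m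
    refine ⟨n, SymmetricAlgebra.ι R M a, ?_⟩
    rw [symMap_ι]
    change _ = SymmetricAlgebra.ι R' M' (g a)
    rw [← h, ← map_pow, ← map_pow, ← Algebra.smul_def, ← map_smul, algebraMap_smul]
    rfl
  | mul a b ha hb =>
    obtain ⟨n, y, hy⟩ := ha
    obtain ⟨m, z, hz⟩ := hb
    exact ⟨n + m, y * z, by rw [map_mul, ← hy, ← hz]; ring⟩
  | add a b ha hb =>
    obtain ⟨n, y, hy⟩ := ha
    obtain ⟨m, z, hz⟩ := hb
    refine ⟨n + m, algebraMap R _ f ^ m * y + algebraMap R _ f ^ n * z, ?_⟩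
    rw [map_add, map_mul, map_mul, map_pow, map_pow, symMap_algebraMap, ← hy, ← hz]; ring

theorem symMap_inj (f : R) (g : M →ₗ[R] M') [IsLocalization.Away f R']
    [IsLocalizedModule (.powers f) g] (x : SymmetricAlgebra R M)
    (hx : symMap (toSemilinear (R' := R') g) x = 0) :
    ∃ n : ℕ, algebraMap R _ f ^ n * x = 0 := by
  let L := Localization.Away (algebraMap R (SymmetricAlgebra R M) f)
  have hu : IsUnit (algebraMap R L f) := by
    rw [IsScalarTower.algebraMap_apply R (SymmetricAlgebra R M) L]
    exact IsLocalization.Away.algebraMap_isUnit _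
  letI : Algebra R' L := (IsLocalization.Away.lift (S := R') f hu).toAlgebra
  haveI : IsScalarTower R R' L := IsScalarTower.of_algebraMap_eq fun r ↦
    (IsLocalization.Away.lift_eq f hu r).symm
  let h : M →ₗ[R] L :=
    (IsScalarTower.toAlgHom R (SymmetricAlgebra R M) L).toLinearMap ∘ₗ SymmetricAlgebra.ι R M
  have hh : ∀ s : Submonoid.powers f, IsUnit (algebraMap R (Module.End R L) s) := by
    rintro ⟨_, n, rfl⟩
    rw [Module.End.isUnit_iff]
    have hn : IsUnit (algebraMap R L (f ^ n)) := by rw [map_pow]; exact hu.pow n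
    have : ⇑(algebraMap R (Module.End R L) (f ^ n)) = fun z : L ↦ algebraMap R L (f ^ n) * z := by
      ext z; simp only [Module.algebraMap_end_apply, Algebra.smul_def]
    change Function.Bijective ⇑(algebraMap R (Module.End R L) (f ^ n))
    rw [this]
    exact (IsUnit.isUnit_iff_mulLeft_bijective).mp hn
  let k : M' →ₗ[R] L := IsLocalizedModule.lift (.powers f) g h hh
  let k' : M' →ₗ[R'] L := LinearMap.extendScalarsOfIsLocalization (.powers f) R' k
  have hψ : ((SymmetricAlgebra.lift k').toRingHom.comp (symMap (toSemilinear (R' := R') g))) =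
      algebraMap (SymmetricAlgebra R M) L := by
    refine ringHom_ext (fun r ↦ ?_) (fun m ↦ ?_)
    · rw [RingHom.comp_apply, symMap_algebraMap]
      change SymmetricAlgebra.lift k' (algebraMap R' _ _) = _
      rw [AlgHom.commutes, ← IsScalarTower.algebraMap_apply, ← IsScalarTower.algebraMap_apply]
    · rw [RingHom.comp_apply, symMap_ι]
      change SymmetricAlgebra.lift k' (SymmetricAlgebra.ι R' M' (g m)) = _
      rw [SymmetricAlgebra.lift_ι_apply]
      exact IsLocalizedModule.lift_apply (.powers f) g h hh m
  have h0 : algebraMap (SymmetricAlgebra R M) L x = 0 := by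
    rw [← hψ, RingHom.comp_apply, hx, map_zero]
  obtain ⟨⟨_, n, rfl⟩, hn⟩ := (IsLocalization.map_eq_zero_iff
    (Submonoid.powers (algebraMap R (SymmetricAlgebra R M) f)) L x).mp h0
  exact ⟨n, hn⟩

end localization
end SymGrading
namespace ProjLoc
variable {A B : Type u} [CommRing A] [CommRing B] {σ τ : Type u} [SetLike σ A]
  [AddSubgroupClass σ A] [SetLike τ B] [AddSubgroupClass τ B]
  {𝒜 : ℕ → σ} {ℬ : ℕ → τ} [GradedRing 𝒜] [GradedRing ℬ]
  (φ : 𝒜 →+*ᵍ ℬ) (hφ : HomogeneousIdeal.irrelevant ℬ ≤ (HomogeneousIdeal.irrelevant 𝒜).map φ)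
  (a : A) (ha : a ∈ 𝒜 0) (hu : IsUnit (φ a))
  (hs : ∀ x : B, ∃ (n : ℕ) (y : A), φ a ^ n * x = φ y)
  (hi : ∀ x : A, φ x = 0 → ∃ n : ℕ, a ^ n * x = 0)

theorem mem_map {i : ℕ} {x : A} (hx : x ∈ 𝒜 i) : φ x ∈ ℬ i := φ.map_mem hx

theorem map_proj (i : ℕ) (x : A) :
    φ (GradedRing.proj 𝒜 i x) = GradedRing.proj ℬ i (φ x) := by
  classical
  conv_rhs => rw [← DirectSum.sum_support_decompose 𝒜 x]
  rw [map_sum, map_sum]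
  by_cases h : i ∈ (DirectSum.decompose 𝒜 x).support
  · rw [Finset.sum_eq_single_of_mem i h]
    · rw [GradedRing.proj_apply, GradedRing.proj_apply,
        DirectSum.decompose_of_mem_same _ (mem_map φ (SetLike.coe_mem _))]
    · intro j _ hj
      rw [GradedRing.proj_apply, DirectSum.decompose_of_mem_ne _ (mem_map φ (SetLike.coe_mem _)) hj]
  · rw [Finset.sum_eq_zero]
    · rw [GradedRing.proj_apply, DFinsupp.notMem_support_iff.mp h]
      simp
    · intro j hj
      rw [GradedRing.proj_apply, DirectSum.decompose_of_mem_ne _ (mem_map φ (SetLike.coe_mem _))]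
      rintro rfl
      exact h hj

theorem surj_hom (ha : a ∈ 𝒜 0) (hs : ∀ x : B, ∃ (n : ℕ) (y : A), φ a ^ n * x = φ y)
    {i : ℕ} {x : B} (hx : x ∈ ℬ i) : ∃ (n : ℕ) (y : A), y ∈ 𝒜 i ∧ φ a ^ n * x = φ y := by
  obtain ⟨n, y, hy⟩ := hs x
  refine ⟨n, GradedRing.proj 𝒜 i y, SetLike.coe_mem _, ?_⟩
  rw [map_proj, ← hy, GradedRing.proj_apply, DirectSum.decompose_of_mem_same]
  have := SetLike.mul_mem_graded (SetLike.pow_mem_graded n (mem_map φ ha)) hx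
  simpa using this

theorem mul_mem_iff (hu : IsUnit (φ a)) (J : Ideal B) (n : ℕ) (x : B) :
    φ a ^ n * x ∈ J ↔ x ∈ J :=
  J.unit_mul_mem_iff_mem (hu.pow n)

theorem range_map (hu : IsUnit (φ a))
    (hs : ∀ x : B, ∃ (n : ℕ) (y : A), φ a ^ n * x = φ y)
    (hi : ∀ x : A, φ x = 0 → ∃ n : ℕ, a ^ n * x = 0) :
    Set.range (Proj.map φ hφ) = {p : Proj 𝒜 | a ∉ p.asHomogeneousIdeal} := by
  ext q
  constructor
  · rintro ⟨p, rfl⟩ (h : φ a ∈ p.asHomogeneousIdeal.toIdeal)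
    exact p.isPrime.ne_top (Ideal.eq_top_of_isUnit_mem _ h hu)
  · intro (hq : a ∉ q.asHomogeneousIdeal.toIdeal)
    letI : Algebra A B := φ.toRingHom.toAlgebra
    have hloc : IsLocalization (Submonoid.powers a) B := by
      rw [isLocalization_iff]
      refine ⟨?_, ?_, ?_⟩
      · rintro ⟨_, n, rfl⟩
        change IsUnit (φ (a ^ n))
        rw [map_pow]; exact hu.pow n
      · intro z
        obtain ⟨n, y, hy⟩ := hs z
        refine ⟨⟨y, ⟨a ^ n, n, rfl⟩⟩, ?_⟩
        change z * φ (a ^ n) = φ y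
        rw [map_pow, mul_comm, hy]
      · intro x y (h : φ x = φ y)
        obtain ⟨n, hn⟩ := hi (x - y) (by rw [map_sub, h, sub_self])
        exact ⟨⟨a ^ n, n, rfl⟩, by rwa [mul_sub, sub_eq_zero] at hn⟩
    have hd : Disjoint (Submonoid.powers a : Set A) (q.asHomogeneousIdeal.toIdeal : Set A) := by
      rw [Set.disjoint_left]
      rintro _ ⟨n, rfl⟩ h
      exact hq (q.isPrime.mem_of_pow_mem n h)
    have hp := IsLocalization.isPrime_of_isPrime_disjoint (Submonoid.powers a) B _ q.isPrime hd
    have hc : ((q.asHomogeneousIdeal.map φ).toIdeal).comap φ = q.asHomogeneousIdeal.toIdeal :=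
      IsLocalization.under_map_of_isPrime_disjoint (Submonoid.powers a) B q.isPrime hd
    refine ⟨⟨q.asHomogeneousIdeal.map φ, hp, fun h ↦ q.not_irrelevant_le ?_⟩, ?_⟩
    · rw [HomogeneousIdeal.irrelevant_le]
      intro i hi x hx
      change x ∈ q.asHomogeneousIdeal.toIdeal
      rw [← hc]
      exact h (HomogeneousIdeal.mem_irrelevant_of_mem _ hi (mem_map φ hx))
    · apply ProjectiveSpectrum.ext
      apply HomogeneousIdeal.toIdeal_injective
      exact hc

theorem isOpenEmbedding (hu : IsUnit (φ a))
    (hs : ∀ x : B, ∃ (n : ℕ) (y : A), φ a ^ n * x = φ y)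
    (hi : ∀ x : A, φ x = 0 → ∃ n : ℕ, a ^ n * x = 0) :
    Topology.IsOpenEmbedding (Proj.map φ hφ) := by
  refine ⟨⟨⟨?_⟩, ?_⟩, ?_⟩
  · refine le_antisymm (continuous_iff_le_induced.mp (Proj.map φ hφ).continuous) ?_
    refine le_trans ?_ (ProjectiveSpectrum.isTopologicalBasis_basic_opens ℬ).eq_generateFrom.ge
    refine le_generateFrom ?_
    rintro _ ⟨x, rfl⟩
    obtain ⟨n, y, hy⟩ := hs x
    refine ⟨_, (ProjectiveSpectrum.basicOpen 𝒜 y).2, ?_⟩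
    ext p
    change φ y ∉ p.asHomogeneousIdeal.toIdeal ↔ x ∉ p.asHomogeneousIdeal.toIdeal
    rw [← hy, mul_mem_iff φ a hu]
  · intro p q h
    apply ProjectiveSpectrum.ext
    apply HomogeneousIdeal.toIdeal_injective
    ext x
    obtain ⟨n, y, hy⟩ := hs x
    rw [← mul_mem_iff φ a hu _ n, ← mul_mem_iff φ a hu q.asHomogeneousIdeal.toIdeal n, hy]
    have h' : (Proj.map φ hφ p).asHomogeneousIdeal.toIdeal =
      (Proj.map φ hφ q).asHomogeneousIdeal.toIdeal := by rw [h]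
    exact (Ideal.ext_iff.mp h' y)
  · rw [range_map φ hφ a hu hs hi]
    exact (ProjectiveSpectrum.basicOpen 𝒜 a).2

theorem den_notMem {I : Ideal A} [I.IsPrime] {J : Ideal B} [J.IsPrime] (hIJ : I = J.comap φ)
    (c : NumDenSameDeg 𝒜 I.primeCompl) : φ c.den ∈ J.primeCompl := by
  subst hIJ
  exact c.den_mem

theorem val_localRingHom_mk {I : Ideal A} [I.IsPrime] {J : Ideal B} [J.IsPrime]
    (hIJ : I = J.comap φ) (c : NumDenSameDeg 𝒜 I.primeCompl) :
    (localRingHom φ I J hIJ (HomogeneousLocalization.mk c)).val =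
      Localization.mk (φ c.num) ⟨φ c.den, den_notMem φ hIJ c⟩ := rfl

theorem bijective_localRingHom (ha : a ∈ 𝒜 0) (hu : IsUnit (φ a))
    (hs : ∀ x : B, ∃ (n : ℕ) (y : A), φ a ^ n * x = φ y)
    (hi : ∀ x : A, φ x = 0 → ∃ n : ℕ, a ^ n * x = 0) (I : Ideal A) [I.IsPrime] (J : Ideal B)
    [J.IsPrime] (hIJ : I = J.comap φ) :
    Function.Bijective (localRingHom φ I J hIJ) := by
  constructor
  · rw [injective_iff_map_eq_zero]
    intro z hz
    obtain ⟨c, rfl⟩ := HomogeneousLocalization.mk_surjective z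
    have h1 := congrArg HomogeneousLocalization.val hz
    rw [val_localRingHom_mk, val_zero, Localization.mk_eq_mk',
      IsLocalization.mk'_eq_zero_iff] at h1
    obtain ⟨⟨t, ht⟩, h⟩ := h1
    obtain ⟨n, y, hy⟩ := hs t
    have h2 : φ (y * c.num) = 0 := by
      rw [map_mul, ← hy, mul_assoc]
      change _ * (t * φ c.num) = 0
      rw [show t * φ c.num = 0 from h, mul_zero]
    obtain ⟨m, hm⟩ := hi _ h2
    apply HomogeneousLocalization.val_injective
    rw [val_mk, val_zero, Localization.mk_eq_mk', IsLocalization.mk'_eq_zero_iff]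
    refine ⟨⟨a ^ m * y, ?_⟩, by rw [← hm]; ring⟩
    subst hIJ
    change ¬ (φ (a ^ m * y) ∈ J)
    rw [map_mul, map_pow, mul_mem_iff φ a hu, ← hy, mul_mem_iff φ a hu]
    exact ht
  · intro z
    obtain ⟨c, rfl⟩ := HomogeneousLocalization.mk_surjective z
    obtain ⟨n, x, hx, hx'⟩ := surj_hom φ a ha hs c.num.2
    obtain ⟨m, y, hy, hy'⟩ := surj_hom φ a ha hs c.den.2
    have hmem : ∀ (k : ℕ) (w : A), w ∈ 𝒜 c.deg → a ^ k * w ∈ 𝒜 c.deg := by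
      intro k w hw
      simpa using SetLike.mul_mem_graded (SetLike.pow_mem_graded k ha) hw
    have hyI : a ^ n * y ∉ I := by
      subst hIJ
      change ¬ (φ (a ^ n * y) ∈ J)
      rw [map_mul, map_pow, mul_mem_iff φ a hu, ← hy', mul_mem_iff φ a hu]
      exact c.den_mem
    refine ⟨HomogeneousLocalization.mk ⟨c.deg, ⟨a ^ m * x, hmem m x hx⟩,
      ⟨a ^ n * y, hmem n y hy⟩, hyI⟩, ?_⟩
    apply HomogeneousLocalization.val_injective
    rw [val_localRingHom_mk, val_mk, Localization.mk_eq_mk',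
      IsLocalization.mk'_eq_iff_eq]
    congr 1
    change (c.den : B) * φ (a ^ m * x) = φ (a ^ n * y) * c.num
    rw [map_mul, map_mul, ← hx', ← hy', map_pow, map_pow]
    ring

theorem isOpenImmersion (ha : a ∈ 𝒜 0) (hu : IsUnit (φ a))
    (hs : ∀ x : B, ∃ (n : ℕ) (y : A), φ a ^ n * x = φ y)
    (hi : ∀ x : A, φ x = 0 → ∃ n : ℕ, a ^ n * x = 0) :
    IsOpenImmersion (Proj.map φ hφ) := by
  rw [IsOpenImmersion.iff_isIso_stalkMap]
  refine ⟨isOpenEmbedding φ hφ a hu hs hi, fun x ↦ ?_⟩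
  have h := Proj.localRingHom_comp_stalkIso φ hφ x
  change IsIso ((Proj.sheafedSpaceMap φ hφ).hom.stalkMap x)
  rw [← h]
  have hx := x.isPrime
  have : IsIso (CommRingCat.ofHom (localRingHom φ
      (ProjectiveSpectrum.comap φ hφ x).asHomogeneousIdeal.toIdeal
      x.asHomogeneousIdeal.toIdeal rfl)) := by
    rw [ConcreteCategory.isIso_iff_bijective]
    exact bijective_localRingHom φ a ha hu hs hi _ _ rfl
  exact IsIso.comp_isIso' (Iso.isIso_hom _) (IsIso.comp_isIso' this (Iso.isIso_inv _))
end ProjLoc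

namespace RelProj
open SymGrading

section affine
variable (R M : Type u) [CommRing R] [AddCommGroup M] [Module R M]

/-- The structure morphism `Proj (Sym_R M) ⟶ Spec R`. -/
def toSpec : Proj (symPart R M) ⟶ Spec (.of R) :=
  Proj.toSpecZero (symPart R M) ≫ Spec.map (CommRingCat.ofHom (algebraMap R (symPart R M 0)))

variable {R M}

/-- The map `R → ((Sym_R M)_s)₀`. -/
def toAway (s : SymmetricAlgebra R M) : R →+* Away (symPart R M) s :=
  (HomogeneousLocalization.fromZeroRingHom (symPart R M) _).comp (algebraMap R (symPart R M 0))

theorem val_toAway (s : SymmetricAlgebra R M) (r : R) :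
    (toAway s r).val = Localization.mk (algebraMap R (SymmetricAlgebra R M) r) 1 := rfl

theorem awayι_toSpec {s : SymmetricAlgebra R M} {m : ℕ} (hs : s ∈ symPart R M m) (hm : 0 < m) :
    Proj.awayι (symPart R M) s hs hm ≫ toSpec R M = Spec.map (CommRingCat.ofHom (toAway s)) := by
  rw [toSpec, Proj.awayι_toSpecZero_assoc, ← Spec.map_comp, ← CommRingCat.ofHom_comp]
  rfl

theorem awayι_mem_iff (f : R) {s : SymmetricAlgebra R M} {m : ℕ} (hs : s ∈ symPart R M m)
    (hm : 0 < m) (q : Spec (.of (Away (symPart R M) s))) :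
    algebraMap R _ f ∈ (Proj.awayι (symPart R M) s hs hm q).asHomogeneousIdeal ↔
      toAway s f ∈ q.asIdeal := by
  have hs1 : s ∉ (Proj.awayι (symPart R M) s hs hm q).asHomogeneousIdeal.toIdeal := by
    have h : Proj.awayι (symPart R M) s hs hm q ∈ (Proj.awayι (symPart R M) s hs hm).opensRange :=
      ⟨q, rfl⟩
    rw [Proj.opensRange_awayι] at h
    exact h
  have hfs : algebraMap R (SymmetricAlgebra R M) f * s ∈ symPart R M m := by
    rw [← Algebra.smul_def]; exact Submodule.smul_mem _ _ hs
  have h1 := Proj.awayι_preimage_basicOpen (symPart R M) hs hm hfs hm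
  have h2 : q ∈ Proj.awayι (symPart R M) s hs hm ⁻¹ᵁ
      Proj.basicOpen (symPart R M) (algebraMap R _ f * s) ↔
      q ∈ PrimeSpectrum.basicOpen (Away.isLocalizationElem hs hfs) := by rw [h1]; exact Iff.rfl
  have h3 : Away.isLocalizationElem hs hfs = toAway s f ^ m := by
    apply HomogeneousLocalization.val_injective
    rw [Away.val_mk, val_pow, val_toAway, Localization.mk_pow, Localization.mk_eq_mk_iff,
      Localization.r_iff_exists]
    exact ⟨1, by simp [mul_pow]; ring⟩
  rw [h3] at h2
  have h4 := (Proj.awayι (symPart R M) s hs hm q).isPrime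
  have h5 : algebraMap R _ f ∈ (Proj.awayι (symPart R M) s hs hm q).asHomogeneousIdeal.toIdeal ↔
      algebraMap R _ f * s ∈
        (Proj.awayι (symPart R M) s hs hm q).asHomogeneousIdeal.toIdeal :=
    ⟨fun h ↦ Ideal.mul_mem_right _ _ h, fun h ↦ (h4.mem_or_mem h).resolve_right hs1⟩
  have h6 : toAway s f ∈ q.asIdeal ↔ toAway s f ^ m ∈ q.asIdeal :=
    ⟨fun h ↦ Ideal.pow_mem_of_mem _ h _ hm, fun h ↦ q.isPrime.mem_of_pow_mem _ h⟩
  exact h5.trans ((not_iff_not.mp h2).trans h6.symm)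

theorem toSpec_preimage (f : R) :
    toSpec R M ⁻¹' (PrimeSpectrum.basicOpen f : Set (PrimeSpectrum R)) =
      {p : Proj (symPart R M) | algebraMap R _ f ∉ p.asHomogeneousIdeal} := by
  have key : ∀ {s : SymmetricAlgebra R M} {m : ℕ} (hs : s ∈ symPart R M m) (hm : 0 < m)
      (q : Spec (.of (Away (symPart R M) s))),
      toSpec R M (Proj.awayι (symPart R M) s hs hm q) ∈
        (PrimeSpectrum.basicOpen f : Set (PrimeSpectrum R)) ↔
      algebraMap R _ f ∉ (Proj.awayι (symPart R M) s hs hm q).asHomogeneousIdeal := by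
    intro s m hs hm q
    rw [awayι_mem_iff, ← Scheme.Hom.comp_apply, awayι_toSpec]
    rfl
  ext p
  obtain ⟨i, q, rfl⟩ := (Proj.affineOpenCover (symPart R M)).openCover.exists_eq p
  exact key i.2.2 i.1.2 q

variable {R' M' : Type u} [CommRing R'] [AddCommGroup M'] [Module R' M']

theorem map_toSpec {σ : R →+* R'} (g : M →ₛₗ[σ] M')
    (hg : HomogeneousIdeal.irrelevant (symPart R' M') ≤
      (HomogeneousIdeal.irrelevant (symPart R M)).map (symGradedMap g)) :
    Proj.map (symGradedMap g) hg ≫ toSpec R M =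
      toSpec R' M' ≫ Spec.map (CommRingCat.ofHom σ) := by
  have key : ∀ {s : SymmetricAlgebra R M} {m : ℕ} (hs : s ∈ symPart R M m) (hm : 0 < m),
      Proj.awayι (symPart R' M') (symGradedMap g s) (symGradedMap_mem g hs) hm ≫
        Proj.map (symGradedMap g) hg ≫ toSpec R M =
      Proj.awayι (symPart R' M') (symGradedMap g s) (symGradedMap_mem g hs) hm ≫
        toSpec R' M' ≫ Spec.map (CommRingCat.ofHom σ) := by
    intro s m hs hm
    have h := Proj.awayι_comp_map_assoc (symGradedMap g) hg hm s hs (toSpec R M)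
    refine h.trans ?_
    rw [awayι_toSpec, ← Category.assoc, awayι_toSpec, ← Spec.map_comp, ← Spec.map_comp,
      ← CommRingCat.ofHom_comp, ← CommRingCat.ofHom_comp]
    congr 2
    ext r
    change (Away.map (symGradedMap g) s (toAway s r)).val = (toAway (symGradedMap g s) (σ r)).val
    rw [val_toAway, ← symMap_algebraMap g]
    change Localization.mk (symMap g (algebraMap R _ r)) ⟨symMap g 1, _⟩ = _
    congr 1
    exact Subtype.ext (map_one _)
  exact (Proj.mapAffineOpenCover _ hg).openCover.hom_ext _ _ fun s ↦ key s.2.2 s.1.2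

end affine
end RelProj

namespace RelProj
open SymGrading

section localization
variable {R M R' M' : Type u} [CommRing R] [AddCommGroup M] [Module R M] [CommRing R']
  [AddCommGroup M'] [Module R' M']

/-- `σ : R → R'` exhibits `R'` as `R[1/f]`, and `g : M → M'` exhibits `M'` as `M[1/f]`. -/
structure IsLocAway (f : R) {σ : R →+* R'} (g : M →ₛₗ[σ] M') : Prop where
  isUnit : IsUnit (σ f)
  surj : ∀ r' : R', ∃ (n : ℕ) (r : R), σ f ^ n * r' = σ r
  inj : ∀ r : R, σ r = 0 → ∃ n : ℕ, f ^ n * r = 0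
  surj_mod : ∀ m' : M', ∃ (n : ℕ) (m : M), σ f ^ n • m' = g m
  inj_mod : ∀ m : M, g m = 0 → ∃ n : ℕ, f ^ n • m = 0

variable {f : R} {σ : R →+* R'} {g : M →ₛₗ[σ] M'}

theorem IsLocAway.span_eq_top (h : IsLocAway f g) : Submodule.span R' (Set.range g) = ⊤ := by
  rw [eq_top_iff]
  intro m' _
  obtain ⟨n, m, hm⟩ := h.surj_mod m'
  obtain ⟨u, hu⟩ := h.isUnit.pow n
  have : m' = (↑u⁻¹ : R') • g m := by
    rw [← hm, ← hu, smul_smul, Units.inv_mul, one_smul]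
  rw [this]
  exact Submodule.smul_mem _ _ (Submodule.subset_span ⟨m, rfl⟩)

theorem IsLocAway.exists_symMap (h : IsLocAway f g) :
    (∀ x : SymmetricAlgebra R' M', ∃ (n : ℕ) (y : SymmetricAlgebra R M),
      symMap g (algebraMap R _ f) ^ n * x = symMap g y) ∧
    (∀ x : SymmetricAlgebra R M, symMap g x = 0 → ∃ n : ℕ, algebraMap R _ f ^ n * x = 0) := by
  letI : Algebra R R' := σ.toAlgebra
  letI : Module R M' := Module.compHom M' σ
  haveI : IsScalarTower R R' M' := ⟨fun r s m ↦ by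
    change (σ r * s) • m = σ r • s • m
    rw [mul_smul]⟩
  let g' : M →ₗ[R] M' :=
    { toFun := g, map_add' := map_add g, map_smul' := fun r m ↦ map_smulₛₗ g r m }
  haveI : IsLocalization.Away f R' := by
    rw [IsLocalization.Away, isLocalization_iff]
    refine ⟨?_, ?_, ?_⟩
    · rintro ⟨_, n, rfl⟩
      change IsUnit (σ (f ^ n))
      rw [map_pow]; exact h.isUnit.pow n
    · intro z
      obtain ⟨n, y, hy⟩ := h.surj z
      refine ⟨⟨y, ⟨f ^ n, n, rfl⟩⟩, ?_⟩
      change z * σ (f ^ n) = σ y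
      rw [map_pow, mul_comm, hy]
    · intro x y (hxy : σ x = σ y)
      obtain ⟨n, hn⟩ := h.inj (x - y) (by rw [map_sub, hxy, sub_self])
      exact ⟨⟨f ^ n, n, rfl⟩, by rwa [mul_sub, sub_eq_zero] at hn⟩
  haveI : IsLocalizedModule (.powers f) g' := by
    refine ⟨?_, ?_, ?_⟩
    · rintro ⟨_, n, rfl⟩
      rw [Module.End.isUnit_iff]
      obtain ⟨u, hu⟩ := h.isUnit.pow n
      have hsm : ∀ m : M', (algebraMap R (Module.End R M') (f ^ n)) m = (u : R') • m := by
        intro m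
        change σ (f ^ n) • m = _
        rw [map_pow, hu]
      constructor
      · intro a b hab
        have hab' : (algebraMap R (Module.End R M') (f ^ n)) a =
          (algebraMap R (Module.End R M') (f ^ n)) b := hab
        rw [hsm, hsm] at hab'
        have := congrArg (fun z ↦ (↑u⁻¹ : R') • z) hab'
        simpa only [smul_smul, Units.inv_mul, one_smul] using this
      · intro b
        refine ⟨(↑u⁻¹ : R') • b, ?_⟩
        refine (hsm _).trans ?_
        rw [smul_smul, Units.mul_inv, one_smul]
    · intro m'
      obtain ⟨n, m, hm⟩ := h.surj_mod m'
      refine ⟨⟨m, ⟨f ^ n, n, rfl⟩⟩, ?_⟩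
      change σ (f ^ n) • m' = g m
      rw [map_pow, hm]
    · intro a b (hab : g a = g b)
      obtain ⟨n, hn⟩ := h.inj_mod (a - b) (by rw [map_sub, hab, sub_self])
      exact ⟨⟨f ^ n, n, rfl⟩, by rwa [smul_sub, sub_eq_zero] at hn⟩
  have hg : toSemilinear (R' := R') g' = g := rfl
  refine ⟨fun x ↦ ?_, fun x hx ↦ symMap_inj (R' := R') f g' x hx⟩
  obtain ⟨n, y, hy⟩ := symMap_surj (R' := R') f g' x
  refine ⟨n, y, ?_⟩
  rw [symMap_algebraMap]
  exact hy

theorem IsLocAway.irrelevant_le (h : IsLocAway f g) :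
    HomogeneousIdeal.irrelevant (symPart R' M') ≤
      (HomogeneousIdeal.irrelevant (symPart R M)).map (symGradedMap g) :=
  SymGrading.irrelevant_le g h.span_eq_top

theorem IsLocAway.isUnit_symMap (h : IsLocAway f g) :
    IsUnit (symGradedMap g (algebraMap R (SymmetricAlgebra R M) f)) := by
  rw [symGradedMap_apply, symMap_algebraMap]
  exact h.isUnit.map _

theorem IsLocAway.isOpenImmersion (h : IsLocAway f g) (hg) :
    IsOpenImmersion (Proj.map (symGradedMap g) hg) :=
  ProjLoc.isOpenImmersion _ _ (algebraMap R _ f) (SetLike.algebraMap_mem_graded (symPart R M) f)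
    h.isUnit_symMap h.exists_symMap.1 h.exists_symMap.2

theorem IsLocAway.range_map (h : IsLocAway f g) (hg) :
    Set.range (Proj.map (symGradedMap g) hg) =
      toSpec R M ⁻¹' (PrimeSpectrum.basicOpen f : Set (PrimeSpectrum R)) := by
  rw [toSpec_preimage]
  exact ProjLoc.range_map _ _ (algebraMap R _ f)
    h.isUnit_symMap h.exists_symMap.1 h.exists_symMap.2

end localization
end RelProj

namespace RelProj
open SymGrading

section sections
variable {X : Scheme.{u}} (M : X.Modules)

/-- Restriction of sections of a sheaf of modules, as a semilinear map. -/
def res {U V : X.Opens} (h : V ≤ U) :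
    Γ(M, U) →ₛₗ[(X.presheaf.map (homOfLE h).op).hom] Γ(M, V) where
  toFun := M.presheaf.map (homOfLE h).op
  map_add' := map_add _
  map_smul' r m := M.map_smul (homOfLE h) r m

theorem res_res {U V W : X.Opens} (h : V ≤ U) (h' : W ≤ V) (m : Γ(M, U)) :
    res M h' (res M h m) = res M (h'.trans h) m := by
  change (M.presheaf.map _ ≫ M.presheaf.map _) m = _
  rw [← Functor.map_comp]
  rfl

theorem res_self {U : X.Opens} (h : U ≤ U) (m : Γ(M, U)) : res M h m = m := by
  change M.presheaf.map (𝟙 _) m = m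
  rw [CategoryTheory.Functor.map_id]
  rfl

theorem appIso_inv_fromSpec {U : X.Opens} (hU : IsAffineOpen U)
    (W : (Spec Γ(X, U)).Opens) (h : hU.fromSpec ''ᵁ W ≤ U) (r : Γ(X, U)) :
    (hU.fromSpec.appIso W).inv ((Spec Γ(X, U)).presheaf.map W.leTop.op
      ((Scheme.ΓSpecIso Γ(X, U)).inv r)) = X.presheaf.map (homOfLE h).op r := by
  have h1 : X.presheaf.map (homOfLE h).op ≫ (hU.fromSpec.appIso W).hom =
      (Scheme.ΓSpecIso Γ(X, U)).inv ≫ (Spec Γ(X, U)).presheaf.map W.leTop.op := by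
    rw [Scheme.Hom.appIso_hom, Scheme.Hom.naturality_assoc, hU.fromSpec_app_self]
    simp only [Category.assoc, ← Functor.map_comp]
    rfl
  have h2 : (Scheme.ΓSpecIso Γ(X, U)).inv ≫ (Spec Γ(X, U)).presheaf.map W.leTop.op ≫
      (hU.fromSpec.appIso W).inv = X.presheaf.map (homOfLE h).op := by
    rw [← Category.assoc, ← h1, Category.assoc, Iso.hom_inv_id, Category.comp_id]
  exact congr($h2 r)

theorem smul_restrict_fromSpec {U : X.Opens} (hU : IsAffineOpen U)
    (W : (Spec Γ(X, U)).Opens) (h : hU.fromSpec ''ᵁ W ≤ U) (r : Γ(X, U))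
    (x : Γ(M.restrict hU.fromSpec, W)) (y : Γ(M, hU.fromSpec ''ᵁ W)) (hxy : x = y) :
    (show Γ(M, hU.fromSpec ''ᵁ W) from r • x) = X.presheaf.map (homOfLE h).op r • y := by
  subst hxy
  rw [← appIso_inv_fromSpec hU W h r]
  rfl

theorem isLocAway_res [M.IsQuasicoherent] {U : X.Opens} (hU : IsAffineOpen U) (f : Γ(X, U)) :
    IsLocAway f (res M (X.basicOpen_le f)) := by
  have hloc := hU.isLocalization_basicOpen f
  let N := M.restrict hU.fromSpec
  have hN : IsIso N.fromTildeΓ := inferInstance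
  rw [isIso_fromTildeΓ_iff_isLocalizing] at hN
  have hf := hN f
  have e1 : hU.fromSpec ''ᵁ PrimeSpectrum.basicOpen f = X.basicOpen f :=
    hU.fromSpec_image_basicOpen f
  have e0 : hU.fromSpec ''ᵁ ⊤ = U := by
    rw [Scheme.Hom.image_top_eq_opensRange, hU.opensRange_fromSpec]
  have h10 : hU.fromSpec ''ᵁ PrimeSpectrum.basicOpen f ≤ hU.fromSpec ''ᵁ ⊤ :=
    Scheme.Hom.image_mono _ le_top
  refine ⟨?_, ?_, ?_, ?_, ?_⟩
  · exact IsLocalization.Away.algebraMap_isUnit (S := Γ(X, X.basicOpen f)) f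
  · intro r'
    obtain ⟨⟨a, ⟨_, n, rfl⟩⟩, h⟩ := IsLocalization.surj (Submonoid.powers f) r'
    refine ⟨n, a, ?_⟩
    rw [← map_pow, mul_comm]
    exact h
  · intro r hr
    obtain ⟨⟨_, n, rfl⟩, hn⟩ := (IsLocalization.map_eq_zero_iff (Submonoid.powers f)
      Γ(X, X.basicOpen f) r).mp hr
    exact ⟨n, hn⟩
  · intro m'
    have h1 : ∃ (n : ℕ) (x : Γ(M, hU.fromSpec ''ᵁ ⊤)),
        X.presheaf.map (homOfLE (e1.le.trans (X.basicOpen_le f))).op (f ^ n) •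
          res M e1.le m' = res M h10 x := by
      obtain ⟨⟨x, ⟨_, n, rfl⟩⟩, h⟩ := hf.surj (res M e1.le m')
      exact ⟨n, x, (smul_restrict_fromSpec M hU _ (e1.le.trans (X.basicOpen_le f))
        (f ^ n) _ _ rfl).symm.trans h⟩
    obtain ⟨n, x, h1⟩ := h1
    refine ⟨n, res M e0.ge x, ?_⟩
    have h2 := congrArg (res M e1.ge) h1
    rw [map_smulₛₗ, res_res, res_self, res_res] at h2
    rw [res_res]
    refine Eq.trans ?_ h2
    congr 1
    rw [← map_pow]
    change _ = (X.presheaf.map _ ≫ X.presheaf.map _) (f ^ n)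
    rw [← Functor.map_comp]
    rfl
  · intro m hm
    have h0 : res M h10 (res M e0.le m) = 0 := by
      rw [res_res, ← res_res M (X.basicOpen_le f) e1.le, hm, map_zero]
    obtain ⟨⟨_, n, rfl⟩, hn⟩ := hf.exists_of_eq (x₁ := res M e0.le m) (x₂ := 0)
      (h0.trans (map_zero (res M h10)).symm)
    have h1 : X.presheaf.map (homOfLE e0.le).op (f ^ n) • res M e0.le m = 0 :=
      (smul_restrict_fromSpec M hU ⊤ e0.le (f ^ n) _ _ rfl).symm.trans
        (hn.trans (smul_zero _))
    refine ⟨n, ?_⟩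
    have h2 := congrArg (res M e0.ge) h1
    rw [map_smulₛₗ, res_res, res_self, map_zero] at h2
    refine Eq.trans ?_ h2
    congr 1
    change _ = (X.presheaf.map _ ≫ X.presheaf.map _) (f ^ n)
    rw [← Functor.map_comp]
    exact congr($((CategoryTheory.Functor.map_id X.presheaf _).symm) (f ^ n))
end sections
end RelProj

namespace RelProj
open SymGrading

section functoriality
variable {R R' R'' M M' M'' : Type u} [CommRing R] [CommRing R'] [CommRing R'']
  [AddCommGroup M] [AddCommGroup M'] [AddCommGroup M''] [Module R M] [Module R' M'] [Module R'' M'']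

theorem projMap_congr {f g : symPart R M →+*ᵍ symPart R' M'} (h : f = g)
    (hf : HomogeneousIdeal.irrelevant (symPart R' M') ≤
      (HomogeneousIdeal.irrelevant (symPart R M)).map f)
    (hg : HomogeneousIdeal.irrelevant (symPart R' M') ≤
      (HomogeneousIdeal.irrelevant (symPart R M)).map g) :
    Proj.map f hf = Proj.map g hg := by
  subst h; rfl

theorem symGradedMap_id {σ : R →+* R} (g : M →ₛₗ[σ] M) (hσ : ∀ r, σ r = r) (hg : ∀ m, g m = m) :
    symGradedMap g = .id (symPart R M) := by
  have h : symMap g = RingHom.id _ := by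
    refine ringHom_ext (fun r ↦ ?_) fun m ↦ ?_
    · rw [symMap_algebraMap, hσ]; rfl
    · rw [symMap_ι, hg]; rfl
  ext x
  exact congr($h x)

theorem symGradedMap_comp {σ : R →+* R'} {τ : R' →+* R''} {ρ : R →+* R''} (g : M →ₛₗ[σ] M')
    (g' : M' →ₛₗ[τ] M'') (g'' : M →ₛₗ[ρ] M'') (hρ : ∀ r, ρ r = τ (σ r))
    (hg : ∀ m, g'' m = g' (g m)) :
    symGradedMap g'' = (symGradedMap g').comp (symGradedMap g) := by
  have h : symMap g'' = (symMap g').comp (symMap g) := by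
    refine ringHom_ext (fun r ↦ ?_) fun m ↦ ?_
    · rw [RingHom.comp_apply, symMap_algebraMap, symMap_algebraMap, symMap_algebraMap, hρ]
    · rw [RingHom.comp_apply, symMap_ι, symMap_ι, symMap_ι, hg]
  ext x
  exact congr($h x)

end functoriality

section glue
variable {X : Scheme.{u}} (M : X.Modules) [M.IsQuasicoherent]
open Scheme (AffineZariskiSite)

theorem exists_isLocAway {U V : X.AffineZariskiSite} (h : U ≤ V) :
    ∃ f : Γ(X, V.1), X.basicOpen f = U.1 ∧
      IsLocAway f (res M (AffineZariskiSite.toOpens_mono h)) := by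
  obtain ⟨f, hf⟩ := id h
  obtain rfl : V.basicOpen f = U := Subtype.ext hf
  exact ⟨f, rfl, isLocAway_res M V.2 f⟩

/-- The scheme `Proj (Sym Γ(M, U))`. -/
abbrev localProj (U : X.AffineZariskiSite) : Scheme.{u} := Proj (symPart Γ(X, U.1) Γ(M, U.1))

theorem localMap_irrelevant {U V : X.AffineZariskiSite} (h : U ≤ V) :
    HomogeneousIdeal.irrelevant (symPart Γ(X, U.1) Γ(M, U.1)) ≤
      (HomogeneousIdeal.irrelevant (symPart Γ(X, V.1) Γ(M, V.1))).map
        (symGradedMap (res M (AffineZariskiSite.toOpens_mono h))) :=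
  (exists_isLocAway M h).choose_spec.2.irrelevant_le

/-- The morphism `Proj (Sym Γ(M, U)) ⟶ Proj (Sym Γ(M, V))` for `U ⊆ V`. -/
def localMap {U V : X.AffineZariskiSite} (h : U ≤ V) : localProj M U ⟶ localProj M V :=
  Proj.map (symGradedMap (res M (AffineZariskiSite.toOpens_mono h))) (localMap_irrelevant M h)

theorem localMap_id (U : X.AffineZariskiSite) : localMap M (le_refl U) = 𝟙 _ := by
  rw [← Proj.map_id]
  refine projMap_congr (symGradedMap_id _ (fun r ↦ ?_) fun m ↦ res_self M _ m) _ _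
  exact congr($(CategoryTheory.Functor.map_id X.presheaf _) r)

theorem localMap_comp {U V W : X.AffineZariskiSite} (h : U ≤ V) (h' : V ≤ W) :
    localMap M (h.trans h') = localMap M h ≫ localMap M h' := by
  unfold localMap
  rw [← Proj.map_comp]
  refine projMap_congr (symGradedMap_comp _ _ _ (fun r ↦ ?_) fun m ↦ (res_res M _ _ m).symm) _ _
  exact congr($(CategoryTheory.Functor.map_comp X.presheaf
    (homOfLE (AffineZariskiSite.toOpens_mono h')).op
    (homOfLE (AffineZariskiSite.toOpens_mono h)).op) r)

/-- The functor `U ↦ Proj (Sym Γ(M, U))` on affine opens. -/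
def localProjFunctor : X.AffineZariskiSite ⥤ Scheme.{u} where
  obj U := localProj M U
  map f := localMap M (leOfHom f)
  map_id U := localMap_id M U
  map_comp f g := localMap_comp M (leOfHom f) (leOfHom g)

/-- The structure morphisms `Proj (Sym Γ(M, U)) ⟶ Spec Γ(X, U)`. -/
def localToSpec : localProjFunctor M ⟶
    AffineZariskiSite.toOpensFunctor X ⋙ X.presheaf.rightOp ⋙ Scheme.Spec where
  app U := toSpec Γ(X, U.1) Γ(M, U.1)
  naturality _ _ f := map_toSpec (res M (AffineZariskiSite.toOpens_mono (leOfHom f)))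
    (localMap_irrelevant M (leOfHom f))

theorem isPullback_localMap {U V : X.AffineZariskiSite} (h : U ≤ V) :
    IsPullback (toSpec Γ(X, U.1) Γ(M, U.1)) (localMap M h)
      (Spec.map (X.presheaf.map (homOfLE (AffineZariskiSite.toOpens_mono h)).op))
      (toSpec Γ(X, V.1) Γ(M, V.1)) := by
  obtain ⟨f, hf, hl⟩ := exists_isLocAway M h
  obtain rfl : V.basicOpen f = U := Subtype.ext hf
  have : IsOpenImmersion (localMap M h) := hl.isOpenImmersion _
  have : IsLocalization.Away f Γ(X, X.basicOpen f) := V.2.isLocalization_basicOpen f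
  have : IsOpenImmersion
      (Spec.map (X.presheaf.map (homOfLE (AffineZariskiSite.toOpens_mono h)).op)) :=
    IsOpenImmersion.of_isLocalization (S := Γ(X, X.basicOpen f)) f
  refine IsOpenImmersion.isPullback _ _ _ _ (map_toSpec _ _) ?_
  refine TopologicalSpace.Opens.ext ?_
  refine Eq.trans ?_ (hl.range_map _).symm
  have hr : Set.range (Spec.map (X.presheaf.map (homOfLE (AffineZariskiSite.toOpens_mono h)).op)) =
      (PrimeSpectrum.basicOpen f : Set (PrimeSpectrum Γ(X, V.1))) :=
    PrimeSpectrum.localization_away_comap_range Γ(X, X.basicOpen f) f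
  exact congrArg (fun s : Set (PrimeSpectrum Γ(X, V.1)) ↦
    (fun x ↦ toSpec Γ(X, V.1) Γ(M, V.1) x) ⁻¹' s) hr

theorem equifibered_localToSpec : (localToSpec M).Equifibered :=
  fun _ _ f ↦ (isPullback_localMap M (leOfHom f)).flip

theorem equifibered_localToBase :
    (localToSpec M ≫ (AffineZariskiSite.restrictIsoSpec X).inv).Equifibered := by
  have : IsIso (AffineZariskiSite.restrictIsoSpec X).inv := Iso.isIso_inv _
  exact (equifibered_localToSpec M).comp (.of_isIso _)

/-- The gluing datum for the relative `Proj` of `Sym M`. -/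
def gluingData : (AffineZariskiSite.directedCover X).RelativeGluingData where
  functor := localProjFunctor M
  natTrans := localToSpec M ≫ (AffineZariskiSite.restrictIsoSpec X).inv
  equifibered := equifibered_localToBase M

end glue
end RelProj

/-- The projectivization `Proj (Sym M)` of a quasi-coherent sheaf `M` on `X`. -/
def projectivization {X : Scheme.{u}} (M : X.Modules) [M.IsQuasicoherent] : Scheme.{u} :=
  (RelProj.gluingData M).glued

/-- The structure morphism of the projectivization. -/
def projectivizationHom {X : Scheme.{u}} (M : X.Modules) [M.IsQuasicoherent] :
    projectivization M ⟶ X :=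
  (RelProj.gluingData M).toBase

attribute [local instance] MvPolynomial.gradedAlgebra

section projectiveSpace
variable (k : Type u) [Field k]

/-- Projective space `ℙⁿ` over `k`. -/
abbrev projSpace (n : ℕ) : Scheme.{u} := Proj (MvPolynomial.homogeneousSubmodule (Fin (n + 1)) k)

/-- The structure morphism `ℙⁿ ⟶ Spec k`. -/
def projSpaceToSpec (n : ℕ) : projSpace k n ⟶ Spec (.of k) :=
  Proj.toSpecZero _ ≫ Spec.map (CommRingCat.ofHom
    (algebraMap k (MvPolynomial.homogeneousSubmodule (Fin (n + 1)) k 0)))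

variable {k}

theorem aeval_mem_homogeneousSubmodule {m n d : ℕ}
    (F : Fin (m + 1) → MvPolynomial (Fin (n + 1)) k) (hF : ∀ i, (F i).IsHomogeneous d) (i : ℕ)
    (a : MvPolynomial (Fin (m + 1)) k)
    (ha : a ∈ MvPolynomial.homogeneousSubmodule (Fin (m + 1)) k i) :
    (MvPolynomial.aeval F).toRingHom a ∈
      MvPolynomial.homogeneousSubmodule (Fin (n + 1)) k (d * i) :=
  MvPolynomial.IsHomogeneous.aeval ha F hF

/-- The morphism `ℙⁿ ⟶ ℙᵐ`, `x ↦ [F₀(x), …, Fₘ(x)]`, given by forms `Fᵢ` of the same positive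
degree `d` without common zero. -/
def projSpaceMap {m n d : ℕ} (hd : 0 < d) (F : Fin (m + 1) → MvPolynomial (Fin (n + 1)) k)
    (hF : ∀ i, (F i).IsHomogeneous d)
    (hcov : ∀ p : ProjectiveSpectrum (MvPolynomial.homogeneousSubmodule (Fin (n + 1)) k),
      ∃ i, F i ∉ p.asHomogeneousIdeal) : projSpace k n ⟶ projSpace k m :=
  ProjDeg.projMap _ _ (MvPolynomial.aeval F).toRingHom d (aeval_mem_homogeneousSubmodule F hF) hd
    (fun i : Fin (m + 1) ↦ MvPolynomial.X i) (fun _ ↦ 1) (fun i ↦ MvPolynomial.isHomogeneous_X k i)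
    (fun _ ↦ one_pos) fun p ↦ by
      obtain ⟨i, hi⟩ := hcov p
      refine ⟨i, ?_⟩
      rwa [AlgHom.toRingHom_eq_coe, RingHom.coe_coe, MvPolynomial.aeval_X]

end projectiveSpace

section curve
variable (k : Type u) [Field k] (b : ℕ)

/-- The forms `S ^ (3b+5)`, `S ^ (3b+2) T ^ 3`, `T ^ (3b+5)`, `S T ^ (3b+4)`. -/
def curveForms : Fin 4 → MvPolynomial (Fin 2) k :=
  ![MvPolynomial.X 0 ^ (3 * b + 5), MvPolynomial.X 0 ^ (3 * b + 2) * MvPolynomial.X 1 ^ 3,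
    MvPolynomial.X 1 ^ (3 * b + 5), MvPolynomial.X 0 * MvPolynomial.X 1 ^ (3 * b + 4)]

theorem curveForms_isHomogeneous (i : Fin 4) : (curveForms k b i).IsHomogeneous (3 * b + 5) := by
  have hX := fun i : Fin 2 ↦ MvPolynomial.isHomogeneous_X k i
  fin_cases i
  · have := (hX 0).pow (3 * b + 5)
    rw [one_mul] at this
    exact this
  · have := ((hX 0).pow (3 * b + 2)).mul ((hX 1).pow 3)
    rw [show 1 * (3 * b + 2) + 1 * 3 = 3 * b + 5 by ring] at this
    exact this
  · have := (hX 1).pow (3 * b + 5)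
    rw [one_mul] at this
    exact this
  · have := (hX 0).mul ((hX 1).pow (3 * b + 4))
    rw [show 1 + 1 * (3 * b + 4) = 3 * b + 5 by ring] at this
    exact this

theorem exists_curveForms_notMem
    (p : ProjectiveSpectrum (MvPolynomial.homogeneousSubmodule (Fin 2) k)) :
    ∃ i, curveForms k b i ∉ p.asHomogeneousIdeal := by
  by_contra! h
  have h0 : (MvPolynomial.X 0 : MvPolynomial (Fin 2) k) ∈ p.asHomogeneousIdeal.toIdeal :=
    p.isPrime.mem_of_pow_mem _ (h 0)
  have h1 : (MvPolynomial.X 1 : MvPolynomial (Fin 2) k) ∈ p.asHomogeneousIdeal.toIdeal :=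
    p.isPrime.mem_of_pow_mem _ (h 2)
  refine p.not_irrelevant_le ((HomogeneousIdeal.irrelevant_le _).mpr fun i hi x hx ↦ ?_)
  change x ∈ p.asHomogeneousIdeal.toIdeal
  have hx' : MvPolynomial.IsHomogeneous x i := hx
  rw [x.as_sum]
  refine Ideal.sum_mem _ fun e he ↦ ?_
  have hd : e.degree = i := by
    by_contra hne
    exact (MvPolynomial.mem_support_iff.mp he) (hx'.coeff_eq_zero hne)
  obtain ⟨j, hj⟩ : ∃ j, e j ≠ 0 := by
    by_contra! h0
    have : e = 0 := Finsupp.ext h0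
    rw [this, map_zero] at hd
    exact absurd hd hi.ne
  have hXj : (MvPolynomial.X j : MvPolynomial (Fin 2) k) ∈ p.asHomogeneousIdeal.toIdeal := by
    fin_cases j
    · exact h0
    · exact h1
  exact Ideal.mem_of_dvd _ ((MvPolynomial.X_dvd_monomial).mpr (Or.inr hj)) hXj

/-- The morphism `ℙ¹ ⟶ ℙ³`, `[S, T] ↦ [S^(3b+5), S^(3b+2) T^3, T^(3b+5), S T^(3b+4)]`. -/
def curveParam : projSpace k 1 ⟶ projSpace k 3 :=
  projSpaceMap (show 0 < 3 * b + 5 by omega) (curveForms k b) (curveForms_isHomogeneous k b)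
    (exists_curveForms_notMem k b)

/-- The curve `X`: the scheme-theoretic image of `ℙ¹ ⟶ ℙ³`. -/
def curve : Scheme.{u} := (curveParam k b).image

/-- The closed immersion `X ⟶ ℙ³`. -/
def curveι : curve k b ⟶ projSpace k 3 := (curveParam k b).imageι

/-- The structure morphism `X ⟶ Spec k`. -/
def curveToSpec : curve k b ⟶ Spec (.of k) := curveι k b ≫ projSpaceToSpec k 3

/-- The open subscheme `X₁ ⊆ X` on which the first projective coordinate does not vanish. -/
def curveChart : (curve k b).Opens :=
  curveι k b ⁻¹ᵁ Proj.basicOpen (MvPolynomial.homogeneousSubmodule (Fin 4) k) (MvPolynomial.X 0)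

/-- The ratio of the `i`-th and the first projective coordinate, as a function on `X₁`. -/
def curveCoord (i : Fin 4) : Γ(curve k b, curveChart k b) :=
  (curveι k b).app (Proj.basicOpen (MvPolynomial.homogeneousSubmodule (Fin 4) k) (MvPolynomial.X 0))
    (Proj.awayToSection (MvPolynomial.homogeneousSubmodule (Fin 4) k) (MvPolynomial.X 0)
      (Away.mk (MvPolynomial.homogeneousSubmodule (Fin 4) k) (MvPolynomial.isHomogeneous_X k 0) 1
        (MvPolynomial.X i) (by simpa using MvPolynomial.isHomogeneous_X k i)))

end curve

section cech
variable {k : Type u} [Field k] {X : Scheme.{u}} (s : X ⟶ Spec (.of k))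

/-- The homomorphism `k → Γ(X, U)` for a `k`-scheme `X`. -/
def scalarMap (U : X.Opens) : k →+* Γ(X, U) :=
  (X.presheaf.map U.leTop.op).hom.comp
    (s.appTop.hom.comp (Scheme.ΓSpecIso (.of k)).inv.hom)

theorem map_scalarMap {U V : X.Opens} (h : V ≤ U) (a : k) :
    X.presheaf.map (homOfLE h).op (scalarMap s U a) = scalarMap s V a := by
  change (X.presheaf.map _ ≫ X.presheaf.map _) _ = _
  rw [← Functor.map_comp]
  rfl

/-- The sections of `M` over `U`, as a `k`-vector space. -/
@[nolint unusedArguments]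
def Sections (_ : X ⟶ Spec (.of k)) (M : X.Modules) (U : X.Opens) : Type u := Γ(M, U)

instance (M : X.Modules) (U : X.Opens) : AddCommGroup (Sections s M U) :=
  inferInstanceAs (AddCommGroup Γ(M, U))

instance (M : X.Modules) (U : X.Opens) : Module k (Sections s M U) :=
  Module.compHom Γ(M, U) (scalarMap s U)

variable (M : X.Modules)

/-- Restriction of sections. -/
def secRes {U V : X.Opens} (h : V ≤ U) : Sections s M U →ₗ[k] Sections s M V where
  toFun := M.presheaf.map (homOfLE h).op
  map_add' := map_add _
  map_smul' a m := (M.map_smul (homOfLE h) (scalarMap s U a) m).trans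
    (congrArg (fun r : Γ(X, V) ↦ r • (M.presheaf.map (homOfLE h).op m : Γ(M, V)))
      (map_scalarMap s h a))

variable {M} {N : X.Modules}

/-- A morphism of sheaves of modules on sections. -/
def secMap (φ : M ⟶ N) (U : X.Opens) : Sections s M U →ₗ[k] Sections s N U where
  toFun := φ.app U
  map_add' := map_add _
  map_smul' a m := φ.app_smul (scalarMap s U a) m

theorem secMap_secRes (φ : M ⟶ N) {U V : X.Opens} (h : V ≤ U) (m : Sections s M U) :
    secMap s φ V (secRes s M h m) = secRes s N h (secMap s φ U m) :=
  congr($(φ.mapPresheaf.naturality (homOfLE h).op) m)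

variable (M) {n : ℕ} (U : Fin n → X.Opens)

/-- Čech differential `C⁰ → C¹`, `(d t)ᵢⱼ = tⱼ - tᵢ`. -/
def cechD0 : (∀ i, Sections s M (U i)) →ₗ[k] (∀ i j, Sections s M (U i ⊓ U j)) :=
  LinearMap.pi fun i ↦ LinearMap.pi fun j ↦
    secRes s M (inf_le_right : U i ⊓ U j ≤ U j) ∘ₗ LinearMap.proj j -
      secRes s M (inf_le_left : U i ⊓ U j ≤ U i) ∘ₗ LinearMap.proj i

/-- Čech differential `C¹ → C²`, `(d c)ᵢⱼₗ = cⱼₗ - cᵢₗ + cᵢⱼ`. -/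
def cechD1 : (∀ i j, Sections s M (U i ⊓ U j)) →ₗ[k] (∀ i j l, Sections s M (U i ⊓ U j ⊓ U l)) :=
  LinearMap.pi fun i ↦ LinearMap.pi fun j ↦ LinearMap.pi fun l ↦
    secRes s M (inf_le_inf_right _ inf_le_right : U i ⊓ U j ⊓ U l ≤ U j ⊓ U l) ∘ₗ
        LinearMap.proj l ∘ₗ LinearMap.proj j -
      secRes s M (inf_le_inf_right _ inf_le_left : U i ⊓ U j ⊓ U l ≤ U i ⊓ U l) ∘ₗ
        LinearMap.proj l ∘ₗ LinearMap.proj i +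
      secRes s M (inf_le_left : U i ⊓ U j ⊓ U l ≤ U i ⊓ U j) ∘ₗ
        LinearMap.proj j ∘ₗ LinearMap.proj i

/-- The first Čech cohomology of `M` with respect to the cover `U`. -/
abbrev CechH1 : Type u :=
  LinearMap.ker (cechD1 s M U) ⧸
    (LinearMap.range (cechD0 s M U)).comap (LinearMap.ker (cechD1 s M U)).subtype

variable {M}

/-- A morphism of sheaves of modules on Čech `1`-cochains. -/
def cechMapC1 (φ : M ⟶ N) :
    (∀ i j, Sections s M (U i ⊓ U j)) →ₗ[k] (∀ i j, Sections s N (U i ⊓ U j)) :=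
  LinearMap.pi fun i ↦ LinearMap.pi fun j ↦
    secMap s φ (U i ⊓ U j) ∘ₗ LinearMap.proj j ∘ₗ LinearMap.proj i

theorem cechMapC1_mem_ker (φ : M ⟶ N) (c) (hc : c ∈ LinearMap.ker (cechD1 s M U)) :
    cechMapC1 s U φ c ∈ LinearMap.ker (cechD1 s N U) := by
  rw [LinearMap.mem_ker] at hc ⊢
  funext i j l
  have h := congrArg (secMap s φ _) (congrFun (congrFun (congrFun hc i) j) l)
  simp only [cechD1, LinearMap.pi_apply, LinearMap.add_apply, LinearMap.sub_apply,
    LinearMap.comp_apply, LinearMap.proj_apply, map_add, map_sub, secMap_secRes, Pi.zero_apply,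
    map_zero] at h
  exact h

theorem cechMapC1_mem_range (φ : M ⟶ N) (c) (hc : c ∈ LinearMap.range (cechD0 s M U)) :
    cechMapC1 s U φ c ∈ LinearMap.range (cechD0 s N U) := by
  obtain ⟨t, rfl⟩ := hc
  refine ⟨fun i ↦ secMap s φ (U i) (t i), ?_⟩
  funext i j
  simp only [cechD0, cechMapC1, LinearMap.pi_apply, LinearMap.sub_apply,
    LinearMap.comp_apply, LinearMap.proj_apply, map_sub, secMap_secRes]

/-- The map `H¹(M) → H¹(N)` induced by `M ⟶ N`. -/
def cechH1Map (φ : M ⟶ N) : CechH1 s M U →ₗ[k] CechH1 s N U :=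
  Submodule.mapQ _ _ ((cechMapC1 s U φ).restrict (cechMapC1_mem_ker s U φ))
    fun c hc ↦ cechMapC1_mem_range s U φ c hc

/-- A coherent sheaf on a locally noetherian scheme. -/
def IsCoherentSheaf (M : X.Modules) : Prop :=
  M.IsQuasicoherent ∧
    ∀ x : X, ∃ U : X.Opens, IsAffineOpen U ∧ x ∈ U ∧ Module.Finite Γ(X, U) Γ(M, U)

/-- `ω` is a dualizing sheaf of the proper one-dimensional `k`-scheme `X`: it is coherent and
there is a trace `H¹(X, ω) → k` such that for every coherent `F` the pairing
`Hom(F, ω) × H¹(X, F) → H¹(X, ω) → k` induces a bijection from `Hom(F, ω)` to the dual space of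
`H¹(X, F)`. As `X` is separated, `H¹` is the Čech cohomology of any finite affine open cover. -/
def IsDualizingSheaf (ω : X.Modules) : Prop :=
  IsCoherentSheaf ω ∧
    ∀ (n : ℕ) (U : Fin n → X.Opens), (∀ i, IsAffineOpen (U i)) → ⨆ i, U i = ⊤ →
      ∃ t : CechH1 s ω U →ₗ[k] k, ∀ F : X.Modules, IsCoherentSheaf F →
        Function.Bijective fun φ : F ⟶ ω ↦ t ∘ₗ cechH1Map s U φ

end cech

section main
variable (k : Type u) [Field k] (b : ℕ)

/-- The map `k[x, y, z] → Γ(X, X₁)` sending `x, y, z` to the second, third and fourth projective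
coordinate divided by the first. -/
def chartHom : MvPolynomial (Fin 3) k →+* Γ(curve k b, curveChart k b) :=
  MvPolynomial.eval₂Hom (scalarMap (curveToSpec k b) (curveChart k b))
    ![curveCoord k b 1, curveCoord k b 2, curveCoord k b 3]

/-- The `3 × 2` matrix with rows `(z, x^(b+1))`, `(y, z)`, `(x^(b+2), y)` over `k[x, y, z]`. -/
def hilbertBurchMatrix : Matrix (Fin 3) (Fin 2) (MvPolynomial (Fin 3) k) :=
  let x : MvPolynomial (Fin 3) k := MvPolynomial.X 0
  let y : MvPolynomial (Fin 3) k := MvPolynomial.X 1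
  let z : MvPolynomial (Fin 3) k := MvPolynomial.X 2
  !![z, x ^ (b + 1); y, z; x ^ (b + 2), y]

/-- The ideal of the maximal minors of a `3 × 2` matrix. -/
def maximalMinors {R : Type*} [CommRing R] (A : Matrix (Fin 3) (Fin 2) R) : Ideal R :=
  Ideal.span (Set.range fun i : Fin 3 ↦ (A.submatrix i.succAbove id).det)

/-- The ring `k[x, v] / (x^(b+1) (x + v^3))`. -/
abbrev LocalModel : Type u :=
  MvPolynomial (Fin 2) k ⧸ Ideal.span {(MvPolynomial.X 0 ^ (b + 1) *
    (MvPolynomial.X 0 + MvPolynomial.X 1 ^ 3) : MvPolynomial (Fin 2) k)}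

/-- The map `k[x, y, z] → k[x, v] / (x^(b+1) (x + v^3))` with `x ↦ x`, `y ↦ v^2 x^(b+1)` and
`z ↦ - v x^(b+1)`. -/
def localModelHom : MvPolynomial (Fin 3) k →ₐ[k] LocalModel k b :=
  let x : LocalModel k b := Ideal.Quotient.mk _ (MvPolynomial.X 0)
  let v : LocalModel k b := Ideal.Quotient.mk _ (MvPolynomial.X 1)
  MvPolynomial.aeval ![x, v ^ 2 * x ^ (b + 1), - (v * x ^ (b + 1))]

/-- The open set `W ⊆ V` is nonempty and carries a function `f` with `f^(b+1) = 0` such that the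
support of `f^b` is all of `W`. -/
def IsNilpotentOpen (V : Scheme.{u}) (W : V.Opens) : Prop :=
  (W : Set V).Nonempty ∧ ∃ f : Γ(V, W), f ^ (b + 1) = 0 ∧
    ∀ (x : V) (hx : x ∈ W), V.presheaf.germ W x hx (f ^ b) ≠ 0

/-- The point `q` of `X ⊆ ℙ³` is `[1, 0, 0, 0]`: its homogeneous prime ideal is generated by the
last three coordinates. -/
def IsBasePoint (q : curve k b) : Prop :=
  (curveι k b q).asHomogeneousIdeal.toIdeal =
    Ideal.span {MvPolynomial.X 1, MvPolynomial.X 2, MvPolynomial.X 3}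

end main

end

/-! Everything is computed with Laurent polynomials in `T`. The torus `Spec k[T, T⁻¹]` maps to `X`
by the parametrization with `S = 1`. Since `X` is a scheme-theoretic image, this map is
scheme-theoretically dominant, so functions on an open set through which it factors embed in `k[T,
T⁻¹]` (`torusEval_injective`). Two affine charts cover `X` (`chart_sup`). On the chart `X₁`, where
the first coordinate is nonzero, the functions are the semigroup ring `R = k[T ^ 3, T ^ (3b+4), T ^
(3b+5)]`. On the chart where the third coordinate is nonzero no positive power of `T` occurs, and on
the overlap all Laurent polynomials occur. The equations of `X₁` follow from a normal form: modulo
the minors every polynomial is `p₀(x) + y p₁(x) + z p₂(x)`, and after substitution the three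
summands live in different residue classes of exponents modulo `3` (`ker_paramHom`).

The sheaf `ω` is known only by its universal property. With two charts, a trace is a functional `τ`
on the sections of `ω` over the overlap that vanishes on sections coming from either chart. A
section `m` over `X₁` is sent to the Laurent polynomial whose coefficient at `T ^ n` is `τ (T ^
(3b+2-n) m)` (`dualEmb`). This is `R`-linear. Duality for line bundles glued from two free pieces
shows that it is injective (`dualEmb_injective`), and duality for `𝒪_X` shows that `1` and `T` are
in the image (`exists_dualEmb_eq_T`). The coefficient at `T ^ n` vanishes if `3b+2-n` lies in the
semigroup, and all the remaining `T ^ n` are multiples of `1` or of `T`. The number `3b+2` is the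
largest gap of the semigroup, so this is the usual description of the canonical module of a monomial
curve.

The generators satisfy `z · 1 = x ^ (b+1) · T`, `y · 1 = z · T` and `x ^ (b+2) · 1 = y · T`, the
rows of the Hilbert-Burch matrix. Let `e` and `e'` correspond to `1` and `-T`, and put `v = e' / e`.
On the locus of `Proj (Sym ω)` where `e` does not vanish, the relations give `z = -v x ^ (b+1)`, `y
= v ^ 2 x ^ (b+1)` and `x ^ (b+1) (x + v ^ 3) = 0`, so the coordinate ring of this locus is a
quotient of the local model. An inverse comes from the semilinear map `T ^ (3i+j) ↦ x ^ i (-v) ^ j`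
(`modelMap_paramHom_mul`), so it is not necessary to know that the three relations generate all
relations (`exists_equiv_of_relations`).

Where `x + v ^ 3` is invertible, `x ^ (b+1) = 0`. There `x`, `y` and `z` vanish at every point, so
this open set lies over `x₀`. The annihilator of `x ^ b` is contained in `(x)`, hence in every prime
of this open set, so no germ of `x ^ b` vanishes there. -/

noncomputable section

/-! ### Points of `Proj` with values in a ring -/

namespace ProjPoint
variable {A B L : Type u} [CommRing A] [CommRing B] [CommRing L] {σ τ : Type u} [SetLike σ A]
  [AddSubgroupClass σ A] [SetLike τ B] [AddSubgroupClass τ B]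
  (𝒜 : ℕ → σ) (ℬ : ℕ → τ) [GradedRing 𝒜] [GradedRing ℬ]

/-- The map `(A_s)₀ → L` induced by `E : A → L` if `E s` is a unit. -/
def awayEval (E : A →+* L) (s : A) (hu : IsUnit (E s)) : Away 𝒜 s →+* L :=
  (IsLocalization.Away.lift (S := Localization.Away s) s hu).comp
    (algebraMap (Away 𝒜 s) (Localization.Away s))

theorem awayEval_apply (E : A →+* L) (s : A) (hu : IsUnit (E s)) (z : Away 𝒜 s) :
    awayEval 𝒜 E s hu z = IsLocalization.Away.lift (S := Localization.Away s) s hu z.val := rfl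

/-- The value `E a / E s ^ n` with its denominator cleared, so that no inverse of `E s` has to be
named. -/
theorem awayEval_mk (E : A →+* L) {s : A} (hu : IsUnit (E s)) {d : ℕ} (hs : s ∈ 𝒜 d) (n : ℕ)
    (a : A) (ha : a ∈ 𝒜 (n • d)) :
    E s ^ n * awayEval 𝒜 E s hu (Away.mk 𝒜 hs n a ha) = E a := by
  rw [awayEval_apply, Away.val_mk, Localization.mk_eq_mk']
  have h := IsLocalization.mk'_spec' (Localization.Away s) a
    (⟨s ^ n, n, rfl⟩ : Submonoid.powers s)
  have h2 := congrArg (IsLocalization.Away.lift (S := Localization.Away s) s hu) h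
  rw [map_mul, IsLocalization.Away.lift_eq, IsLocalization.Away.lift_eq, map_pow] at h2
  exact h2

theorem awayEval_comp_awayMap (E : A →+* L) {s t x : A} {m : ℕ} (ht : t ∈ 𝒜 m) (hx : x = s * t)
    (hs : IsUnit (E s)) (hu : IsUnit (E x)) :
    (awayEval 𝒜 E x hu).comp (HomogeneousLocalization.awayMap 𝒜 ht hx) = awayEval 𝒜 E s hs := by
  ext z
  rw [RingHom.comp_apply, awayEval_apply, awayEval_apply, val_awayMap]
  generalize z.val = w
  simp only [← RingHom.comp_apply]
  congr 1
  apply IsLocalization.ringHom_ext (Submonoid.powers s)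
  ext a
  simp [Localization.awayLift]

theorem awayEval_comp_projMap (f : A →+* B) (d : ℕ) (hf : ∀ i a, a ∈ 𝒜 i → f a ∈ ℬ (d * i))
    (E : B →+* L) (s : A) (hu : IsUnit (E (f s))) :
    (awayEval ℬ E (f s) hu).comp (ProjDeg.awayMap 𝒜 ℬ f d hf s) =
      awayEval 𝒜 (E.comp f) s hu := by
  ext z
  rw [RingHom.comp_apply, awayEval_apply, awayEval_apply]
  change IsLocalization.Away.lift (S := Localization.Away (f s)) _ _
    (ProjDeg.awayFun 𝒜 ℬ f d hf s z).val = _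
  rw [ProjDeg.val_awayFun]
  generalize z.val = w
  simp only [← RingHom.comp_apply]
  congr 1
  apply IsLocalization.ringHom_ext (Submonoid.powers s)
  ext a
  simp [IsLocalization.map_eq]

/-- The morphism `Spec L ⟶ Proj A` induced by `E : A → L`, through the chart `D₊(s)`. -/
def ptHom (E : A →+* L) {s : A} {m : ℕ} (hs : s ∈ 𝒜 m) (hm : 0 < m) (hu : IsUnit (E s)) :
    Spec (.of L) ⟶ Proj 𝒜 :=
  Spec.map (CommRingCat.ofHom (awayEval 𝒜 E s hu)) ≫ Proj.awayι 𝒜 s hs hm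

theorem ptHom_mul (E : A →+* L) {s t x : A} {m n : ℕ} (hs : s ∈ 𝒜 m) (hm : 0 < m)
    (hu : IsUnit (E s)) (ht : t ∈ 𝒜 n) (hx : x = s * t) (hux : IsUnit (E x)) :
    ptHom 𝒜 E (hx ▸ SetLike.mul_mem_graded hs ht) (hm.trans_le (m.le_add_right n)) hux =
      ptHom 𝒜 E hs hm hu := by
  rw [ptHom, ptHom, ← awayEval_comp_awayMap 𝒜 E ht hx hu hux, CommRingCat.ofHom_comp, Spec.map_comp,
    Category.assoc, Proj.SpecMap_awayMap_awayι]

/-- Both morphisms factor through the smaller chart `D₊(s t)`, where they are the same evaluation.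
-/
theorem ptHom_eq (E : A →+* L) {s t : A} {m n : ℕ} (hs : s ∈ 𝒜 m) (hm : 0 < m)
    (hu : IsUnit (E s)) (ht : t ∈ 𝒜 n) (hn : 0 < n) (hut : IsUnit (E t)) :
    ptHom 𝒜 E hs hm hu = ptHom 𝒜 E ht hn hut := by
  have hux : IsUnit (E (s * t)) := by rw [map_mul]; exact hu.mul hut
  rw [← ptHom_mul 𝒜 E hs hm hu ht rfl hux]
  exact ptHom_mul 𝒜 E ht hn hut hs (mul_comm s t) hux

theorem ptHom_projMap (f : A →+* B) (d : ℕ) (hf : ∀ i a, a ∈ 𝒜 i → f a ∈ ℬ (d * i)) (hd : 0 < d)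
    {ι : Type*} (s : ι → A) (m : ι → ℕ) (hs : ∀ i, s i ∈ 𝒜 (m i)) (hm : ∀ i, 0 < m i)
    (hcov : ∀ p : ProjectiveSpectrum ℬ, ∃ i, f (s i) ∉ p.asHomogeneousIdeal) (i : ι)
    (E : B →+* L) (hu : IsUnit (E (f (s i)))) :
    ptHom ℬ E (hf _ _ (hs i)) (Nat.mul_pos hd (hm i)) hu ≫
      ProjDeg.projMap 𝒜 ℬ f d hf hd s m hs hm hcov = ptHom 𝒜 (E.comp f) (hs i) (hm i) hu := by
  rw [ptHom, ptHom, Category.assoc, ProjDeg.awayι_projMap, ← awayEval_comp_projMap 𝒜 ℬ f d hf,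
    CommRingCat.ofHom_comp, Spec.map_comp, Category.assoc]

theorem ptHom_preimage (E : A →+* L) {s : A} {m : ℕ} (hs : s ∈ 𝒜 m) (hm : 0 < m)
    (hu : IsUnit (E s)) : ⊤ ≤ ptHom 𝒜 E hs hm hu ⁻¹ᵁ Proj.basicOpen 𝒜 s := by
  rw [← Proj.opensRange_awayι 𝒜 s hs hm]
  intro q _
  exact ⟨Spec.map (CommRingCat.ofHom (awayEval 𝒜 E s hu)) q, rfl⟩

theorem awayι_appLE {s : A} {m : ℕ} (hs : s ∈ 𝒜 m) (hm : 0 < m)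
    (h : ⊤ ≤ Proj.awayι 𝒜 s hs hm ⁻¹ᵁ Proj.basicOpen 𝒜 s) :
    Proj.awayToSection 𝒜 s ≫ (Proj.awayι 𝒜 s hs hm).appLE (Proj.basicOpen 𝒜 s) ⊤ h =
      (Scheme.ΓSpecIso _).inv := by
  have h1 : (Proj.basicOpenIsoSpec 𝒜 s hs hm).hom.appTop = (Scheme.ΓSpecIso _).hom ≫
      Proj.awayToSection 𝒜 s ≫ (Proj.basicOpen 𝒜 s).topIso.inv := by
    rw [Proj.basicOpenIsoSpec_hom 𝒜 s hs hm]
    exact Proj.basicOpenToSpec_app_top 𝒜 s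
  have h2 : (Proj.awayι 𝒜 s hs hm).appLE (Proj.basicOpen 𝒜 s) ⊤ h =
      (Proj.basicOpen 𝒜 s).topIso.inv ≫ (Proj.basicOpenIsoSpec 𝒜 s hs hm).inv.appTop := by
    refine (Scheme.Hom.appLE_comp_appLE (Proj.basicOpenIsoSpec 𝒜 s hs hm).inv
      (Proj.basicOpen 𝒜 s).ι (Proj.basicOpen 𝒜 s) ⊤ ⊤ (fun q _ ↦ q.2) le_top).symm.trans ?_
    rw [Scheme.Hom.appTop, Scheme.Hom.app_eq_appLE]
    congr 1
  have h3 : (Proj.basicOpenIsoSpec 𝒜 s hs hm).hom.appTop ≫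
      (Proj.basicOpenIsoSpec 𝒜 s hs hm).inv.appTop = 𝟙 _ := by
    rw [← Scheme.Hom.comp_appTop, Iso.inv_hom_id, Scheme.Hom.id_appTop]
  rw [h2, ← cancel_epi (Scheme.ΓSpecIso _).hom, Iso.hom_inv_id, ← h3, h1]
  simp only [Category.assoc]

theorem ptHom_appLE (E : A →+* L) {s : A} {m : ℕ} (hs : s ∈ 𝒜 m) (hm : 0 < m)
    (hu : IsUnit (E s)) (h : ⊤ ≤ ptHom 𝒜 E hs hm hu ⁻¹ᵁ Proj.basicOpen 𝒜 s) (a : Away 𝒜 s) :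
    (ptHom 𝒜 E hs hm hu).appLE (Proj.basicOpen 𝒜 s) ⊤ h (Proj.awayToSection 𝒜 s a) =
      (Scheme.ΓSpecIso (.of L)).inv (awayEval 𝒜 E s hu a) := by
  have h0 : ⊤ ≤ Proj.awayι 𝒜 s hs hm ⁻¹ᵁ Proj.basicOpen 𝒜 s := by
    rw [← Proj.opensRange_awayι 𝒜 s hs hm]
    exact fun q _ ↦ ⟨q, rfl⟩
  have h1 : Proj.awayToSection 𝒜 s ≫ (ptHom 𝒜 E hs hm hu).appLE (Proj.basicOpen 𝒜 s) ⊤ h =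
      CommRingCat.ofHom (awayEval 𝒜 E s hu) ≫ (Scheme.ΓSpecIso (.of L)).inv := by
    rw [Scheme.ΓSpecIso_inv_naturality, ← awayι_appLE 𝒜 hs hm h0, Category.assoc]
    rw [Scheme.Hom.appTop, Scheme.Hom.app_eq_appLE]
    exact congrArg _ (Scheme.Hom.appLE_comp_appLE (Spec.map (CommRingCat.ofHom (awayEval 𝒜 E s hu)))
      (Proj.awayι 𝒜 s hs hm) _ ⊤ ⊤ h0 le_top).symm
  exact congr($h1 a)

end ProjPoint
end

noncomputable section

/-! ### Dominance: reduced `Proj` and scheme-theoretic images -/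

section projReduced
variable {A σ : Type u} [CommRing A] [IsDomain A] [SetLike σ A] [AddSubgroupClass σ A]
  (𝒜 : ℕ → σ) [GradedRing 𝒜]

theorem isReduced_away (s : A) : _root_.IsReduced (Away 𝒜 s) := by
  refine isReduced_of_injective (algebraMap (Away 𝒜 s) (Localization.Away s))
    (HomogeneousLocalization.val_injective _)

theorem isReduced_Proj : IsReduced (Proj 𝒜) := by
  have : ∀ i, IsReduced ((Proj.affineOpenCover 𝒜).openCover.X i) := fun i ↦ by
    have : _root_.IsReduced (Away 𝒜 (i.2 : A)) := isReduced_away 𝒜 _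
    exact inferInstanceAs (IsReduced (Spec (.of (Away 𝒜 (i.2 : A)))))
  exact IsReduced.of_openCover _ (Proj.affineOpenCover 𝒜).openCover

/-- In a domain the zero ideal is a point of `Proj`, and it lies in `D₊(a)` for every nonzero `a`.
-/
theorem isDominant_awayι {s : A} {m : ℕ} (hs : s ∈ 𝒜 m) (hm : 0 < m) (h0 : s ≠ 0) :
    IsDominant (Proj.awayι 𝒜 s hs hm) := by
  let p : Proj 𝒜 := ⟨⊥, Ideal.isPrime_bot, fun h ↦ h0 ((Ideal.mem_bot).mp
    (h (HomogeneousIdeal.mem_irrelevant_of_mem _ hm hs)))⟩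
  have hp : ∀ a : A, a ≠ 0 → p ∈ Proj.basicOpen 𝒜 a := fun a ha h ↦ ha ((Ideal.mem_bot).mp h)
  refine ⟨fun q ↦ ?_⟩
  rw [(Proj.isBasis_basicOpen 𝒜).mem_closure_iff]
  rintro _ ⟨_, ⟨a, rfl⟩, rfl⟩ hq
  refine ⟨p, hp a ?_, ?_⟩
  · rintro rfl
    exact hq (Ideal.zero_mem _)
  · have : p ∈ (Proj.awayι 𝒜 s hs hm).opensRange := by
      rw [Proj.opensRange_awayι]
      exact hp s h0
    exact this

end projReduced

/-- The preimages in the image of the affine opens of `Y` form an affine cover, and on each of them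
the map on sections is injective. -/
theorem isSchemeTheoreticallyDominant_toImage {X Y : Scheme.{u}} (f : X ⟶ Y) [QuasiCompact f] :
    IsSchemeTheoreticallyDominant f.toImage := by
  rw [isSchemeTheoreticallyDominant_iff]
  refine Scheme.IdealSheafData.ext_of_iSup_eq_top
    (fun U : Y.affineOpens ↦ ⟨f.imageι ⁻¹ᵁ U.1, U.2.preimage f.imageι⟩) ?_ fun U ↦ ?_
  · rw [← Scheme.Hom.preimage_iSup, iSup_affineOpens_eq_top]
    rfl
  · rw [Scheme.Hom.ker_apply]
    exact ((RingHom.injective_iff_ker_eq_bot _).mp (f.toImage_app_injective U)).trans (by simp)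

attribute [local instance] MvPolynomial.gradedAlgebra
open ProjPoint LaurentPolynomial

/-! ### The torus, the projective line and the curve -/

section param
variable (k : Type u) [Field k] (b : ℕ)

/-- The substitution `S ↦ 1`, `T ↦ T` from `k[S, T]` to the Laurent polynomials. -/
def evalHom : MvPolynomial (Fin 2) k →+* k[T;T⁻¹] :=
  (MvPolynomial.aeval (R := k) (S₁ := k[T;T⁻¹]) ![1, LaurentPolynomial.T 1]).toRingHom

theorem evalHom_X0 : evalHom k (MvPolynomial.X 0) = 1 := by simp [evalHom]
theorem evalHom_X1 : evalHom k (MvPolynomial.X 1) = LaurentPolynomial.T 1 := by simp [evalHom]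
theorem evalHom_C (a : k) : evalHom k (MvPolynomial.C a) = LaurentPolynomial.C a := by
  simp [evalHom]

theorem evalHom_monomial (m : Fin 2 →₀ ℕ) (a : k) :
    evalHom k (MvPolynomial.monomial m a) = LaurentPolynomial.C a * LaurentPolynomial.T (m 1 : ℤ) := by
  rw [MvPolynomial.monomial_eq, map_mul, evalHom_C, Finsupp.prod_fintype _ _ (by simp)]
  simp only [Fin.prod_univ_two, map_mul, map_pow, evalHom_X0, evalHom_X1, one_pow, one_mul]
  rw [LaurentPolynomial.T_pow, mul_one]

/-- In a fixed degree the exponent of `T` determines the monomial, so setting `S = 1` loses nothing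
on forms. -/
theorem eq_zero_of_evalHom_eq_zero {n : ℕ} {p : MvPolynomial (Fin 2) k} (hp : p.IsHomogeneous n)
    (h : evalHom k p = 0) : p = 0 := by
  ext m
  rw [MvPolynomial.coeff_zero]
  by_contra hm
  have hd : ∀ e : Fin 2 →₀ ℕ, p.coeff e ≠ 0 → e 0 + e 1 = n := by
    intro e he
    have := hp he
    simpa [Finsupp.weight_apply, Finsupp.sum_fintype, Fin.sum_univ_two] using this
  have h2 : (evalHom k p).coeff (m 1 : ℤ) = p.coeff m := by
    conv_lhs => rw [p.as_sum, map_sum]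
    simp only [evalHom_monomial, AddMonoidAlgebra.coeff_sum, Finsupp.finsetSum_apply,
      ← LaurentPolynomial.single_eq_C_mul_T, AddMonoidAlgebra.coeff_single]
    rw [Finset.sum_eq_single m]
    · exact Finsupp.single_eq_same
    · intro e he hne
      refine Finsupp.single_eq_of_ne ?_
      intro h1
      apply hne
      have h3 := hd e (MvPolynomial.mem_support_iff.mp he)
      have h4 := hd m hm
      ext i
      fin_cases i
      · simp; omega
      · simp; omega
    · intro h
      rw [MvPolynomial.notMem_support_iff] at h
      exact absurd h hm
  rw [h] at h2
  exact hm h2.symm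

/-- The torus enters the projective line through the chart `D₊(S T)`, whose form of degree two is
the source of the `2` in `torusToLine`. -/
theorem X0X1_mem : (MvPolynomial.X 0 * MvPolynomial.X 1 : MvPolynomial (Fin 2) k) ∈
    MvPolynomial.homogeneousSubmodule (Fin 2) k 2 :=
  (MvPolynomial.isHomogeneous_X k 0).mul (MvPolynomial.isHomogeneous_X k 1)

theorem isUnit_evalHom_X0X1 : IsUnit (evalHom k (MvPolynomial.X 0 * MvPolynomial.X 1)) := by
  rw [map_mul, evalHom_X0, evalHom_X1, one_mul]
  exact LaurentPolynomial.isUnit_T 1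

/-- The morphism `Spec k[T, T⁻¹] ⟶ ℙ¹`. -/
def torusToLine : Spec (.of k[T;T⁻¹]) ⟶ projSpace k 1 :=
  ptHom _ (evalHom k) (X0X1_mem k) two_pos (isUnit_evalHom_X0X1 k)

theorem injective_awayEval : Function.Injective
    (awayEval (MvPolynomial.homogeneousSubmodule (Fin 2) k) (evalHom k) _
      (isUnit_evalHom_X0X1 k)) := by
  rw [injective_iff_map_eq_zero]
  intro z hz
  obtain ⟨n, a, ha, rfl⟩ := Away.mk_surjective _ (X0X1_mem k) z
  have h := awayEval_mk (MvPolynomial.homogeneousSubmodule (Fin 2) k) (evalHom k)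
    (isUnit_evalHom_X0X1 k) (X0X1_mem k) n a ha
  rw [hz, mul_zero] at h
  have := eq_zero_of_evalHom_eq_zero k ha h.symm
  subst this
  apply HomogeneousLocalization.val_injective
  rw [Away.val_mk, Localization.mk_zero, val_zero]

instance : IsDominant (torusToLine k) := by
  have h1 : IsDominant (Proj.awayι (MvPolynomial.homogeneousSubmodule (Fin 2) k) _ (X0X1_mem k)
      two_pos) := isDominant_awayι _ _ _ (mul_ne_zero (MvPolynomial.X_ne_zero _) (MvPolynomial.X_ne_zero _))
  have h2 : IsDominant (Spec.map (CommRingCat.ofHom (awayEval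
      (MvPolynomial.homogeneousSubmodule (Fin 2) k) (evalHom k) _ (isUnit_evalHom_X0X1 k)))) := by
    refine ⟨?_⟩
    have := PrimeSpectrum.denseRange_comap_iff_ker_le_nilRadical (CommRingCat.ofHom (awayEval
      (MvPolynomial.homogeneousSubmodule (Fin 2) k) (evalHom k) _ (isUnit_evalHom_X0X1 k))).hom
    exact this.mpr (((RingHom.injective_iff_ker_eq_bot _).mp (injective_awayEval k)).trans_le
      bot_le)
  exact inferInstanceAs (IsDominant (_ ≫ _))

instance compactSpace_projSpace (n : ℕ) : CompactSpace (projSpace k n) := by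
  have : Algebra.FiniteType (MvPolynomial.homogeneousSubmodule (Fin (n + 1)) k 0)
      (MvPolynomial (Fin (n + 1)) k) :=
    have : IsScalarTower k (MvPolynomial.homogeneousSubmodule (Fin (n + 1)) k 0)
      (MvPolynomial (Fin (n + 1)) k) := ⟨fun _ _ _ ↦ smul_mul_assoc _ _ _⟩
    Algebra.FiniteType.of_restrictScalars_finiteType k _ _
  exact QuasiCompact.compactSpace_of_compactSpace
    (Proj.toSpecZero (MvPolynomial.homogeneousSubmodule (Fin (n + 1)) k))

instance : IsSchemeTheoreticallyDominant (torusToLine k) :=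
  have : IsReduced (projSpace k 1) := isReduced_Proj _
  .of_isDominant _

/-- The morphism `ℙ¹ ⟶ X`. -/
def lineToCurve : projSpace k 1 ⟶ curve k b := (curveParam k b).toImage

theorem lineToCurve_ι : lineToCurve k b ≫ curveι k b = curveParam k b :=
  Scheme.Hom.toImage_imageι _

instance : IsSchemeTheoreticallyDominant (lineToCurve k b) :=
  isSchemeTheoreticallyDominant_toImage (curveParam k b)

instance : QuasiCompact (lineToCurve k b) :=
  inferInstanceAs (QuasiCompact (curveParam k b).toImage)

/-- The morphism `Spec k[T, T⁻¹] ⟶ X`. -/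
def torusToCurve : Spec (.of k[T;T⁻¹]) ⟶ curve k b := torusToLine k ≫ lineToCurve k b

instance : IsSchemeTheoreticallyDominant (torusToCurve k b) :=
  inferInstanceAs (IsSchemeTheoreticallyDominant (_ ≫ _))

instance : QuasiCompact (torusToCurve k b) := inferInstanceAs (QuasiCompact (_ ≫ _))

/-- The substitution of the parametrization in forms on `ℙ³`, with `S = 1`. -/
def formsEval : MvPolynomial (Fin 4) k →+* k[T;T⁻¹] :=
  (evalHom k).comp (MvPolynomial.aeval (curveForms k b)).toRingHom

theorem formsEval_X0 : formsEval k b (MvPolynomial.X 0) = 1 := by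
  simp [formsEval, curveForms, evalHom_X0]

theorem formsEval_X1 : formsEval k b (MvPolynomial.X 1) = LaurentPolynomial.T 3 := by
  simp [formsEval, curveForms, evalHom_X0, evalHom_X1, LaurentPolynomial.T_pow]

theorem formsEval_X2 :
    formsEval k b (MvPolynomial.X 2) = LaurentPolynomial.T ((3 * b + 5 : ℕ) : ℤ) := by
  simp only [formsEval, curveForms, RingHom.comp_apply, AlgHom.toRingHom_eq_coe, RingHom.coe_coe,
    MvPolynomial.aeval_X]
  simp [evalHom_X1, LaurentPolynomial.T_pow]

theorem formsEval_X3 :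
    formsEval k b (MvPolynomial.X 3) = LaurentPolynomial.T ((3 * b + 4 : ℕ) : ℤ) := by
  simp only [formsEval, curveForms, RingHom.comp_apply, AlgHom.toRingHom_eq_coe, RingHom.coe_coe,
    MvPolynomial.aeval_X]
  simp [evalHom_X0, evalHom_X1, LaurentPolynomial.T_pow]

theorem formsEval_C (a : k) : formsEval k b (MvPolynomial.C a) = LaurentPolynomial.C a := by
  simp [formsEval, evalHom_C, MvPolynomial.algebraMap_eq]

theorem isUnit_formsEval (i : Fin 4) : IsUnit (formsEval k b (MvPolynomial.X i)) := by
  fin_cases i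
  · exact (formsEval_X0 k b).symm ▸ isUnit_one
  · exact (formsEval_X1 k b).symm ▸ LaurentPolynomial.isUnit_T _
  · exact (formsEval_X2 k b).symm ▸ LaurentPolynomial.isUnit_T _
  · exact (formsEval_X3 k b).symm ▸ LaurentPolynomial.isUnit_T _

/-- All four forms become powers of `T`, hence units, so the torus lands in every coordinate chart.
The free choice of `i` permits the evaluation of functions on each chart in turn. -/
theorem torusToCurve_ι (i : Fin 4) : torusToCurve k b ≫ curveι k b =
    ptHom (MvPolynomial.homogeneousSubmodule (Fin 4) k) (formsEval k b)
      (MvPolynomial.isHomogeneous_X k i) one_pos (isUnit_formsEval k b i) := by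
  rw [torusToCurve, Category.assoc, lineToCurve_ι, torusToLine,
    ptHom_eq (MvPolynomial.homogeneousSubmodule (Fin 2) k) (evalHom k) (X0X1_mem k) two_pos
      (isUnit_evalHom_X0X1 k)
      (aeval_mem_homogeneousSubmodule (curveForms k b) (curveForms_isHomogeneous k b) 1
        (MvPolynomial.X i) (MvPolynomial.isHomogeneous_X k i))
      (Nat.mul_pos (show 0 < 3 * b + 5 by omega) one_pos) (isUnit_formsEval k b i)]
  exact ptHom_projMap _ _ _ (3 * b + 5)
    (aeval_mem_homogeneousSubmodule (curveForms k b) (curveForms_isHomogeneous k b))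
    (show 0 < 3 * b + 5 by omega) (fun i : Fin 4 ↦ MvPolynomial.X i) (fun _ ↦ 1)
    (fun i ↦ MvPolynomial.isHomogeneous_X k i) (fun _ ↦ one_pos) (fun p ↦ by
      obtain ⟨i, hi⟩ := exists_curveForms_notMem k b p
      refine ⟨i, ?_⟩
      rwa [AlgHom.toRingHom_eq_coe, RingHom.coe_coe, MvPolynomial.aeval_X]) i (evalHom k)
    (isUnit_formsEval k b i)

end param
end

noncomputable section
attribute [local instance] MvPolynomial.gradedAlgebra
open ProjPoint LaurentPolynomial

theorem ptHom_preimage_eq_bot {A L σ : Type u} [CommRing A] [CommRing L] [SetLike σ A]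
    [AddSubgroupClass σ A] (𝒜 : ℕ → σ) [GradedRing 𝒜] (E : A →+* L) {s t : A} {m n : ℕ}
    (hs : s ∈ 𝒜 m) (hm : 0 < m) (hu : IsUnit (E s)) (ht : t ∈ 𝒜 n) (hn : 0 < n) (h0 : E t = 0) :
    ptHom 𝒜 E hs hm hu ⁻¹ᵁ Proj.basicOpen 𝒜 t = ⊥ := by
  have h1 : ptHom 𝒜 E hs hm hu ⁻¹ᵁ Proj.basicOpen 𝒜 t =
      Spec.map (CommRingCat.ofHom (awayEval 𝒜 E s hu)) ⁻¹ᵁ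
        (Proj.awayι 𝒜 s hs hm ⁻¹ᵁ Proj.basicOpen 𝒜 t) := rfl
  have h2 : awayEval 𝒜 E s hu (Away.isLocalizationElem hs ht) = 0 := by
    have h3 := awayEval_mk 𝒜 E hu hs n (t ^ m)
      (by simpa [mul_comm] using SetLike.pow_mem_graded m ht)
    rw [map_pow, h0, zero_pow hm.ne'] at h3
    exact ((hu.pow n).mul_right_eq_zero).mp h3
  rw [h1, Proj.awayι_preimage_basicOpen 𝒜 hs hm ht hn]
  ext q
  change awayEval 𝒜 E s hu (Away.isLocalizationElem hs ht) ∉ q.asIdeal ↔ False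
  simp [h2]

theorem basicOpen_awayToSection {A σ : Type u} [CommRing A] [SetLike σ A]
    [AddSubgroupClass σ A] (𝒜 : ℕ → σ) [GradedRing 𝒜] {s t : A} {m n : ℕ}
    (hs : s ∈ 𝒜 m) (hm : 0 < m) (ht : t ∈ 𝒜 n) (hn : 0 < n) :
    (Proj 𝒜).basicOpen (Proj.awayToSection 𝒜 s (Away.isLocalizationElem hs ht)) =
      Proj.basicOpen 𝒜 t ⊓ Proj.basicOpen 𝒜 s := by
  have h0 : ⊤ ≤ Proj.awayι 𝒜 s hs hm ⁻¹ᵁ Proj.basicOpen 𝒜 s := by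
    rw [← Proj.opensRange_awayι 𝒜 s hs hm]
    exact fun q _ ↦ ⟨q, rfl⟩
  have h1 : Proj.awayι 𝒜 s hs hm ⁻¹ᵁ
      (Proj 𝒜).basicOpen (Proj.awayToSection 𝒜 s (Away.isLocalizationElem hs ht)) =
      Proj.awayι 𝒜 s hs hm ⁻¹ᵁ Proj.basicOpen 𝒜 t := by
    refine Eq.trans ?_ (Proj.awayι_preimage_basicOpen 𝒜 hs hm ht hn).symm
    have h2 := congr($(awayι_appLE 𝒜 hs hm h0) (Away.isLocalizationElem hs ht))
    have h3 := Scheme.basicOpen_appLE (Proj.awayι 𝒜 s hs hm) ⊤ (Proj.basicOpen 𝒜 s) h0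
      (Proj.awayToSection 𝒜 s (Away.isLocalizationElem hs ht))
    rw [top_inf_eq] at h3
    refine h3.symm.trans ?_
    refine (congrArg _ h2).trans ?_
    exact basicOpen_eq_of_affine _
  refine le_antisymm (le_inf ?_ (Scheme.basicOpen_le _ _)) ?_
  · intro p hp
    have hp' : p ∈ (Proj.awayι 𝒜 s hs hm).opensRange := by
      rw [Proj.opensRange_awayι]; exact Scheme.basicOpen_le _ _ hp
    obtain ⟨q, rfl⟩ := hp'
    exact h1.le (show q ∈ _ from hp)
  · intro p hp
    have hp' : p ∈ (Proj.awayι 𝒜 s hs hm).opensRange := by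
      rw [Proj.opensRange_awayι]; exact hp.2
    obtain ⟨q, rfl⟩ := hp'
    exact h1.ge (show q ∈ _ from hp.1)

/-! ### The coordinate charts of the curve -/

section charts
variable (k : Type u) [Field k] (b : ℕ)

/-- The open subscheme of `X` on which the `i`-th coordinate does not vanish. -/
def chart (i : Fin 4) : (curve k b).Opens :=
  curveι k b ⁻¹ᵁ Proj.basicOpen (MvPolynomial.homogeneousSubmodule (Fin 4) k) (MvPolynomial.X i)

instance : IsClosedImmersion (curveι k b) :=
  inferInstanceAs (IsClosedImmersion (curveParam k b).imageι)

theorem isAffineOpen_chart (i : Fin 4) : IsAffineOpen (chart k b i) :=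
  (Proj.isAffineOpen_basicOpen (MvPolynomial.homogeneousSubmodule (Fin 4) k) (MvPolynomial.X i)
    (MvPolynomial.isHomogeneous_X k i) one_pos).preimage (curveι k b)

theorem top_le_preimage_chart (i : Fin 4) : ⊤ ≤ torusToCurve k b ⁻¹ᵁ chart k b i := by
  have h := ptHom_preimage (MvPolynomial.homogeneousSubmodule (Fin 4) k) (formsEval k b)
    (MvPolynomial.isHomogeneous_X k i) one_pos (isUnit_formsEval k b i)
  rw [← torusToCurve_ι] at h
  exact h

/-- The nonvanishing locus of `t` on `X` is open and misses the image of the torus, which is dense.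
-/
theorem curveι_preimage_eq_bot {t : MvPolynomial (Fin 4) k} {n : ℕ} (ht : t.IsHomogeneous n)
    (hn : 0 < n) (h0 : formsEval k b t = 0) :
    curveι k b ⁻¹ᵁ Proj.basicOpen (MvPolynomial.homogeneousSubmodule (Fin 4) k) t = ⊥ := by
  have h := ptHom_preimage_eq_bot (MvPolynomial.homogeneousSubmodule (Fin 4) k) (formsEval k b)
    (MvPolynomial.isHomogeneous_X k 0) one_pos (isUnit_formsEval k b 0) ht hn h0
  rw [← torusToCurve_ι] at h
  by_contra hne
  rw [← ne_eq, TopologicalSpace.Opens.ne_bot_iff_nonempty] at hne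
  obtain ⟨q, hq⟩ := (torusToCurve k b).denseRange.exists_mem_open
    (curveι k b ⁻¹ᵁ Proj.basicOpen _ t).2 hne
  exact h.le (show q ∈ _ from hq)

/-- The forms `X₁ ^ (3b+5) - X₀ ^ (3b+2) X₂ ^ 3` and `X₃ ^ (3b+5) - X₀ X₂ ^ (3b+4)` vanish on `X`.
If `X₀` and `X₂` vanish at a point, then so do `X₁` and `X₃`, which is impossible in projective
space. -/
theorem chart_sup : chart k b 0 ⊔ chart k b 2 = ⊤ := by
  have h1 := curveι_preimage_eq_bot k b (t := MvPolynomial.X 1 ^ (3 * b + 5) -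
      MvPolynomial.X 0 ^ (3 * b + 2) * MvPolynomial.X 2 ^ 3) (n := 3 * b + 5)
    (by
      have hX := fun i : Fin 4 ↦ MvPolynomial.isHomogeneous_X k i
      have e1 := (hX 1).pow (3 * b + 5)
      have e2 := ((hX 0).pow (3 * b + 2)).mul ((hX 2).pow 3)
      rw [one_mul] at e1
      rw [show 1 * (3 * b + 2) + 1 * 3 = 3 * b + 5 by ring] at e2
      exact e1.sub e2) (by omega)
    (by simp only [map_sub, map_mul, map_pow, formsEval_X0, formsEval_X1, formsEval_X2,
          LaurentPolynomial.T_pow, one_pow, one_mul]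
        rw [sub_eq_zero]; congr 1; push_cast; ring)
  have h3 := curveι_preimage_eq_bot k b (t := MvPolynomial.X 3 ^ (3 * b + 5) -
      MvPolynomial.X 0 * MvPolynomial.X 2 ^ (3 * b + 4)) (n := 3 * b + 5)
    (by
      have hX := fun i : Fin 4 ↦ MvPolynomial.isHomogeneous_X k i
      have e1 := (hX 3).pow (3 * b + 5)
      have e2 := (hX 0).mul ((hX 2).pow (3 * b + 4))
      rw [one_mul] at e1
      rw [show 1 + 1 * (3 * b + 4) = 3 * b + 5 by ring] at e2
      exact e1.sub e2) (by omega)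
    (by simp only [map_sub, map_mul, map_pow, formsEval_X0, formsEval_X3, formsEval_X2,
          LaurentPolynomial.T_pow, one_mul]
        rw [sub_eq_zero]; congr 1; push_cast; ring)
  rw [eq_top_iff]
  intro p _
  by_contra hp
  have h0 : MvPolynomial.X 0 ∈ (curveι k b p).asHomogeneousIdeal.toIdeal := by
    by_contra h; exact hp (Or.inl h)
  have h2 : MvPolynomial.X 2 ∈ (curveι k b p).asHomogeneousIdeal.toIdeal := by
    by_contra h; exact hp (Or.inr h)
  have hpr := (curveι k b p).isPrime
  have h1' : MvPolynomial.X 1 ∈ (curveι k b p).asHomogeneousIdeal.toIdeal := by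
    refine hpr.mem_of_pow_mem (3 * b + 5) ?_
    have : MvPolynomial.X 1 ^ (3 * b + 5) -
      MvPolynomial.X 0 ^ (3 * b + 2) * MvPolynomial.X 2 ^ 3 ∈
        (curveι k b p).asHomogeneousIdeal.toIdeal := by
      by_contra h
      exact (h1.le (show p ∈ _ from h))
    exact (Submodule.sub_mem_iff_left _ (Ideal.mul_mem_left _ _
      (Ideal.pow_mem_of_mem _ h2 _ (by omega)))).mp this
  have h3' : MvPolynomial.X 3 ∈ (curveι k b p).asHomogeneousIdeal.toIdeal := by
    refine hpr.mem_of_pow_mem (3 * b + 5) ?_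
    have : MvPolynomial.X 3 ^ (3 * b + 5) -
      MvPolynomial.X 0 * MvPolynomial.X 2 ^ (3 * b + 4) ∈
        (curveι k b p).asHomogeneousIdeal.toIdeal := by
      by_contra h
      exact (h3.le (show p ∈ _ from h))
    exact (Submodule.sub_mem_iff_left _ (Ideal.mul_mem_right _ _ h0)).mp this
  refine (curveι k b p).not_irrelevant_le ((HomogeneousIdeal.irrelevant_le _).mpr
    fun i hi x hx ↦ ?_)
  change x ∈ (curveι k b p).asHomogeneousIdeal.toIdeal
  have hx' : MvPolynomial.IsHomogeneous x i := hx
  rw [x.as_sum]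
  refine Ideal.sum_mem _ fun e he ↦ ?_
  have hd : e.degree = i := by
    by_contra hne
    exact (MvPolynomial.mem_support_iff.mp he) (hx'.coeff_eq_zero hne)
  obtain ⟨j, hj⟩ : ∃ j, e j ≠ 0 := by
    by_contra! h0
    have : e = 0 := Finsupp.ext h0
    rw [this, map_zero] at hd
    exact absurd hd hi.ne
  have hXj : MvPolynomial.X j ∈ (curveι k b p).asHomogeneousIdeal.toIdeal := by
    fin_cases j
    · exact h0
    · exact h1'
    · exact h2
    · exact h3'
  exact Ideal.mem_of_dvd _ ((MvPolynomial.X_dvd_monomial).mpr (Or.inr hj)) hXj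

end charts
end

noncomputable section
attribute [local instance] MvPolynomial.gradedAlgebra
open ProjPoint LaurentPolynomial

theorem appLE_congr_hom {X Y : Scheme.{u}} {f g : X ⟶ Y} (h : f = g) {U : Y.Opens} {V : X.Opens}
    (hf : V ≤ f ⁻¹ᵁ U) (hg : V ≤ g ⁻¹ᵁ U) (x : Γ(Y, U)) : f.appLE U V hf x = g.appLE U V hg x := by
  subst h; rfl

theorem ptHom_toSpecZero {A L : Type u} [CommRing A] [CommRing L] {σ : Type u} [SetLike σ A]
    [AddSubgroupClass σ A] (𝒜 : ℕ → σ) [GradedRing 𝒜] (E : A →+* L) {s : A} {m : ℕ}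
    (hs : s ∈ 𝒜 m) (hm : 0 < m) (hu : IsUnit (E s)) :
    ptHom 𝒜 E hs hm hu ≫ Proj.toSpecZero 𝒜 =
      Spec.map (CommRingCat.ofHom (E.comp (algebraMap (𝒜 0) A))) := by
  rw [ptHom, Category.assoc, Proj.awayι_toSpecZero, ← Spec.map_comp]
  congr 1
  ext a
  change awayEval 𝒜 E s hu (fromZeroRingHom 𝒜 _ a) = E (a : A)
  rw [awayEval_apply]
  have : (fromZeroRingHom 𝒜 (Submonoid.powers s) a).val =
    algebraMap A (Localization.Away s) (a : A) := rfl
  rw [this, IsLocalization.Away.lift_eq]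

/-! ### Functions on the curve as Laurent polynomials -/

section torusEval
variable (k : Type u) [Field k] (b : ℕ)

/-- Functions on an open subset of `X` containing the torus, as Laurent polynomials. -/
def torusEval (U : (curve k b).Opens) (h : ⊤ ≤ torusToCurve k b ⁻¹ᵁ U) :
    Γ(curve k b, U) →+* k[T;T⁻¹] :=
  (Scheme.ΓSpecIso (.of k[T;T⁻¹])).hom.hom.comp ((torusToCurve k b).appLE U ⊤ h).hom

theorem torusEval_apply (U : (curve k b).Opens) (h : ⊤ ≤ torusToCurve k b ⁻¹ᵁ U)
    (f : Γ(curve k b, U)) : torusEval k b U h f =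
      (Scheme.ΓSpecIso (.of k[T;T⁻¹])).hom ((torusToCurve k b).appLE U ⊤ h f) := rfl

/-- This is scheme-theoretic dominance of the torus; the restriction from the preimage of `U` to `⊤`
is an isomorphism because the two open sets coincide. -/
theorem torusEval_injective (U : (curve k b).Opens) (h : ⊤ ≤ torusToCurve k b ⁻¹ᵁ U) :
    Function.Injective (torusEval k b U h) := by
  have h1 : Function.Injective ((torusToCurve k b).app U) := Scheme.Hom.app_injective _ _
  have h2 : IsIso (homOfLE h) := by
    have : (⊤ : (Spec (.of k[T;T⁻¹])).Opens) = torusToCurve k b ⁻¹ᵁ U := top_le_iff.mp h |>.symm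
    exact ⟨homOfLE this.ge, Subsingleton.elim _ _, Subsingleton.elim _ _⟩
  have h3 : Function.Injective
      ((Spec (.of k[T;T⁻¹])).presheaf.map (homOfLE h).op) :=
    (ConcreteCategory.bijective_of_isIso _).1
  have h4 : Function.Injective (Scheme.ΓSpecIso (.of k[T;T⁻¹])).hom :=
    (ConcreteCategory.bijective_of_isIso _).1
  intro f g hfg
  exact h1 (h3 (h4 hfg))

theorem torusEval_map {U V : (curve k b).Opens} (hV : ⊤ ≤ torusToCurve k b ⁻¹ᵁ V)
    (hVU : V ≤ U) (f : Γ(curve k b, U)) :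
    torusEval k b V hV ((curve k b).presheaf.map (homOfLE hVU).op f) =
      torusEval k b U (hV.trans ((torusToCurve k b).preimage_mono hVU)) f :=
  congrArg (Scheme.ΓSpecIso (.of k[T;T⁻¹])).hom
    congr($(Scheme.Hom.map_appLE (torusToCurve k b) hV (homOfLE hVU).op) f)

/-- The function on a chart of `X` defined by a homogeneous fraction. -/
def chartFn (i : Fin 4) :
    Away (MvPolynomial.homogeneousSubmodule (Fin 4) k) (MvPolynomial.X i) →+*
      Γ(curve k b, chart k b i) :=
  ((curveι k b).app (Proj.basicOpen (MvPolynomial.homogeneousSubmodule (Fin 4) k)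
    (MvPolynomial.X i))).hom.comp
    (Proj.awayToSection (MvPolynomial.homogeneousSubmodule (Fin 4) k) (MvPolynomial.X i)).hom

theorem torusEval_chartFn (i : Fin 4)
    (a : Away (MvPolynomial.homogeneousSubmodule (Fin 4) k) (MvPolynomial.X i)) :
    torusEval k b _ (top_le_preimage_chart k b i) (chartFn k b i a) =
      awayEval _ (formsEval k b) _ (isUnit_formsEval k b i) a := by
  have h := ptHom_appLE (MvPolynomial.homogeneousSubmodule (Fin 4) k) (formsEval k b)
    (MvPolynomial.isHomogeneous_X k i) one_pos (isUnit_formsEval k b i)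
    (ptHom_preimage _ _ _ _ _) a
  have h2 := congr($(Scheme.Hom.comp_appLE (torusToCurve k b) (curveι k b) (Proj.basicOpen
    (MvPolynomial.homogeneousSubmodule (Fin 4) k) (MvPolynomial.X i)) ⊤
    (top_le_preimage_chart k b i)) (Proj.awayToSection _ (MvPolynomial.X i) a))
  have h3 := appLE_congr_hom (torusToCurve_ι k b i) (top_le_preimage_chart k b i)
    (ptHom_preimage _ _ _ _ _) (Proj.awayToSection _ (MvPolynomial.X i) a)
  rw [torusEval_apply]
  refine (congrArg _ (h2.symm.trans (h3.trans h))).trans ?_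
  exact congr($((Scheme.ΓSpecIso (.of k[T;T⁻¹])).inv_hom_id) _)

/-- A closed immersion is surjective on sections over the affine open `D₊(Xᵢ)`. -/
theorem chartFn_surjective (i : Fin 4) : Function.Surjective (chartFn k b i) := by
  have h1 : Function.Surjective (Proj.awayToSection (MvPolynomial.homogeneousSubmodule (Fin 4) k)
      (MvPolynomial.X i)) :=
    (ConcreteCategory.bijective_of_isIso (Proj.basicOpenIsoAway
      (MvPolynomial.homogeneousSubmodule (Fin 4) k) (MvPolynomial.X i)
      (MvPolynomial.isHomogeneous_X k i) one_pos).hom).2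
  have h2 : Function.Surjective ((curveι k b).app (Proj.basicOpen
      (MvPolynomial.homogeneousSubmodule (Fin 4) k) (MvPolynomial.X i))) :=
    ((curveι k b).app_surjective _ (Proj.isAffineOpen_basicOpen _ _
      (MvPolynomial.isHomogeneous_X k i) one_pos))
  exact h2.comp h1

theorem torusToCurve_toSpec : torusToCurve k b ≫ curveToSpec k b =
    Spec.map (CommRingCat.ofHom (LaurentPolynomial.C (R := k))) := by
  have h1 := ptHom_toSpecZero (MvPolynomial.homogeneousSubmodule (Fin 4) k) (formsEval k b)
    (MvPolynomial.isHomogeneous_X k 0) one_pos (isUnit_formsEval k b 0)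
  rw [← torusToCurve_ι] at h1
  have h2 : torusToCurve k b ≫ curveToSpec k b = (torusToCurve k b ≫ curveι k b) ≫
    Proj.toSpecZero (MvPolynomial.homogeneousSubmodule (Fin 4) k) ≫ Spec.map (CommRingCat.ofHom
    (algebraMap k (MvPolynomial.homogeneousSubmodule (Fin 4) k 0))) := rfl
  have h3 := congr($h1 ≫ Spec.map (CommRingCat.ofHom
    (algebraMap k (MvPolynomial.homogeneousSubmodule (Fin 4) k 0))))
  rw [Category.assoc, ← Spec.map_comp] at h3
  refine h2.trans (h3.trans ?_)
  congr 1
  exact CommRingCat.hom_ext (RingHom.ext fun a ↦ formsEval_C k b a)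

theorem torusEval_scalarMap (U : (curve k b).Opens) (h : ⊤ ≤ torusToCurve k b ⁻¹ᵁ U) (a : k) :
    torusEval k b U h (scalarMap (curveToSpec k b) U a) = LaurentPolynomial.C a := by
  refine (torusEval_map k b h le_top _).trans ?_
  rw [torusEval_apply]
  have h1 : (torusToCurve k b).appLE ⊤ ⊤ le_top ((curveToSpec k b).appTop
      ((Scheme.ΓSpecIso (.of k)).inv a)) = (torusToCurve k b ≫ curveToSpec k b).appTop
      ((Scheme.ΓSpecIso (.of k)).inv a) := by
    rw [Scheme.Hom.comp_appTop, CommRingCat.comp_apply]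
    rw [Scheme.Hom.appTop, Scheme.Hom.appTop, Scheme.Hom.app_eq_appLE]
    rfl
  refine (congrArg _ h1).trans ?_
  rw [torusToCurve_toSpec]
  have h2 := congr($(Scheme.ΓSpecIso_inv_naturality (CommRingCat.ofHom (LaurentPolynomial.C (R := k)))) a)
  refine (congrArg _ h2.symm).trans ?_
  exact congr($((Scheme.ΓSpecIso (.of k[T;T⁻¹])).inv_hom_id) _)

end torusEval
end

noncomputable section
attribute [local instance] MvPolynomial.gradedAlgebra
open ProjPoint LaurentPolynomial

/-! ### The rings of the two charts and of their overlap -/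

section chartRings
variable (k : Type u) [Field k] (b : ℕ)

/-- The ratio of two coordinates as a function on a chart of `X`. -/
def coordRatio (i j : Fin 4) : Γ(curve k b, chart k b i) :=
  chartFn k b i (Away.mk (MvPolynomial.homogeneousSubmodule (Fin 4) k)
    (MvPolynomial.isHomogeneous_X k i) 1 (MvPolynomial.X j)
      (by simpa using MvPolynomial.isHomogeneous_X k j))

theorem torusEval_coordRatio (i j : Fin 4) :
    formsEval k b (MvPolynomial.X i) *
      torusEval k b _ (top_le_preimage_chart k b i) (coordRatio k b i j) =
      formsEval k b (MvPolynomial.X j) := by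
  rw [coordRatio, torusEval_chartFn]
  have := awayEval_mk (MvPolynomial.homogeneousSubmodule (Fin 4) k) (formsEval k b)
    (isUnit_formsEval k b i) (MvPolynomial.isHomogeneous_X k i) 1 (MvPolynomial.X j)
    (by simpa using MvPolynomial.isHomogeneous_X k j)
  rwa [pow_one] at this

theorem basicOpen_coordRatio (i j : Fin 4) :
    (curve k b).basicOpen (coordRatio k b i j) = chart k b j ⊓ chart k b i := by
  have h := congrArg (curveι k b ⁻¹ᵁ ·) (basicOpen_awayToSection
    (MvPolynomial.homogeneousSubmodule (Fin 4) k)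
    (MvPolynomial.isHomogeneous_X k i) one_pos (MvPolynomial.isHomogeneous_X k j) one_pos)
  refine Eq.trans ?_ h
  refine Eq.trans ?_ (Scheme.preimage_basicOpen _ _).symm
  refine congrArg (fun z ↦ (curve k b).basicOpen (chartFn k b i z)) ?_
  apply HomogeneousLocalization.val_injective
  refine (Away.val_mk _ _ _ _ _).trans (Eq.trans ?_ (Away.val_mk _ _ _ _ _).symm)
  simp only [pow_one]

/-- The map `k[x, y, z] → k[T, T⁻¹]` with `x ↦ T ^ 3`, `y ↦ T ^ (3b+5)`, `z ↦ T ^ (3b+4)`. -/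
def paramHom : MvPolynomial (Fin 3) k →ₐ[k] k[T;T⁻¹] :=
  MvPolynomial.aeval ![LaurentPolynomial.T 3, LaurentPolynomial.T ((3 * b + 5 : ℕ) : ℤ),
    LaurentPolynomial.T ((3 * b + 4 : ℕ) : ℤ)]

/-- The map `k[x, y, z] → Γ(X, X₁)` for the first chart. -/
def coordHom : MvPolynomial (Fin 3) k →+* Γ(curve k b, chart k b 0) := chartHom k b

theorem coordHom_C (a : k) :
    coordHom k b (MvPolynomial.C a) = scalarMap (curveToSpec k b) (chart k b 0) a :=
  MvPolynomial.eval₂Hom_C _ _ _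

theorem coordHom_X (i : Fin 3) : coordHom k b (MvPolynomial.X i) = coordRatio k b 0 i.succ := by
  refine (MvPolynomial.eval₂Hom_X' _ _ _).trans ?_
  fin_cases i <;> rfl

theorem torusEval_coordHom (p : MvPolynomial (Fin 3) k) :
    torusEval k b _ (top_le_preimage_chart k b 0) (coordHom k b p) = paramHom k b p := by
  have h : (torusEval k b _ (top_le_preimage_chart k b 0)).comp (coordHom k b) =
      (paramHom k b).toRingHom := by
    have hc : ∀ i, torusEval k b _ (top_le_preimage_chart k b 0) (coordRatio k b 0 i) =
        formsEval k b (MvPolynomial.X i) := fun i ↦ by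
      have := torusEval_coordRatio k b 0 i
      rwa [formsEval_X0, one_mul] at this
    refine MvPolynomial.ringHom_ext (fun a ↦ ?_) fun i ↦ ?_
    · rw [RingHom.comp_apply, coordHom_C, torusEval_scalarMap]
      simp [paramHom]
    · rw [RingHom.comp_apply, coordHom_X, hc]
      fin_cases i
      · refine (formsEval_X1 k b).trans ?_; simp [paramHom]
      · refine (formsEval_X2 k b).trans ?_; simp [paramHom]
      · refine (formsEval_X3 k b).trans ?_; simp [paramHom]
  exact congr($h p)

theorem paramHom_dehomogenize (a : MvPolynomial (Fin 4) k) :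
    paramHom k b (MvPolynomial.aeval ![1, MvPolynomial.X 0, MvPolynomial.X 1, MvPolynomial.X 2] a) =
      formsEval k b a := by
  have h : (paramHom k b).toRingHom.comp (MvPolynomial.aeval (R := k) (S₁ := MvPolynomial (Fin 3) k)
      ![1, MvPolynomial.X 0, MvPolynomial.X 1, MvPolynomial.X 2]).toRingHom = formsEval k b := by
    refine MvPolynomial.ringHom_ext (fun a ↦ ?_) fun i ↦ ?_
    · rw [formsEval_C]; simp [MvPolynomial.algebraMap_eq, paramHom]
    · fin_cases i
      · refine Eq.trans ?_ (formsEval_X0 k b).symm; simp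
      · refine Eq.trans ?_ (formsEval_X1 k b).symm; simp [paramHom]
      · refine Eq.trans ?_ (formsEval_X2 k b).symm; simp [paramHom]
      · refine Eq.trans ?_ (formsEval_X3 k b).symm; simp [paramHom]
  exact congr($h a)

theorem coordHom_surjective : Function.Surjective (coordHom k b) := by
  intro f
  obtain ⟨z, rfl⟩ := chartFn_surjective k b 0 f
  obtain ⟨n, a, ha, rfl⟩ := Away.mk_surjective _ (MvPolynomial.isHomogeneous_X k 0) z
  refine ⟨_, torusEval_injective k b _ (top_le_preimage_chart k b 0)
    ((torusEval_coordHom k b _).trans ((paramHom_dehomogenize k b a).trans ?_))⟩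
  refine Eq.trans ?_ (torusEval_chartFn k b 0 _).symm
  have := awayEval_mk (MvPolynomial.homogeneousSubmodule (Fin 4) k) (formsEval k b)
    (isUnit_formsEval k b 0) (MvPolynomial.isHomogeneous_X k 0) n a ha
  rw [formsEval_X0, one_pow, one_mul] at this
  exact this.symm

/-- By injectivity of `torusEval` the equations of the first chart are the polynomial relations
between three powers of `T`. -/
theorem ker_coordHom : RingHom.ker (coordHom k b) = RingHom.ker (paramHom k b) := by
  ext p
  rw [RingHom.mem_ker, RingHom.mem_ker, ← torusEval_coordHom,
    map_eq_zero_iff _ (torusEval_injective k b _ _)]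

theorem coeff_evalHom_eq_zero {d : ℕ} {p : MvPolynomial (Fin 2) k} (hp : p.IsHomogeneous d)
    {i : ℤ} (hi : (d : ℤ) < i) : (evalHom k p).coeff i = 0 := by
  rw [p.as_sum, map_sum]
  simp only [evalHom_monomial, AddMonoidAlgebra.coeff_sum, Finsupp.finsetSum_apply,
      ← LaurentPolynomial.single_eq_C_mul_T, AddMonoidAlgebra.coeff_single]
  refine Finset.sum_eq_zero fun e he ↦ Finsupp.single_eq_of_ne ?_
  rintro rfl
  have := hp (MvPolynomial.mem_support_iff.mp he)
  simp [Finsupp.weight_apply, Finsupp.sum_fintype, Fin.sum_univ_two] at this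
  omega

/-- A function on this chart is `a / X₂ ^ n` with `a` of degree `n`. Its numerator pulls back to a
form of degree `(3b+5) n`, so of degree at most that in `T`, and `X₂ ^ n` pulls back to `T ^ ((3b+5)
n)`. -/
theorem coeff_torusEval_eq_zero (f : Γ(curve k b, chart k b 2)) {i : ℤ} (hi : 0 < i) :
    (torusEval k b _ (top_le_preimage_chart k b 2) f).coeff i = 0 := by
  obtain ⟨z, rfl⟩ := chartFn_surjective k b 2 f
  obtain ⟨n, a, ha, rfl⟩ := Away.mk_surjective _ (MvPolynomial.isHomogeneous_X k 2) z
  rw [torusEval_chartFn]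
  have h1 := awayEval_mk (MvPolynomial.homogeneousSubmodule (Fin 4) k) (formsEval k b)
    (isUnit_formsEval k b 2) (MvPolynomial.isHomogeneous_X k 2) n a ha
  have h2 : (formsEval k b a).coeff (i + ((3 * b + 5) * n : ℕ)) = 0 := by
    have := aeval_mem_homogeneousSubmodule (curveForms k b) (curveForms_isHomogeneous k b) (n • 1) a ha
    exact coeff_evalHom_eq_zero k this (by simp; omega)
  rw [← h1, formsEval_X2, LaurentPolynomial.T_pow, mul_comm] at h2
  rw [← one_mul (LaurentPolynomial.T _), ← map_one LaurentPolynomial.C,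
    ← LaurentPolynomial.single_eq_C_mul_T, show ((n : ℤ) * ((3 * b + 5 : ℕ) : ℤ)) =
      ((3 * b + 5) * n : ℕ) by push_cast; ring, AddMonoidAlgebra.coeff_mul_single_add,
    mul_one] at h2
  exact h2

theorem top_le_preimage_overlap : ⊤ ≤ torusToCurve k b ⁻¹ᵁ (chart k b 0 ⊓ chart k b 2) :=
  fun _ hq ↦ ⟨top_le_preimage_chart k b 0 hq, top_le_preimage_chart k b 2 hq⟩

theorem torusEval_coordRatio_two_three :
    torusEval k b _ (top_le_preimage_chart k b 2) (coordRatio k b 2 3) =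
      LaurentPolynomial.T (-1) := by
  have h := torusEval_coordRatio k b 2 3
  rw [formsEval_X2, formsEval_X3] at h
  have h2 := congrArg (LaurentPolynomial.T (-((3 * b + 5 : ℕ) : ℤ)) * ·) h
  simp only [← mul_assoc, ← LaurentPolynomial.T_add, neg_add_cancel, LaurentPolynomial.T_zero,
    one_mul] at h2
  rw [h2]; congr 1; push_cast; ring

theorem torusEval_coordRatio_two_zero :
    torusEval k b _ (top_le_preimage_chart k b 2) (coordRatio k b 2 0) =
      LaurentPolynomial.T (-((3 * b + 5 : ℕ) : ℤ)) := by
  have h := torusEval_coordRatio k b 2 0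
  rw [formsEval_X2, formsEval_X0] at h
  have h2 := congrArg (LaurentPolynomial.T (-((3 * b + 5 : ℕ) : ℤ)) * ·) h
  simp only [← mul_assoc, ← LaurentPolynomial.T_add, neg_add_cancel, LaurentPolynomial.T_zero,
    one_mul, mul_one] at h2
  exact h2

/-- The overlap contains `T⁻¹` from the second chart and the positive power `T ^ (3b+5)` from the
first one; together they produce every `T ^ n`. -/
theorem torusEval_overlap_surjective :
    Function.Surjective (torusEval k b _ (top_le_preimage_overlap k b)) := by
  have hC : ∀ a : k, LaurentPolynomial.C a ∈ (torusEval k b _ (top_le_preimage_overlap k b)).range :=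
    fun a ↦ ⟨_, torusEval_scalarMap k b _ _ a⟩
  have h1 : LaurentPolynomial.T (-1) ∈ (torusEval k b _ (top_le_preimage_overlap k b)).range :=
    ⟨_, (torusEval_map k b (top_le_preimage_overlap k b) inf_le_right _).trans
      (torusEval_coordRatio_two_three k b)⟩
  have h2 : LaurentPolynomial.T ((3 * b + 5 : ℕ) : ℤ) ∈
      (torusEval k b _ (top_le_preimage_overlap k b)).range := by
    refine ⟨_, (torusEval_map k b (top_le_preimage_overlap k b) inf_le_left
      (coordRatio k b 0 2)).trans ?_⟩
    have := torusEval_coordRatio k b 0 2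
    rwa [formsEval_X0, one_mul, formsEval_X2] at this
  have hT : ∀ n : ℤ, LaurentPolynomial.T n ∈
      (torusEval k b _ (top_le_preimage_overlap k b)).range := by
    intro n
    -- First overshoot to `T ^ ((3b+5) |n|)`, then come down to `T ^ n` by powers of `T⁻¹`; the
    -- number of steps down is nonnegative because `n ≤ |n|`.
    have h := mul_mem (pow_mem h2 n.natAbs) (pow_mem h1 ((3 * b + 5) * n.natAbs - n).toNat)
    rw [LaurentPolynomial.T_pow, LaurentPolynomial.T_pow, ← LaurentPolynomial.T_add] at h
    convert h using 2
    have : (0 : ℤ) ≤ (3 * b + 5) * n.natAbs - n := by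
      have : (n : ℤ) ≤ n.natAbs := by omega
      nlinarith
    rw [Int.toNat_of_nonneg this]
    push_cast; ring
  intro g
  change g ∈ (torusEval k b _ (top_le_preimage_overlap k b)).range
  induction g using LaurentPolynomial.induction_on' with
  | add p q hp hq => exact add_mem hp hq
  | C_mul_T n a => exact mul_mem (hC a) (hT n)

/-- Laurent polynomials as functions on the overlap of the two charts. -/
def torusFn : k[T;T⁻¹] →+* Γ(curve k b, chart k b 0 ⊓ chart k b 2) :=
  (RingEquiv.ofBijective _ ⟨torusEval_injective k b _ (top_le_preimage_overlap k b),
    torusEval_overlap_surjective k b⟩).symm.toRingHom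

theorem torusEval_torusFn (g : k[T;T⁻¹]) :
    torusEval k b _ (top_le_preimage_overlap k b) (torusFn k b g) = g :=
  (RingEquiv.ofBijective _ ⟨torusEval_injective k b _ (top_le_preimage_overlap k b),
    torusEval_overlap_surjective k b⟩).apply_symm_apply g

theorem torusFn_torusEval (f : Γ(curve k b, chart k b 0 ⊓ chart k b 2)) :
    torusFn k b (torusEval k b _ (top_le_preimage_overlap k b) f) = f :=
  (RingEquiv.ofBijective _ ⟨torusEval_injective k b _ (top_le_preimage_overlap k b),
    torusEval_overlap_surjective k b⟩).symm_apply_apply f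

theorem map_left_eq_torusFn (f : Γ(curve k b, chart k b 0)) :
    (curve k b).presheaf.map (homOfLE inf_le_left).op f =
      torusFn k b (torusEval k b _ (top_le_preimage_chart k b 0) f) := by
  rw [← torusFn_torusEval k b ((curve k b).presheaf.map _ f)]
  exact congrArg _ (torusEval_map k b (top_le_preimage_overlap k b) inf_le_left f)

theorem map_right_eq_torusFn (f : Γ(curve k b, chart k b 2)) :
    (curve k b).presheaf.map (homOfLE inf_le_right).op f =
      torusFn k b (torusEval k b _ (top_le_preimage_chart k b 2) f) := by
  rw [← torusFn_torusEval k b ((curve k b).presheaf.map _ f)]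
  exact congrArg _ (torusEval_map k b (top_le_preimage_overlap k b) inf_le_right f)

theorem scalarMap_eq_torusFn (a : k) :
    scalarMap (curveToSpec k b) (chart k b 0 ⊓ chart k b 2) a =
      torusFn k b (LaurentPolynomial.C a) := by
  rw [← torusFn_torusEval k b (scalarMap _ _ a), torusEval_scalarMap]

end chartRings
end

noncomputable section
attribute [local instance] MvPolynomial.gradedAlgebra
open ProjPoint LaurentPolynomial

/-! ### The semigroup ring and its equations -/

section semigroupRing
variable (k : Type u) [Field k] (b : ℕ)

theorem coeff_mul_T (g : k[T;T⁻¹]) (m n : ℤ) :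
    (g * LaurentPolynomial.T m).coeff n = g.coeff (n - m) := by
  have := AddMonoidAlgebra.coeff_mul_single_add g (1 : k) m (n - m)
  rw [sub_add_cancel, LaurentPolynomial.single_eq_C_mul_T, map_one, one_mul, mul_one] at this
  exact this

theorem coeff_aeval_T_three (p : Polynomial k) (n : ℤ) :
    (Polynomial.aeval (LaurentPolynomial.T 3 : k[T;T⁻¹]) p).coeff n =
      if 3 ∣ n ∧ 0 ≤ n then p.coeff (n / 3).toNat else 0 := by
  induction p using Polynomial.induction_on' with
  | add p q hp hq =>
    rw [map_add, AddMonoidAlgebra.coeff_add, Finsupp.add_apply, hp, hq]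
    split_ifs <;> simp
  | monomial i a =>
    rw [Polynomial.aeval_monomial, LaurentPolynomial.T_pow, LaurentPolynomial.algebraMap_apply]
    rw [coeff_mul_T, Polynomial.coeff_monomial]
    simp only [Algebra.algebraMap_self, RingHom.id_apply, LaurentPolynomial.C_apply]
    by_cases h : 3 ∣ n ∧ 0 ≤ n
    · rw [if_pos h]
      congr 1
      apply propext
      omega
    · rw [if_neg h, if_neg (by omega)]

/-- The element `p₀(x) + y p₁(x) + z p₂(x)` of `k[x, y, z]`. -/
def normalForm (p₀ p₁ p₂ : Polynomial k) : MvPolynomial (Fin 3) k :=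
  Polynomial.aeval (MvPolynomial.X 0) p₀ + MvPolynomial.X 1 * Polynomial.aeval (MvPolynomial.X 0) p₁ +
    MvPolynomial.X 2 * Polynomial.aeval (MvPolynomial.X 0) p₂

theorem det_submatrix_zero :
    ((hilbertBurchMatrix k b).submatrix (Fin.succAbove 0) id).det =
      MvPolynomial.X 1 * MvPolynomial.X 1 -
    MvPolynomial.X 2 * MvPolynomial.X 0 ^ (b + 2) := by
  simp [Matrix.det_fin_two, hilbertBurchMatrix]

theorem minor_zero_mem : (MvPolynomial.X 1 * MvPolynomial.X 1 -
    MvPolynomial.X 2 * MvPolynomial.X 0 ^ (b + 2) : MvPolynomial (Fin 3) k) ∈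
      maximalMinors (hilbertBurchMatrix k b) :=
  Ideal.subset_span ⟨0, det_submatrix_zero k b⟩

theorem det_submatrix_one :
    ((hilbertBurchMatrix k b).submatrix (Fin.succAbove 1) id).det =
      MvPolynomial.X 2 * MvPolynomial.X 1 -
    MvPolynomial.X 0 ^ (b + 1) * MvPolynomial.X 0 ^ (b + 2) := by
  simp [Matrix.det_fin_two, hilbertBurchMatrix, Fin.succAbove]

theorem minor_one_mem : (MvPolynomial.X 2 * MvPolynomial.X 1 -
    MvPolynomial.X 0 ^ (b + 1) * MvPolynomial.X 0 ^ (b + 2) : MvPolynomial (Fin 3) k) ∈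
      maximalMinors (hilbertBurchMatrix k b) :=
  Ideal.subset_span ⟨1, det_submatrix_one k b⟩

theorem det_submatrix_two :
    ((hilbertBurchMatrix k b).submatrix (Fin.succAbove 2) id).det =
      MvPolynomial.X 2 * MvPolynomial.X 2 -
    MvPolynomial.X 0 ^ (b + 1) * MvPolynomial.X 1 := by
  simp [Matrix.det_fin_two, hilbertBurchMatrix, Fin.succAbove]

theorem minor_two_mem : (MvPolynomial.X 2 * MvPolynomial.X 2 -
    MvPolynomial.X 0 ^ (b + 1) * MvPolynomial.X 1 : MvPolynomial (Fin 3) k) ∈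
      maximalMinors (hilbertBurchMatrix k b) :=
  Ideal.subset_span ⟨2, det_submatrix_two k b⟩

/-- Modulo the minors, `y ^ 2 = z x ^ (b+2)`, `y z = x ^ (2b+3)` and `z ^ 2 = x ^ (b+1) y`. Hence
the `k[x]`-span of `1, y, z` is stable under multiplication by each variable. -/
theorem exists_normalForm (p : MvPolynomial (Fin 3) k) : ∃ p₀ p₁ p₂ : Polynomial k,
    p - normalForm k p₀ p₁ p₂ ∈ maximalMinors (hilbertBurchMatrix k b) := by
  induction p using MvPolynomial.induction_on with
  | C a =>
    refine ⟨Polynomial.C a, 0, 0, ?_⟩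
    simp [normalForm, MvPolynomial.algebraMap_eq]
  | add p q hp hq =>
    obtain ⟨p₀, p₁, p₂, hp⟩ := hp
    obtain ⟨q₀, q₁, q₂, hq⟩ := hq
    refine ⟨p₀ + q₀, p₁ + q₁, p₂ + q₂, ?_⟩
    convert add_mem hp hq using 1
    simp only [normalForm, map_add]
    ring
  | mul_X p i hp =>
    obtain ⟨p₀, p₁, p₂, hp⟩ := hp
    have hp' := Ideal.mul_mem_right (MvPolynomial.X i) _ hp
    have h0 := minor_zero_mem k b
    have h1 := minor_one_mem k b
    have h2 := minor_two_mem k b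
    fin_cases i
    · refine ⟨p₀ * Polynomial.X, p₁ * Polynomial.X, p₂ * Polynomial.X, ?_⟩
      convert hp' using 1
      simp only [normalForm, map_mul, Polynomial.aeval_X, Fin.zero_eta]
      ring
    -- Multiplication by `y` turns `y p₁` into `z x ^ (b+2) p₁` and `z p₂` into `x ^ (2b+3) p₂`.
    · refine ⟨p₂ * Polynomial.X ^ (2 * b + 3), p₀, p₁ * Polynomial.X ^ (b + 2), ?_⟩
      convert add_mem hp' (add_mem (Ideal.mul_mem_left _ (Polynomial.aeval (MvPolynomial.X 0) p₁) h0)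
        (Ideal.mul_mem_left _ (Polynomial.aeval (MvPolynomial.X 0) p₂) h1)) using 1
      simp only [normalForm, map_mul, map_pow, Polynomial.aeval_X, Fin.mk_one]
      ring
    -- Multiplication by `z` turns `y p₁` into `x ^ (2b+3) p₁` and `z p₂` into `y x ^ (b+1) p₂`.
    · refine ⟨p₁ * Polynomial.X ^ (2 * b + 3), p₂ * Polynomial.X ^ (b + 1), p₀, ?_⟩
      convert add_mem hp' (add_mem (Ideal.mul_mem_left _ (Polynomial.aeval (MvPolynomial.X 0) p₁) h1)
        (Ideal.mul_mem_left _ (Polynomial.aeval (MvPolynomial.X 0) p₂) h2)) using 1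
      simp only [normalForm, map_mul, map_pow, Polynomial.aeval_X, Fin.reduceFinMk]
      ring

theorem paramHom_X0 : paramHom k b (MvPolynomial.X 0) = LaurentPolynomial.T 3 := by simp [paramHom]

theorem paramHom_X1 :
    paramHom k b (MvPolynomial.X 1) = LaurentPolynomial.T ((3 * b + 5 : ℕ) : ℤ) := by
  simp [paramHom]

theorem paramHom_X2 :
    paramHom k b (MvPolynomial.X 2) = LaurentPolynomial.T ((3 * b + 4 : ℕ) : ℤ) := by
  simp [paramHom]

theorem maximalMinors_le_ker :
    maximalMinors (hilbertBurchMatrix k b) ≤ RingHom.ker (paramHom k b) := by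
  rw [maximalMinors, Ideal.span_le]
  rintro _ ⟨i, rfl⟩
  rw [SetLike.mem_coe, RingHom.mem_ker]
  fin_cases i
  · refine (congrArg _ (det_submatrix_zero k b)).trans ?_
    simp only [map_sub, map_mul, map_pow, paramHom_X0, paramHom_X1, paramHom_X2,
      LaurentPolynomial.T_pow, ← LaurentPolynomial.T_add]
    rw [sub_eq_zero]; congr 1; push_cast; ring
  · refine (congrArg _ (det_submatrix_one k b)).trans ?_
    simp only [map_sub, map_mul, map_pow, paramHom_X0, paramHom_X1, paramHom_X2,
      LaurentPolynomial.T_pow, ← LaurentPolynomial.T_add]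
    rw [sub_eq_zero]; congr 1; push_cast; ring
  · refine (congrArg _ (det_submatrix_two k b)).trans ?_
    simp only [map_sub, map_mul, map_pow, paramHom_X0, paramHom_X1, paramHom_X2,
      LaurentPolynomial.T_pow, ← LaurentPolynomial.T_add]
    rw [sub_eq_zero]; congr 1; push_cast; ring

theorem coeff_paramHom_normalForm (p₀ p₁ p₂ : Polynomial k) (n : ℤ) :
    (paramHom k b (normalForm k p₀ p₁ p₂)).coeff n =
      (Polynomial.aeval (LaurentPolynomial.T 3 : k[T;T⁻¹]) p₀).coeff n +
      (Polynomial.aeval (LaurentPolynomial.T 3 : k[T;T⁻¹]) p₁).coeff (n - (3 * b + 5 : ℕ)) +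
      (Polynomial.aeval (LaurentPolynomial.T 3 : k[T;T⁻¹]) p₂).coeff (n - (3 * b + 4 : ℕ)) := by
  have h : paramHom k b (normalForm k p₀ p₁ p₂) =
      Polynomial.aeval (LaurentPolynomial.T 3 : k[T;T⁻¹]) p₀ +
      Polynomial.aeval (LaurentPolynomial.T 3 : k[T;T⁻¹]) p₁ *
        LaurentPolynomial.T ((3 * b + 5 : ℕ) : ℤ) +
      Polynomial.aeval (LaurentPolynomial.T 3 : k[T;T⁻¹]) p₂ *
        LaurentPolynomial.T ((3 * b + 4 : ℕ) : ℤ) := by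
    simp only [normalForm, map_add, map_mul, ← Polynomial.aeval_algHom_apply, paramHom_X0,
      paramHom_X1, paramHom_X2]
    ring
  rw [h, AddMonoidAlgebra.coeff_add, AddMonoidAlgebra.coeff_add, Finsupp.add_apply,
    Finsupp.add_apply, coeff_mul_T, coeff_mul_T]

/-- In a normal form the terms `p₀`, `y p₁`, `z p₂` have exponents congruent to `0`, `2`, `1` modulo
`3`. They cannot cancel each other, so a normal form in the kernel is zero. -/
theorem ker_paramHom : RingHom.ker (paramHom k b) = maximalMinors (hilbertBurchMatrix k b) := by
  refine le_antisymm (fun p hp ↦ ?_) (maximalMinors_le_ker k b)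
  obtain ⟨p₀, p₁, p₂, h⟩ := exists_normalForm k b p
  have h0 : paramHom k b (normalForm k p₀ p₁ p₂) = 0 := by
    have := maximalMinors_le_ker k b h
    rw [RingHom.mem_ker, map_sub, (RingHom.mem_ker).mp hp, zero_sub, neg_eq_zero] at this
    exact this
  have hc : ∀ n : ℤ, (paramHom k b (normalForm k p₀ p₁ p₂)).coeff n = 0 := by simp [h0]
  simp only [coeff_paramHom_normalForm, coeff_aeval_T_three] at hc
  have e0 : p₀ = 0 := by
    ext i
    have := hc (3 * i)
    rw [if_pos (by omega), if_neg (by omega), if_neg (by omega)] at this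
    simpa using this
  have e1 : p₁ = 0 := by
    ext i
    have := hc (3 * i + (3 * b + 5 : ℕ))
    rw [if_neg (by omega), if_pos (by omega), if_neg (by omega)] at this
    simpa using this
  have e2 : p₂ = 0 := by
    ext i
    have := hc (3 * i + (3 * b + 4 : ℕ))
    rw [if_neg (by omega), if_neg (by omega), if_pos (by omega)] at this
    simpa using this
  subst e0 e1 e2
  simpa [normalForm] using h

/-- The exponents of the semigroup generated by `3`, `3b+4`, `3b+5`. -/
def IsExponent (n : ℤ) : Prop := 0 ≤ n ∧ ∀ i : ℕ, i ≤ b → n ≠ 3 * i + 1 ∧ n ≠ 3 * i + 2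

theorem coeff_paramHom_eq_zero (p : MvPolynomial (Fin 3) k) {n : ℤ} (hn : ¬ IsExponent b n) :
    (paramHom k b p).coeff n = 0 := by
  obtain ⟨p₀, p₁, p₂, h⟩ := exists_normalForm k b p
  have h0 : paramHom k b p = paramHom k b (normalForm k p₀ p₁ p₂) := by
    have := maximalMinors_le_ker k b h
    rwa [RingHom.mem_ker, map_sub, sub_eq_zero] at this
  rw [h0, coeff_paramHom_normalForm, coeff_aeval_T_three, coeff_aeval_T_three, coeff_aeval_T_three]
  have hn' : ¬ (3 ∣ n ∧ 0 ≤ n) ∧ ¬ (3 ∣ n - (3 * b + 5 : ℕ) ∧ 0 ≤ n - (3 * b + 5 : ℕ)) ∧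
      ¬ (3 ∣ n - (3 * b + 4 : ℕ) ∧ 0 ≤ n - (3 * b + 4 : ℕ)) := by
    refine ⟨fun h ↦ hn ⟨h.2, fun i hi ↦ by omega⟩, fun h ↦ hn ⟨by omega, fun i hi ↦ by omega⟩,
      fun h ↦ hn ⟨by omega, fun i hi ↦ by omega⟩⟩
  rw [if_neg hn'.1, if_neg hn'.2.1, if_neg hn'.2.2]
  simp

theorem exists_paramHom_eq_T {n : ℤ} (hn : IsExponent b n) :
    ∃ p, paramHom k b p = LaurentPolynomial.T n := by
  obtain ⟨h0, h⟩ := hn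
  -- The smallest exponents in the three residue classes are `0`, `3b+4` and `3b+5`; the rest is a
  -- power of `x`.
  have hlt : n % 3 = 0 ∨ (n % 3 = 1 ∧ 3 * b + 4 ≤ n) ∨ (n % 3 = 2 ∧ 3 * b + 5 ≤ n) := by
    have := h (n / 3).toNat
    omega
  rcases hlt with h3 | ⟨h3, hb⟩ | ⟨h3, hb⟩
  · refine ⟨MvPolynomial.X 0 ^ (n / 3).toNat, ?_⟩
    rw [map_pow, paramHom_X0, LaurentPolynomial.T_pow]; congr 1; omega
  · refine ⟨MvPolynomial.X 0 ^ ((n - (3 * b + 4)) / 3).toNat * MvPolynomial.X 2, ?_⟩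
    rw [map_mul, map_pow, paramHom_X0, paramHom_X2, LaurentPolynomial.T_pow,
      ← LaurentPolynomial.T_add]; congr 1; omega
  · refine ⟨MvPolynomial.X 0 ^ ((n - (3 * b + 5)) / 3).toNat * MvPolynomial.X 1, ?_⟩
    rw [map_mul, map_pow, paramHom_X0, paramHom_X1, LaurentPolynomial.T_pow,
      ← LaurentPolynomial.T_add]; congr 1; omega

end semigroupRing
end

noncomputable section

/-! ### Sheaves of modules with local free generators -/

section freeGenerators
open RelProj
variable {X : Scheme.{u}}

/-- The section `e` over `U` freely generates the sheaf of modules `F` over `U`. -/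
def IsFreeGenerator (F : X.Modules) (U : X.Opens) (e : Γ(F, U)) : Prop :=
  ∀ (V : X.Opens) (h : V ≤ U), Function.Bijective fun a : Γ(X, V) ↦ a • res F h e

theorem IsFreeGenerator.finite {F : X.Modules} {U : X.Opens} {e : Γ(F, U)}
    (h : IsFreeGenerator F U e) : Module.Finite Γ(X, U) Γ(F, U) := by
  refine ⟨⟨{e}, ?_⟩⟩
  rw [eq_top_iff]
  intro s _
  obtain ⟨a, rfl⟩ := (h U le_rfl).2 s
  simp only [res_self, Finset.coe_singleton]
  exact Submodule.smul_mem _ _ (Submodule.mem_span_singleton_self e)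

/-- A section over `U` as a section of the restriction to the slice category over `U`. -/
def overSection {F : X.Modules} {U : X.Opens} (e : Γ(F, U)) :
    (SheafOfModules.over (R := X.ringCatSheaf) F U).sections :=
  ⟨fun V ↦ res F (leOfHom V.unop.hom) e, fun _ ↦ res_res F _ _ e⟩

theorem isIso_freeHomEquiv_symm {C : Type*} [Category C] {J : GrothendieckTopology C}
    {R : Sheaf J RingCat.{u}} [HasSheafify J AddCommGrpCat.{u}]
    [J.WEqualsLocallyBijective AddCommGrpCat.{u}] (M : SheafOfModules.{u} R) (s : M.sections)
    [IsIso (M.unitHomEquiv.symm s)] :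
    IsIso (M.freeHomEquiv.symm (fun _ : PUnit.{u + 1} ↦ s)) := by
  have h : ∀ i, SheafOfModules.ιFree i ≫ M.freeHomEquiv.symm (fun _ : PUnit.{u + 1} ↦ s) =
      M.unitHomEquiv.symm s := fun i ↦ by
    rw [← SheafOfModules.unitHomEquiv_symm_freeHomEquiv_apply, Equiv.apply_symm_apply]
  refine ⟨inv (M.unitHomEquiv.symm s) ≫ SheafOfModules.ιFree PUnit.unit, ?_, ?_⟩
  · apply (SheafOfModules.free PUnit.{u + 1}).freeHomEquiv.injective
    funext i
    apply (SheafOfModules.free PUnit.{u + 1}).unitHomEquiv.symm.injective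
    rw [SheafOfModules.unitHomEquiv_symm_freeHomEquiv_apply,
      SheafOfModules.unitHomEquiv_symm_freeHomEquiv_apply, ← Category.assoc, h,
      IsIso.hom_inv_id_assoc, Category.comp_id]
  · rw [Category.assoc, h, IsIso.inv_hom_id]

/-- Isomorphisms of sheaves are detected on sections, where the claim is the definition of a free
generator. -/
theorem isIso_unitHomEquiv_symm {F : X.Modules} {U : X.Opens} {e : Γ(F, U)}
    (h : IsFreeGenerator F U e) :
    IsIso ((SheafOfModules.over (R := X.ringCatSheaf) F U).unitHomEquiv.symm (overSection e)) := by
  rw [← isIso_iff_of_reflects_iso _ (SheafOfModules.forget _),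
    ← isIso_iff_of_reflects_iso _ (PresheafOfModules.toPresheaf _), NatTrans.isIso_iff_isIso_app]
  intro V
  rw [ConcreteCategory.isIso_iff_bijective]
  exact h V.unop.left (leOfHom V.unop.hom)

/-- The generators trivialize `F` on a cover, and a locally free sheaf has local presentations. -/
theorem isQuasicoherent_of_isFreeGenerator {F : X.Modules} {ι : Type u} (U : ι → X.Opens)
    (hU : ⨆ i, U i = ⊤) (e : ∀ i, Γ(F, U i)) (h : ∀ i, IsFreeGenerator F (U i) (e i)) :
    F.IsQuasicoherent := by
  have := fun i ↦ isIso_unitHomEquiv_symm (h i)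
  have := fun i ↦ isIso_freeHomEquiv_symm (SheafOfModules.over (R := X.ringCatSheaf) F (U i))
    (overSection (e i))
  let q : SheafOfModules.LocalGeneratorsData.{u} (R := X.ringCatSheaf) F :=
    { I := ι
      X := U
      coversTop := by rw [Opens.coversTop_iff]; exact hU
      generators := fun i ↦
        { I := PUnit
          s := fun _ ↦ overSection (e i)
          epi := inferInstance } }
  have : q.IsLocallyFreeData := { isIso := this }
  exact q.quasiCoherentData.isQuasicoherent

end freeGenerators
end

noncomputable section

/-! ### Morphisms out of a sheaf that is free on two open sets -/

section glueHom
open RelProj TopologicalSpace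
variable {X : Scheme.{u}} (G : X.Modules)

theorem sections_ext {U₀ U₁ : X.Opens} (hU : U₀ ⊔ U₁ = ⊤) {W : X.Opens} {s t : Γ(G, W)}
    (h₀ : res G (inf_le_left : W ⊓ U₀ ≤ W) s = res G inf_le_left t)
    (h₁ : res G (inf_le_left : W ⊓ U₁ ≤ W) s = res G inf_le_left t) : s = t := by
  refine TopCat.Sheaf.eq_of_locally_eq₂ ⟨G.presheaf, G.isSheaf⟩ (homOfLE inf_le_left)
    (homOfLE inf_le_left) ?_ s t h₀ h₁
  rw [← inf_sup_left, hU, inf_top_eq]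

theorem exists_glue {U₀ U₁ : X.Opens} (hU : U₀ ⊔ U₁ = ⊤) {W : X.Opens} (s₀ : Γ(G, W ⊓ U₀))
    (s₁ : Γ(G, W ⊓ U₁))
    (h : res G (inf_le_inf_left W inf_le_left : W ⊓ (U₀ ⊓ U₁) ≤ W ⊓ U₀) s₀ =
      res G (inf_le_inf_left W inf_le_right) s₁) :
    ∃ s : Γ(G, W), res G inf_le_left s = s₀ ∧ res G inf_le_left s = s₁ := by
  -- The two-element index type is lifted to the universe of `X`, where gluing of sections takes
  -- place.
  let V : ULift.{u} Bool → X.Opens := fun i ↦ if i.down then W ⊓ U₀ else W ⊓ U₁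
  let sf : ∀ i, Γ(G, V i) := fun i ↦ match i with
    | ⟨true⟩ => s₀
    | ⟨false⟩ => s₁
  have hc : TopCat.Presheaf.IsCompatible G.presheaf V sf := by
    have key : res G (inf_le_left : (W ⊓ U₀) ⊓ (W ⊓ U₁) ≤ W ⊓ U₀) s₀ = res G inf_le_right s₁ := by
      have hle : (W ⊓ U₀) ⊓ (W ⊓ U₁) ≤ W ⊓ (U₀ ⊓ U₁) :=
        le_inf (inf_le_left.trans inf_le_left)
          (le_inf (inf_le_left.trans inf_le_right) (inf_le_right.trans inf_le_right))
      have := congrArg (res G hle) h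
      rwa [res_res, res_res] at this
    rintro ⟨_ | _⟩ ⟨_ | _⟩
    · rfl
    · have := congrArg (res G (inf_comm (W ⊓ U₀) (W ⊓ U₁)).ge) key
      rw [res_res, res_res] at this
      exact this.symm
    · exact key
    · rfl
  obtain ⟨s, hs, -⟩ := TopCat.Sheaf.existsUnique_gluing' ⟨G.presheaf, G.isSheaf⟩ V W
    (fun i ↦ match i with
      | ⟨true⟩ => homOfLE inf_le_left
      | ⟨false⟩ => homOfLE inf_le_left) (by
        rw [← inf_top_eq W, ← hU, inf_sup_left]
        exact sup_le (le_iSup V ⟨true⟩) (le_iSup V ⟨false⟩)) sf hc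
  exact ⟨s, hs ⟨true⟩, hs ⟨false⟩⟩

/-- A morphism of sheaves of modules from its action on sections. -/
def modHomMk {F G : X.Modules} (t : ∀ W, Γ(F, W) → Γ(G, W))
    (h_add : ∀ W s s', t W (s + s') = t W s + t W s')
    (h_smul : ∀ W (r : Γ(X, W)) s, t W (r • s) = r • t W s)
    (h_res : ∀ W V (h : V ≤ W) s, t V (res F h s) = res G h (t W s)) : F ⟶ G :=
  ⟨PresheafOfModules.homMk
    { app := fun W ↦ AddCommGrpCat.ofHom (AddMonoidHom.mk' (t W.unop) (h_add W.unop))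
      naturality := fun W V f ↦ by
        ext s
        exact h_res W.unop V.unop (leOfHom f.unop) s }
    fun W r s ↦ h_smul W.unop r s⟩

variable {G} {F : X.Modules} {U₀ U₁ : X.Opens} {e₀ : Γ(F, U₀)} {e₁ : Γ(F, U₁)}
  {m₀ : Γ(G, U₀)} {m₁ : Γ(G, U₁)} {c : Γ(X, U₀ ⊓ U₁)}

/-- A section `s` is `a₀ e₀` on one piece and `a₁ e₁` on the other; its image is glued from `a₀ m₀`
and `a₁ m₁`. These agree on the overlap because `m₀, m₁` have the same transition function `c` as
`e₀, e₁`. -/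
theorem exists_glueHom (hU : U₀ ⊔ U₁ = ⊤) (h₀ : IsFreeGenerator F U₀ e₀)
    (h₁ : IsFreeGenerator F U₁ e₁)
    (he : res F (inf_le_right : U₀ ⊓ U₁ ≤ U₁) e₁ = c • res F inf_le_left e₀)
    (hm : res G (inf_le_right : U₀ ⊓ U₁ ≤ U₁) m₁ = c • res G inf_le_left m₀) :
    ∃ φ : F ⟶ G, φ.app U₀ e₀ = m₀ ∧ φ.app U₁ e₁ = m₁ := by
  have key : ∀ (W : X.Opens) (s : Γ(F, W)), ∃ t : Γ(G, W),
      (∀ a : Γ(X, W ⊓ U₀), res F inf_le_left s = a • res F inf_le_right e₀ →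
        res G inf_le_left t = a • res G inf_le_right m₀) ∧
      (∀ a : Γ(X, W ⊓ U₁), res F inf_le_left s = a • res F inf_le_right e₁ →
        res G inf_le_left t = a • res G inf_le_right m₁) := by
    intro W s
    obtain ⟨a₀, ha₀⟩ := (h₀ (W ⊓ U₀) inf_le_right).2 (res F inf_le_left s)
    obtain ⟨a₁, ha₁⟩ := (h₁ (W ⊓ U₁) inf_le_right).2 (res F inf_le_left s)
    dsimp only at ha₀ ha₁
    obtain ⟨t, ht₀, ht₁⟩ := exists_glue G hU (W := W) (a₀ • res G inf_le_right m₀)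
      (a₁ • res G inf_le_right m₁) (by
        rw [map_smulₛₗ, map_smulₛₗ, res_res, res_res]
        have e1 := congrArg (res F (inf_le_inf_left W inf_le_left :
          W ⊓ (U₀ ⊓ U₁) ≤ W ⊓ U₀)) ha₀
        have e2 := congrArg (res F (inf_le_inf_left W inf_le_right :
          W ⊓ (U₀ ⊓ U₁) ≤ W ⊓ U₁)) ha₁
        rw [map_smulₛₗ, res_res, res_res] at e1 e2
        have e3 := e1.trans e2.symm
        have he' := congrArg (res F (inf_le_right : W ⊓ (U₀ ⊓ U₁) ≤ U₀ ⊓ U₁)) he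
        have hm' := congrArg (res G (inf_le_right : W ⊓ (U₀ ⊓ U₁) ≤ U₀ ⊓ U₁)) hm
        rw [map_smulₛₗ, res_res, res_res] at he' hm'
        rw [he', smul_smul] at e3
        have e4 := (h₀ (W ⊓ (U₀ ⊓ U₁)) (inf_le_right.trans inf_le_left)).1 e3
        rw [hm', smul_smul, ← e4])
    refine ⟨t, fun a ha ↦ ?_, fun a ha ↦ ?_⟩
    · rw [ht₀, (h₀ _ inf_le_right).1 (ha₀.trans ha)]
    · rw [ht₁, (h₁ _ inf_le_right).1 (ha₁.trans ha)]
  choose t ht₀ ht₁ using key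
  have ex₀ : ∀ (W : X.Opens) (s : Γ(F, W)), ∃ a : Γ(X, W ⊓ U₀),
      res F inf_le_left s = a • res F inf_le_right e₀ ∧
        res G inf_le_left (t W s) = a • res G inf_le_right m₀ := fun W s ↦ by
    obtain ⟨a, ha⟩ := (h₀ (W ⊓ U₀) inf_le_right).2 (res F inf_le_left s)
    exact ⟨a, ha.symm, ht₀ _ _ _ ha.symm⟩
  have ex₁ : ∀ (W : X.Opens) (s : Γ(F, W)), ∃ a : Γ(X, W ⊓ U₁),
      res F inf_le_left s = a • res F inf_le_right e₁ ∧
        res G inf_le_left (t W s) = a • res G inf_le_right m₁ := fun W s ↦ by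
    obtain ⟨a, ha⟩ := (h₁ (W ⊓ U₁) inf_le_right).2 (res F inf_le_left s)
    exact ⟨a, ha.symm, ht₁ _ _ _ ha.symm⟩
  -- The glued value is determined by its restrictions to the two pieces, so additivity, linearity
  -- and naturality need only be checked on coefficients.
  have uniq : ∀ (W : X.Opens) (s : Γ(F, W)) (t' : Γ(G, W)),
      (∃ a : Γ(X, W ⊓ U₀), res F inf_le_left s = a • res F inf_le_right e₀ ∧
        res G inf_le_left t' = a • res G inf_le_right m₀) →
      (∃ a : Γ(X, W ⊓ U₁), res F inf_le_left s = a • res F inf_le_right e₁ ∧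
        res G inf_le_left t' = a • res G inf_le_right m₁) → t W s = t' := by
    rintro W s t' ⟨a₀, ha₀, hb₀⟩ ⟨a₁, ha₁, hb₁⟩
    exact sections_ext G hU ((ht₀ _ _ _ ha₀).trans hb₀.symm) ((ht₁ _ _ _ ha₁).trans hb₁.symm)
  have t_add : ∀ W s s', t W (s + s') = t W s + t W s' := by
    intro W s s'
    obtain ⟨a, ha, ha'⟩ := ex₀ W s
    obtain ⟨b, hb, hb'⟩ := ex₀ W s'
    obtain ⟨c, hc, hc'⟩ := ex₁ W s
    obtain ⟨d, hd, hd'⟩ := ex₁ W s'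
    refine uniq _ _ _ ⟨a + b, ?_, ?_⟩ ⟨c + d, ?_, ?_⟩
    · rw [map_add, ha, hb, add_smul]
    · rw [map_add, ha', hb', add_smul]
    · rw [map_add, hc, hd, add_smul]
    · rw [map_add, hc', hd', add_smul]
  have t_smul : ∀ W (r : Γ(X, W)) s, t W (r • s) = r • t W s := by
    intro W r s
    obtain ⟨a, ha, ha'⟩ := ex₀ W s
    obtain ⟨c, hc, hc'⟩ := ex₁ W s
    refine uniq _ _ _ ⟨(X.presheaf.map (homOfLE inf_le_left).op).hom r * a, ?_, ?_⟩
      ⟨(X.presheaf.map (homOfLE inf_le_left).op).hom r * c, ?_, ?_⟩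
    · rw [map_smulₛₗ, ha, mul_smul]
    · rw [map_smulₛₗ, ha', mul_smul]
    · rw [map_smulₛₗ, hc, mul_smul]
    · rw [map_smulₛₗ, hc', mul_smul]
  have t_res : ∀ W V (h : V ≤ W) s, t V (res F h s) = res G h (t W s) := by
    intro W V h s
    obtain ⟨a, ha, ha'⟩ := ex₀ W s
    obtain ⟨c, hc, hc'⟩ := ex₁ W s
    refine uniq _ _ _ ⟨(X.presheaf.map (homOfLE (inf_le_inf_right U₀ h)).op).hom a, ?_, ?_⟩
      ⟨(X.presheaf.map (homOfLE (inf_le_inf_right U₁ h)).op).hom c, ?_, ?_⟩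
    · have := congrArg (res F (inf_le_inf_right U₀ h)) ha
      rw [map_smulₛₗ, res_res, res_res] at this
      rw [res_res]; exact this
    · have := congrArg (res G (inf_le_inf_right U₀ h)) ha'
      rw [map_smulₛₗ, res_res, res_res] at this
      rw [res_res]; exact this
    · have := congrArg (res F (inf_le_inf_right U₁ h)) hc
      rw [map_smulₛₗ, res_res, res_res] at this
      rw [res_res]; exact this
    · have := congrArg (res G (inf_le_inf_right U₁ h)) hc'
      rw [map_smulₛₗ, res_res, res_res] at this
      rw [res_res]; exact this
  refine ⟨modHomMk t t_add t_smul t_res, ?_, ?_⟩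
  · have h := ht₀ U₀ e₀ 1 (by rw [one_smul])
    have h' := congrArg (res G (le_inf le_rfl le_rfl : U₀ ≤ U₀ ⊓ U₀)) h
    rw [one_smul, res_res, res_res, res_self, res_self] at h'
    exact h'
  · have h := ht₁ U₁ e₁ 1 (by rw [one_smul])
    have h' := congrArg (res G (le_inf le_rfl le_rfl : U₁ ≤ U₁ ⊓ U₁)) h
    rw [one_smul, res_res, res_res, res_self, res_self] at h'
    exact h'

end glueHom
end

noncomputable section

/-! ### Line bundles glued from two trivial pieces -/

namespace GluedLine
open RelProj TopologicalSpace
variable {X : Scheme.{u}}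

/-- Restriction of functions. -/
abbrev fnRes {U V : X.Opens} (h : V ≤ U) : Γ(X, U) →+* Γ(X, V) :=
  (X.presheaf.map (homOfLE h).op).hom

theorem fnRes_fnRes {U V W : X.Opens} (h : V ≤ U) (h' : W ≤ V) (a : Γ(X, U)) :
    fnRes h' (fnRes h a) = fnRes (h'.trans h) a := by
  change (X.presheaf.map _ ≫ X.presheaf.map _) a = _
  rw [← Functor.map_comp]
  rfl

theorem fnRes_self {U : X.Opens} (h : U ≤ U) (a : Γ(X, U)) : fnRes h a = a := by
  change X.presheaf.map (𝟙 _) a = a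
  rw [CategoryTheory.Functor.map_id]
  rfl

variable {U₀ U₁ : X.Opens} (c : Γ(X, U₀ ⊓ U₁))

/-- Pairs of functions on `W ⊓ U₀` and `W ⊓ U₁` which differ by the transition function `c`. -/
def pairs (W : X.Opens) : AddSubgroup (Γ(X, W ⊓ U₀) × Γ(X, W ⊓ U₁)) where
  carrier := {p | fnRes (inf_le_inf_left W inf_le_left : W ⊓ (U₀ ⊓ U₁) ≤ W ⊓ U₀) p.1 =
    fnRes inf_le_right c * fnRes (inf_le_inf_left W inf_le_right) p.2}
  add_mem' {p q} hp hq := by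
    simp only [Set.mem_ofPred_eq, Prod.fst_add, Prod.snd_add, map_add] at *
    rw [hp, hq, mul_add]
  zero_mem' := by simp
  neg_mem' {p} hp := by
    simp only [Set.mem_ofPred_eq, Prod.fst_neg, Prod.snd_neg, map_neg] at *
    rw [hp, mul_neg]

theorem mem_pairs {W : X.Opens} {p : Γ(X, W ⊓ U₀) × Γ(X, W ⊓ U₁)} : p ∈ pairs c W ↔
    fnRes (inf_le_inf_left W inf_le_left : W ⊓ (U₀ ⊓ U₁) ≤ W ⊓ U₀) p.1 =
    fnRes inf_le_right c * fnRes (inf_le_inf_left W inf_le_right) p.2 := Iff.rfl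

instance (W : X.Opens) : SMul Γ(X, W) (pairs c W) where
  smul a p := ⟨(fnRes inf_le_left a * p.1.1, fnRes inf_le_left a * p.1.2), by
    have hp := p.2
    rw [mem_pairs] at hp ⊢
    simp only [map_mul, fnRes_fnRes, hp]
    ring⟩

theorem smul_fst {W : X.Opens} (a : Γ(X, W)) (p : pairs c W) :
    (a • p).1.1 = fnRes inf_le_left a * p.1.1 := rfl

theorem smul_snd {W : X.Opens} (a : Γ(X, W)) (p : pairs c W) :
    (a • p).1.2 = fnRes inf_le_left a * p.1.2 := rfl

theorem ext_pairs {W : X.Opens} {p q : pairs c W} (h1 : p.1.1 = q.1.1) (h2 : p.1.2 = q.1.2) :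
    p = q := Subtype.ext (Prod.ext h1 h2)

instance (W : X.Opens) : Module Γ(X, W) (pairs c W) where
  one_smul p := ext_pairs c (by simp [smul_fst]) (by simp [smul_snd])
  mul_smul a a' p := ext_pairs c (by simp [smul_fst, mul_assoc]) (by simp [smul_snd, mul_assoc])
  smul_zero a := ext_pairs c (by simp [smul_fst]) (by simp [smul_snd])
  smul_add a p q := ext_pairs c (by simp [smul_fst, mul_add]) (by simp [smul_snd, mul_add])
  add_smul a a' p := ext_pairs c (by simp [smul_fst, add_mul]) (by simp [smul_snd, add_mul])
  zero_smul p := ext_pairs c (by simp [smul_fst]) (by simp [smul_snd])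

/-- Restriction of pairs. -/
def pairsRes {W V : X.Opens} (h : V ≤ W) : pairs c W →+ pairs c V where
  toFun p := ⟨(fnRes (inf_le_inf_right U₀ h) p.1.1, fnRes (inf_le_inf_right U₁ h) p.1.2), by
    have hp := p.2
    rw [mem_pairs] at hp ⊢
    have := congrArg (fnRes (inf_le_inf_right (U₀ ⊓ U₁) h)) hp
    rw [map_mul, fnRes_fnRes, fnRes_fnRes, fnRes_fnRes] at this
    rw [fnRes_fnRes, fnRes_fnRes]
    exact this⟩
  map_zero' := ext_pairs c (map_zero _) (map_zero _)
  map_add' p q := ext_pairs c (map_add _ _ _) (map_add _ _ _)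

theorem pairsRes_self {W : X.Opens} (h : W ≤ W) (p : pairs c W) : pairsRes c h p = p :=
  ext_pairs c (fnRes_self _ _) (fnRes_self _ _)

theorem pairsRes_pairsRes {W V V' : X.Opens} (h : V ≤ W) (h' : V' ≤ V) (p : pairs c W) :
    pairsRes c h' (pairsRes c h p) = pairsRes c (h'.trans h) p :=
  ext_pairs c (fnRes_fnRes _ _ _) (fnRes_fnRes _ _ _)

theorem pairsRes_smul {W V : X.Opens} (h : V ≤ W) (a : Γ(X, W)) (p : pairs c W) :
    pairsRes c h (a • p) = fnRes h a • pairsRes c h p := by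
  refine ext_pairs c ?_ ?_
  · change fnRes _ (fnRes _ _ * _) = fnRes _ (fnRes _ _) * fnRes _ _
    rw [map_mul, fnRes_fnRes, fnRes_fnRes]
  · change fnRes _ (fnRes _ _ * _) = fnRes _ (fnRes _ _) * fnRes _ _
    rw [map_mul, fnRes_fnRes, fnRes_fnRes]

/-- The presheaf of pairs. -/
def pairsPresheaf : TopCat.Presheaf Ab.{u} X where
  obj W := AddCommGrpCat.of (pairs c W.unop)
  map f := AddCommGrpCat.ofHom (pairsRes c (leOfHom f.unop))
  map_id _ :=
    AddCommGrpCat.hom_ext (AddMonoidHom.ext fun p ↦ pairsRes_self c le_rfl p)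
  map_comp f g :=
    AddCommGrpCat.hom_ext (AddMonoidHom.ext fun p ↦
      (pairsRes_pairsRes c (leOfHom f.unop) (leOfHom g.unop) p).symm)

theorem glue_fn {ι : Type u} (V : ι → X.Opens) (U : X.Opens) (f : ∀ i, Γ(X, V i ⊓ U))
    (hf : ∀ i j, fnRes (inf_le_inf_right U inf_le_left : V i ⊓ V j ⊓ U ≤ V i ⊓ U) (f i) =
      fnRes (inf_le_inf_right U inf_le_right) (f j)) :
    ∃! g : Γ(X, iSup V ⊓ U), ∀ i, fnRes (inf_le_inf_right U (le_iSup V i)) g = f i := by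
  refine TopCat.Sheaf.existsUnique_gluing' X.sheaf (fun i ↦ V i ⊓ U) (iSup V ⊓ U)
    (fun i ↦ homOfLE (inf_le_inf_right U (le_iSup V i))) (by rw [iSup_inf_eq]) f ?_
  intro i j
  have hle : (V i ⊓ U) ⊓ (V j ⊓ U) ≤ V i ⊓ V j ⊓ U :=
    le_inf (inf_le_inf inf_le_left inf_le_left) (inf_le_left.trans inf_le_right)
  have := congrArg (fnRes hle) (hf i j)
  rwa [fnRes_fnRes, fnRes_fnRes] at this

theorem isSheaf_pairsPresheaf : (pairsPresheaf c).IsSheaf := by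
  rw [TopCat.Presheaf.isSheaf_iff_isSheafUniqueGluing]
  intro ι V sf hsf
  change ∀ i, pairs c (V i) at sf
  obtain ⟨g₀, hg₀, u₀⟩ := glue_fn V U₀ (fun i ↦ (sf i).1.1) fun i j ↦
    congrArg (fun p : pairs c (V i ⊓ V j) ↦ p.1.1) (hsf i j)
  obtain ⟨g₁, hg₁, u₁⟩ := glue_fn V U₁ (fun i ↦ (sf i).1.2) fun i j ↦
    congrArg (fun p : pairs c (V i ⊓ V j) ↦ p.1.2) (hsf i j)
  -- The pair condition for the glued functions holds on each `V i ⊓ (U₀ ⊓ U₁)`, so it follows from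
  -- uniqueness of gluing over `iSup V ⊓ (U₀ ⊓ U₁)`.
  have hg : (g₀, g₁) ∈ pairs c (iSup V) := by
    rw [mem_pairs]
    obtain ⟨g, -, u⟩ := glue_fn V (U₀ ⊓ U₁)
      (fun i ↦ fnRes (inf_le_inf_left (V i) inf_le_left) (sf i).1.1) fun i j ↦ by
        rw [fnRes_fnRes, fnRes_fnRes]
        have := congrArg (fun p : pairs c (V i ⊓ V j) ↦
          fnRes (inf_le_inf_left (V i ⊓ V j) inf_le_left :
            V i ⊓ V j ⊓ (U₀ ⊓ U₁) ≤ V i ⊓ V j ⊓ U₀) p.1.1) (hsf i j)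
        dsimp only at this
        exact (fnRes_fnRes _ _ _).symm.trans (this.trans (fnRes_fnRes _ _ _))
    refine (u _ fun i ↦ ?_).trans (u _ fun i ↦ ?_).symm
    · rw [fnRes_fnRes, ← hg₀ i, fnRes_fnRes]
    · rw [map_mul, fnRes_fnRes, fnRes_fnRes, (mem_pairs c).mp (sf i).2, ← hg₁ i, fnRes_fnRes]
  refine ⟨⟨(g₀, g₁), hg⟩, fun i ↦ ext_pairs c (hg₀ i) (hg₁ i), fun p hp ↦ ext_pairs c ?_ ?_⟩
  · exact u₀ _ fun i ↦ congrArg (fun p : pairs c (V i) ↦ p.1.1) (hp i)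
  · exact u₁ _ fun i ↦ congrArg (fun p : pairs c (V i) ↦ p.1.2) (hp i)

instance (W : (Opens X)ᵒᵖ) : Module (X.ringCatSheaf.obj.obj W) ((pairsPresheaf c).obj W) :=
  inferInstanceAs (Module Γ(X, W.unop) (pairs c W.unop))

/-- The sheaf of modules glued from `𝒪_{U₀}` and `𝒪_{U₁}` by means of `c`. -/
def sheaf : X.Modules where
  val := PresheafOfModules.ofPresheaf (R := X.ringCatSheaf.obj) (pairsPresheaf c)
    fun _ _ f r p ↦ pairsRes_smul c (leOfHom f.unop) r p
  isSheaf := isSheaf_pairsPresheaf c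

/-- A pair as a section of the glued sheaf. -/
def toSection {W : X.Opens} (p : pairs c W) : Γ(sheaf c, W) := p

/-- The generators are `e₀ = (1, c⁻¹)` and `e₁ = (c, 1)`. Over `U₀` a pair is determined by its
first component, over `U₁` by its second. -/
theorem exists_glued (hc : IsUnit c) : ∃ (F : X.Modules) (e₀ : Γ(F, U₀)) (e₁ : Γ(F, U₁)),
    IsFreeGenerator F U₀ e₀ ∧ IsFreeGenerator F U₁ e₁ ∧
      res F (inf_le_right : U₀ ⊓ U₁ ≤ U₁) e₁ = c • res F inf_le_left e₀ := by
  obtain ⟨d, hd⟩ := hc.exists_right_inv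
  let p₀ : pairs c U₀ := ⟨(1, d), by
    rw [mem_pairs, map_one, ← map_one (fnRes inf_le_right), ← hd, map_mul]⟩
  let p₁ : pairs c U₁ := ⟨(fnRes (inf_comm U₀ U₁).ge c, 1), by
    rw [mem_pairs, map_one, mul_one, fnRes_fnRes]⟩
  refine ⟨sheaf c, toSection c p₀, toSection c p₁, fun V h ↦ ⟨fun a a' haa ↦ ?_, fun p ↦ ?_⟩,
    fun V h ↦ ⟨fun a a' haa ↦ ?_, fun p ↦ ?_⟩, ?_⟩
  · have h1 : fnRes (inf_le_left : V ⊓ U₀ ≤ V) a * fnRes _ 1 = fnRes inf_le_left a' * fnRes _ 1 :=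
      congrArg (fun p : pairs c V ↦ p.1.1) haa
    rw [map_one, mul_one, mul_one] at h1
    have := congrArg (fnRes (le_inf le_rfl h)) h1
    rwa [fnRes_fnRes, fnRes_fnRes, fnRes_self, fnRes_self] at this
  · change pairs c V at p
    refine ⟨fnRes (le_inf le_rfl h) p.1.1, ext_pairs c ?_ ?_⟩
    · change fnRes _ (fnRes _ _) * fnRes _ 1 = _
      rw [map_one, mul_one, fnRes_fnRes, fnRes_self]
    · change fnRes _ (fnRes _ _) * fnRes _ d = _
      have hle : V ⊓ U₁ ≤ V ⊓ (U₀ ⊓ U₁) := le_inf inf_le_left (inf_le_inf_right _ h)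
      have h1 := congrArg (fnRes hle) ((mem_pairs c).mp p.2)
      rw [map_mul, fnRes_fnRes, fnRes_fnRes, fnRes_fnRes, fnRes_self] at h1
      have h2 := congrArg (fnRes (hle.trans inf_le_right)) hd
      rw [map_mul, map_one] at h2
      rw [fnRes_fnRes, h1, mul_right_comm, h2, one_mul]
  · have h1 : fnRes (inf_le_left : V ⊓ U₁ ≤ V) a * fnRes _ 1 = fnRes inf_le_left a' * fnRes _ 1 :=
      congrArg (fun p : pairs c V ↦ p.1.2) haa
    rw [map_one, mul_one, mul_one] at h1
    have := congrArg (fnRes (le_inf le_rfl h)) h1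
    rwa [fnRes_fnRes, fnRes_fnRes, fnRes_self, fnRes_self] at this
  · change pairs c V at p
    refine ⟨fnRes (le_inf le_rfl h) p.1.2, ext_pairs c ?_ ?_⟩
    · change fnRes _ (fnRes _ _) * fnRes _ (fnRes _ c) = _
      have hle : V ⊓ U₀ ≤ V ⊓ (U₀ ⊓ U₁) := le_inf inf_le_left
        (le_inf inf_le_right (inf_le_left.trans h))
      have h1 := congrArg (fnRes hle) ((mem_pairs c).mp p.2)
      rw [map_mul, fnRes_fnRes, fnRes_fnRes, fnRes_fnRes, fnRes_self] at h1
      rw [fnRes_fnRes, fnRes_fnRes, h1, mul_comm]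
    · change fnRes _ (fnRes _ _) * fnRes _ 1 = _
      rw [map_one, mul_one, fnRes_fnRes, fnRes_self]
  · refine ext_pairs c ?_ ?_
    · change fnRes _ (fnRes _ c) = fnRes _ c * fnRes _ 1
      rw [map_one, mul_one, fnRes_fnRes]
    · change fnRes _ 1 = fnRes _ c * fnRes _ d
      rw [map_one, ← map_one (fnRes inf_le_left), ← hd, map_mul]

end GluedLine
end

noncomputable section

/-! ### Čech cohomology of a cover by two open sets -/

section cechTwo
variable {k : Type u} [Field k] {X : Scheme.{u}} (s : X ⟶ Spec (.of k)) (M : X.Modules)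

theorem secRes_secRes {U V W : X.Opens} (h : V ≤ U) (h' : W ≤ V) (m : Sections s M U) :
    secRes s M h' (secRes s M h m) = secRes s M (h'.trans h) m :=
  RelProj.res_res M h h' m

theorem secRes_self {U : X.Opens} (h : U ≤ U) (m : Sections s M U) : secRes s M h m = m :=
  RelProj.res_self M h m

variable (U : Fin 2 → X.Opens)

/-- The alternating cochain with a given component on `U 0 ⊓ U 1`. -/
def altCochain : Sections s M (U 0 ⊓ U 1) →ₗ[k] (∀ i j, Sections s M (U i ⊓ U j)) :=
  LinearMap.pi fun i ↦ LinearMap.pi fun j ↦ match i, j with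
    | 0, 0 => 0
    | 0, 1 => LinearMap.id
    | 1, 0 => -secRes s M (inf_comm (U 0) (U 1)).ge
    | 1, 1 => 0

theorem altCochain_zero_one (m : Sections s M (U 0 ⊓ U 1)) : altCochain s M U m 0 1 = m := rfl
theorem altCochain_zero_zero (m : Sections s M (U 0 ⊓ U 1)) : altCochain s M U m 0 0 = 0 := rfl
theorem altCochain_one_one (m : Sections s M (U 0 ⊓ U 1)) : altCochain s M U m 1 1 = 0 := rfl
theorem altCochain_one_zero (m : Sections s M (U 0 ⊓ U 1)) :
    altCochain s M U m 1 0 = -secRes s M (inf_comm (U 0) (U 1)).ge m := rfl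

theorem cechD1_apply (z : ∀ i j, Sections s M (U i ⊓ U j)) (i j l : Fin 2) :
    cechD1 s M U z i j l =
      secRes s M (inf_le_inf_right _ inf_le_right) (z j l) -
      secRes s M (inf_le_inf_right _ inf_le_left) (z i l) + secRes s M inf_le_left (z i j) := rfl

theorem altCochain_mem_ker (m : Sections s M (U 0 ⊓ U 1)) :
    altCochain s M U m ∈ LinearMap.ker (cechD1 s M U) := by
  rw [LinearMap.mem_ker]
  funext i j l
  rw [cechD1_apply]
  fin_cases i <;> fin_cases j <;> fin_cases l <;>
  simp [altCochain_zero_one, altCochain_zero_zero, altCochain_one_one, altCochain_one_zero,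
    secRes_secRes]

/-- The cocycle condition at `(i, i, i)` kills the diagonal and at `(0, 1, 0)` gives antisymmetry.
Thus `H¹` is a quotient of the sections over `U 0 ⊓ U 1`, although the complex uses all ordered
pairs of indices. -/
theorem eq_altCochain {z : ∀ i j, Sections s M (U i ⊓ U j)}
    (hz : z ∈ LinearMap.ker (cechD1 s M U)) : z = altCochain s M U (z 0 1) := by
  rw [LinearMap.mem_ker] at hz
  have h : ∀ i j l, secRes s M (inf_le_inf_right _ inf_le_right) (z j l) -
      secRes s M (inf_le_inf_right _ inf_le_left) (z i l) + secRes s M inf_le_left (z i j) = 0 :=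
    fun i j l ↦ congrFun (congrFun (congrFun hz i) j) l
  have hd : ∀ i, z i i = 0 := by
    intro i
    have h1 := congrArg (secRes s M (le_inf (le_inf inf_le_left inf_le_left) inf_le_left :
      U i ⊓ U i ≤ U i ⊓ U i ⊓ U i)) (h i i i)
    rw [sub_self, zero_add, map_zero, secRes_secRes, secRes_self] at h1
    exact h1
  funext i j
  fin_cases i <;> fin_cases j
  · exact hd 0
  · rfl
  · have h1 := congrArg (secRes s M (le_inf (le_inf inf_le_right inf_le_left) inf_le_right :
      U 1 ⊓ U 0 ≤ U 0 ⊓ U 1 ⊓ U 0)) (h 0 1 0)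
    rw [map_add, map_sub, map_zero, secRes_secRes, secRes_secRes, secRes_secRes, hd 0, map_zero,
      sub_zero, secRes_self] at h1
    exact eq_neg_of_add_eq_zero_left h1
  · exact hd 1

/-- The Čech class of a section over `U 0 ⊓ U 1`. -/
def cechClass : Sections s M (U 0 ⊓ U 1) →ₗ[k] CechH1 s M U :=
  Submodule.mkQ _ ∘ₗ (altCochain s M U).codRestrict _ (altCochain_mem_ker s M U)

theorem cechClass_apply (m : Sections s M (U 0 ⊓ U 1)) :
    cechClass s M U m = Submodule.Quotient.mk ⟨altCochain s M U m, altCochain_mem_ker s M U m⟩ :=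
  rfl

theorem cechClass_surjective : Function.Surjective (cechClass s M U) := by
  intro c
  obtain ⟨z, rfl⟩ := Submodule.Quotient.mk_surjective _ c
  refine ⟨z.1 0 1, ?_⟩
  rw [cechClass_apply]
  congr 1
  exact Subtype.ext (eq_altCochain s M U z.2).symm

theorem cechD0_apply (t : ∀ i, Sections s M (U i)) (i j : Fin 2) :
    cechD0 s M U t i j = secRes s M inf_le_right (t j) - secRes s M inf_le_left (t i) := rfl

theorem cechD0_eq_altCochain (t : ∀ i, Sections s M (U i)) :
    cechD0 s M U t = altCochain s M U
      (secRes s M inf_le_right (t 1) - secRes s M inf_le_left (t 0)) := by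
  funext i j
  rw [cechD0_apply]
  fin_cases i <;> fin_cases j
  · exact sub_self _
  · rfl
  · refine Eq.trans ?_ (altCochain_one_zero s M U _).symm
    rw [map_sub, secRes_secRes, secRes_secRes, neg_sub]
    rfl
  · exact sub_self _

theorem cechClass_sub_eq_zero (t : ∀ i, Sections s M (U i)) :
    cechClass s M U (secRes s M inf_le_right (t 1) - secRes s M inf_le_left (t 0)) = 0 := by
  rw [cechClass_apply, Submodule.Quotient.mk_eq_zero]
  exact ⟨t, cechD0_eq_altCochain s M U t⟩

theorem cechClass_secRes_one (m : Sections s M (U 1)) :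
    cechClass s M U (secRes s M inf_le_right m) = 0 := by
  have := cechClass_sub_eq_zero s M U fun i ↦ match i with
    | 0 => 0
    | 1 => m
  rwa [map_zero, sub_zero] at this

theorem cechClass_secRes_zero (m : Sections s M (U 0)) :
    cechClass s M U (secRes s M inf_le_left m) = 0 := by
  have := cechClass_sub_eq_zero s M U fun i ↦ match i with
    | 0 => m
    | 1 => 0
  rwa [map_zero, zero_sub, map_neg, neg_eq_zero] at this

variable {M} in
theorem cechH1Map_cechClass {N : X.Modules} (φ : M ⟶ N) (m : Sections s M (U 0 ⊓ U 1)) :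
    cechH1Map s U φ (cechClass s M U m) = cechClass s N U (secMap s φ _ m) := by
  change Submodule.Quotient.mk _ = Submodule.Quotient.mk _
  congr 1
  refine Subtype.ext ?_
  exact eq_altCochain s N U (cechMapC1_mem_ker s U φ _ (altCochain_mem_ker s M U m))

/-- A functional on sections over `U 0 ⊓ U 1` as a functional on cohomology. -/
def cechFunctional (l : Sections s M (U 0 ⊓ U 1) →ₗ[k] k)
    (h₀ : ∀ m, l (secRes s M inf_le_left m) = 0) (h₁ : ∀ m, l (secRes s M inf_le_right m) = 0) :
    CechH1 s M U →ₗ[k] k :=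
  Submodule.liftQ _ (l ∘ₗ LinearMap.proj (φ := fun j ↦ Sections s M (U 0 ⊓ U j)) 1 ∘ₗ
      LinearMap.proj (φ := fun i ↦ ∀ j, Sections s M (U i ⊓ U j)) 0 ∘ₗ
      (LinearMap.ker (cechD1 s M U)).subtype) (by
    rintro z ⟨t, ht⟩
    rw [LinearMap.mem_ker]
    change l (z.1 0 1) = 0
    have : z.1 0 1 = secRes s M inf_le_right (t 1) - secRes s M inf_le_left (t 0) :=
      (congrFun (congrFun ht 0) 1).symm
    rw [this, map_sub, h₀, h₁, sub_zero])

end cechTwo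

/-! ### Duality in terms of sections over the overlap -/

section duality
variable {k : Type u} [Field k] {X : Scheme.{u}} {s : X ⟶ Spec (.of k)} {ω : X.Modules}

/-- A functional on `H¹` is a functional on sections over the overlap that vanishes on the
restrictions from both charts. The last two clauses are injectivity and surjectivity of the duality
map. -/
theorem IsDualizingSheaf.exists_trace (hω : IsDualizingSheaf s ω) {U₀ U₁ : X.Opens}
    (h₀ : IsAffineOpen U₀) (h₁ : IsAffineOpen U₁) (hU : U₀ ⊔ U₁ = ⊤) :
    ∃ τ : Sections s ω (U₀ ⊓ U₁) →ₗ[k] k,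
      (∀ m, τ (secRes s ω inf_le_left m) = 0) ∧ (∀ m, τ (secRes s ω inf_le_right m) = 0) ∧
      (∀ (F : X.Modules) (_ : IsCoherentSheaf F) (φ ψ : F ⟶ ω),
        (∀ m, τ (secMap s φ _ m) = τ (secMap s ψ _ m)) → φ = ψ) ∧
      ∀ (F : X.Modules) (_ : IsCoherentSheaf F) (l : Sections s F (U₀ ⊓ U₁) →ₗ[k] k),
        (∀ m, l (secRes s F inf_le_left m) = 0) → (∀ m, l (secRes s F inf_le_right m) = 0) →
        ∃ φ : F ⟶ ω, ∀ m, τ (secMap s φ _ m) = l m := by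
  obtain ⟨t, ht⟩ := hω.2 2 ![U₀, U₁] (by intro i; fin_cases i; exacts [h₀, h₁]) (by
    rw [eq_top_iff, ← hU]
    exact sup_le (le_iSup ![U₀, U₁] 0) (le_iSup ![U₀, U₁] 1))
  refine ⟨t ∘ₗ cechClass s ω ![U₀, U₁], fun m ↦ ?_, fun m ↦ ?_, fun F hF φ ψ h ↦ ?_,
    fun F hF l hl₀ hl₁ ↦ ?_⟩
  · exact (congrArg t (cechClass_secRes_zero s ω ![U₀, U₁] m)).trans (map_zero t)
  · exact (congrArg t (cechClass_secRes_one s ω ![U₀, U₁] m)).trans (map_zero t)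
  · refine (ht F hF).1 (LinearMap.ext fun c ↦ ?_)
    obtain ⟨m, rfl⟩ := cechClass_surjective s F ![U₀, U₁] c
    rw [LinearMap.comp_apply, LinearMap.comp_apply, cechH1Map_cechClass, cechH1Map_cechClass]
    exact h m
  · obtain ⟨φ, hφ⟩ := (ht F hF).2 (cechFunctional s F ![U₀, U₁] l hl₀ hl₁)
    refine ⟨φ, fun m ↦ ?_⟩
    have h1 := congr($hφ (cechClass s F ![U₀, U₁] m))
    exact (congrArg t (cechH1Map_cechClass s ![U₀, U₁] φ m)).symm.trans h1

end duality
end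

noncomputable section
open LaurentPolynomial

/-! ### Traces, and coherence of the glued line bundles -/

section trace
open RelProj GluedLine
variable {k : Type u} [Field k] {X : Scheme.{u}}

/-- A functional on the sections of `ω` over `U₀ ⊓ U₁` that represents a trace map, and hence
makes `ω` a dualizing sheaf. -/
structure IsTrace (s : X ⟶ Spec (.of k)) (ω : X.Modules) (U₀ U₁ : X.Opens)
    (τ : Sections s ω (U₀ ⊓ U₁) →ₗ[k] k) : Prop where
  left : ∀ m, τ (secRes s ω inf_le_left m) = 0
  right : ∀ m, τ (secRes s ω inf_le_right m) = 0
  inj : ∀ (F : X.Modules) (_ : IsCoherentSheaf F) (φ ψ : F ⟶ ω),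
    (∀ m, τ (secMap s φ _ m) = τ (secMap s ψ _ m)) → φ = ψ
  surj : ∀ (F : X.Modules) (_ : IsCoherentSheaf F) (l : Sections s F (U₀ ⊓ U₁) →ₗ[k] k),
    (∀ m, l (secRes s F inf_le_left m) = 0) → (∀ m, l (secRes s F inf_le_right m) = 0) →
    ∃ φ : F ⟶ ω, ∀ m, τ (secMap s φ _ m) = l m

theorem exists_isTrace {s : X ⟶ Spec (.of k)} {ω : X.Modules} (hω : IsDualizingSheaf s ω)
    {U₀ U₁ : X.Opens} (h₀ : IsAffineOpen U₀) (h₁ : IsAffineOpen U₁) (hU : U₀ ⊔ U₁ = ⊤) :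
    ∃ τ, IsTrace s ω U₀ U₁ τ := by
  obtain ⟨τ, h⟩ := hω.exists_trace h₀ h₁ hU
  exact ⟨τ, h.1, h.2.1, h.2.2.1, h.2.2.2⟩

theorem exists_pow_smul_eq_res (M : X.Modules) [M.IsQuasicoherent] {U V : X.Opens}
    (hU : IsAffineOpen U) (f : Γ(X, U)) (hV : X.basicOpen f = V) (hle : V ≤ U) (n : Γ(M, V)) :
    ∃ (K : ℕ) (m : Γ(M, U)), fnRes hle f ^ K • n = res M hle m := by
  subst hV
  exact (isLocAway_res M hU f).surj_mod n

theorem isCoherentSheaf_of_isFreeGenerator {F : X.Modules} {U₀ U₁ : X.Opens}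
    (hU₀ : IsAffineOpen U₀) (hU₁ : IsAffineOpen U₁) (hU : U₀ ⊔ U₁ = ⊤) {e₀ : Γ(F, U₀)}
    {e₁ : Γ(F, U₁)} (h₀ : IsFreeGenerator F U₀ e₀) (h₁ : IsFreeGenerator F U₁ e₁) :
    IsCoherentSheaf F := by
  refine ⟨?_, fun x ↦ ?_⟩
  · let U : ULift.{u} Bool → X.Opens := fun i ↦ match i with
      | ⟨true⟩ => U₀
      | ⟨false⟩ => U₁
    refine isQuasicoherent_of_isFreeGenerator U ?_ (fun i ↦ match i with
      | ⟨true⟩ => e₀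
      | ⟨false⟩ => e₁) ?_
    · rw [eq_top_iff, ← hU]
      exact sup_le (le_iSup U ⟨true⟩) (le_iSup U ⟨false⟩)
    · rintro ⟨_ | _⟩
      exacts [h₁, h₀]
  · have hx : x ∈ U₀ ⊔ U₁ := hU ▸ trivial
    rcases hx with hx | hx
    · exact ⟨U₀, hU₀, hx, h₀.finite⟩
    · exact ⟨U₁, hU₁, hx, h₁.finite⟩

end trace

/-! ### The dualizing module as a module of Laurent polynomials -/

section curveTrace
open RelProj GluedLine
variable {k : Type u} [Field k] {b : ℕ} {ω : (curve k b).Modules}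
  {τ : Sections (curveToSpec k b) ω (chart k b 0 ⊓ chart k b 2) →ₗ[k] k}

variable (τ) in
/-- The trace of the product of a Laurent polynomial and a section over the first chart. -/
def traceMul (m : Γ(ω, chart k b 0)) : k[T;T⁻¹] →ₗ[k] k where
  toFun g := τ (torusFn k b g • res ω (inf_le_left : chart k b 0 ⊓ chart k b 2 ≤ _) m :
    Γ(ω, chart k b 0 ⊓ chart k b 2))
  map_add' g h := by
    rw [map_add, add_smul]
    exact map_add τ _ _
  map_smul' a g := by
    rw [LaurentPolynomial.smul_eq_C_mul, map_mul, mul_smul, ← scalarMap_eq_torusFn]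
    exact map_smul τ a _

theorem traceMul_apply (m : Γ(ω, chart k b 0)) (g : k[T;T⁻¹]) :
    traceMul τ m g = τ (torusFn k b g • res ω (inf_le_left : chart k b 0 ⊓ chart k b 2 ≤ _) m :
      Γ(ω, chart k b 0 ⊓ chart k b 2)) := rfl

theorem traceMul_add (m m' : Γ(ω, chart k b 0)) (g : k[T;T⁻¹]) :
    traceMul τ (m + m') g = traceMul τ m g + traceMul τ m' g := by
  rw [traceMul_apply, map_add, smul_add]
  exact map_add τ _ _

theorem traceMul_smul (f : Γ(curve k b, chart k b 0)) (m : Γ(ω, chart k b 0)) (g : k[T;T⁻¹]) :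
    traceMul τ (f • m) g =
      traceMul τ m (g * torusEval k b _ (top_le_preimage_chart k b 0) f) := by
  rw [traceMul_apply, traceMul_apply, map_smulₛₗ, map_mul, mul_smul, ← map_left_eq_torusFn]

theorem traceMul_T_eq_zero
    (hτ : IsTrace (curveToSpec k b) ω (chart k b 0) (chart k b 2) τ)
    (m : Γ(ω, chart k b 0)) {n : ℤ} (hn : IsExponent b n) :
    traceMul τ m (LaurentPolynomial.T n) = 0 := by
  obtain ⟨p, hp⟩ := exists_paramHom_eq_T k b hn
  rw [← torusEval_coordHom] at hp
  rw [← one_mul (LaurentPolynomial.T n), ← hp, ← traceMul_smul, traceMul_apply, map_one, one_smul]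
  exact hτ.left _

/-- By quasi-coherence some power of `T ^ (-(3b+5))` times `m` extends to the second chart. Since
`T⁻¹` is regular there, every sufficiently negative `T ^ n m` extends too, and its trace is zero. -/
theorem exists_traceMul_T_eq_zero [ω.IsQuasicoherent]
    (hτ : IsTrace (curveToSpec k b) ω (chart k b 0) (chart k b 2) τ) (m : Γ(ω, chart k b 0)) :
    ∃ K : ℤ, ∀ n < K, traceMul τ m (LaurentPolynomial.T n) = 0 := by
  obtain ⟨K, m₁, h⟩ := exists_pow_smul_eq_res ω (isAffineOpen_chart k b 2) (coordRatio k b 2 0)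
    (basicOpen_coordRatio k b 2 0) inf_le_right
    (res ω (inf_le_left : chart k b 0 ⊓ chart k b 2 ≤ _) m)
  refine ⟨-((3 * b + 5 : ℕ) * K : ℤ), fun n hn ↦ ?_⟩
  have h1 : fnRes (inf_le_right : chart k b 0 ⊓ chart k b 2 ≤ _) (coordRatio k b 2 0) =
      torusFn k b (LaurentPolynomial.T (-((3 * b + 5 : ℕ) : ℤ))) :=
    (map_right_eq_torusFn k b _).trans (congrArg _ (torusEval_coordRatio_two_zero k b))
  have h2 : fnRes (inf_le_right : chart k b 0 ⊓ chart k b 2 ≤ _) (coordRatio k b 2 3) =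
      torusFn k b (LaurentPolynomial.T (-1)) :=
    (map_right_eq_torusFn k b _).trans (congrArg _ (torusEval_coordRatio_two_three k b))
  have h3 : LaurentPolynomial.T n = (LaurentPolynomial.T (-1) : k[T;T⁻¹]) ^
      (-((3 * b + 5 : ℕ) * K) - n : ℤ).toNat *
      LaurentPolynomial.T (-((3 * b + 5 : ℕ) : ℤ)) ^ K := by
    rw [LaurentPolynomial.T_pow, LaurentPolynomial.T_pow, ← LaurentPolynomial.T_add]
    congr 1
    rw [Int.toNat_of_nonneg (by linarith)]
    ring
  rw [traceMul_apply, h3, map_mul, map_pow, map_pow, ← h1, ← h2, mul_smul, h, ← map_pow]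
  exact (congrArg τ (map_smulₛₗ (res ω (inf_le_right : chart k b 0 ⊓ chart k b 2 ≤ _)) _ m₁).symm).trans
    (hτ.right _)

theorem isExponent_of_lt {n : ℤ} (hn : 3 * b + 2 < n) : IsExponent b n :=
  ⟨by omega, fun i hi ↦ by omega⟩

/-- For `n < 0` the exponent `3b+2-n` exceeds the largest gap, so `T ^ (3b+2-n)` is a function on
the first chart. For large `n` the product extends to the second chart. -/
theorem finite_support_traceMul [ω.IsQuasicoherent]
    (hτ : IsTrace (curveToSpec k b) ω (chart k b 0) (chart k b 2) τ) (m : Γ(ω, chart k b 0)) :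
    (Function.support fun n : ℤ ↦ traceMul τ m (LaurentPolynomial.T (3 * b + 2 - n))).Finite := by
  obtain ⟨K, hK⟩ := exists_traceMul_T_eq_zero hτ m
  refine (Set.finite_Icc 0 (3 * b + 2 - K)).subset fun n hn ↦ ?_
  rw [Function.mem_support] at hn
  refine ⟨?_, ?_⟩
  · by_contra h
    exact hn (traceMul_T_eq_zero hτ m (isExponent_of_lt (by omega)))
  · by_contra h
    exact hn (hK _ (by omega))

/-- The embedding of the sections of the dualizing sheaf over the first chart in the ring of
Laurent polynomials: the coefficient of `T ^ n` is the trace of `T ^ (3b+2-n) m`. -/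
def dualEmb [ω.IsQuasicoherent]
    (hτ : IsTrace (curveToSpec k b) ω (chart k b 0) (chart k b 2) τ) (m : Γ(ω, chart k b 0)) :
    k[T;T⁻¹] :=
  .ofCoeff (Finsupp.ofSupportFinite _ (finite_support_traceMul hτ m))

variable [ω.IsQuasicoherent]
  (hτ : IsTrace (curveToSpec k b) ω (chart k b 0) (chart k b 2) τ)

theorem coeff_dualEmb (m : Γ(ω, chart k b 0)) (n : ℤ) :
    (dualEmb hτ m).coeff n = traceMul τ m (LaurentPolynomial.T (3 * b + 2 - n)) := rfl

/-- Under the embedding the trace becomes a residue: it reads off the coefficient of `T ^ (3b+2)`.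
-/
theorem traceMul_eq_coeff (m : Γ(ω, chart k b 0)) (g : k[T;T⁻¹]) :
    traceMul τ m g = (dualEmb hτ m * g).coeff (3 * b + 2) := by
  induction g using LaurentPolynomial.induction_on' with
  | add p q hp hq =>
    rw [map_add, hp, hq, mul_add, AddMonoidAlgebra.coeff_add, Finsupp.add_apply]
  | C_mul_T n a =>
    rw [← LaurentPolynomial.smul_eq_C_mul, map_smul, mul_smul_comm, AddMonoidAlgebra.coeff_smul,
      Finsupp.smul_apply, coeff_mul_T, coeff_dualEmb, sub_sub_cancel]

theorem dualEmb_add (m m' : Γ(ω, chart k b 0)) :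
    dualEmb hτ (m + m') = dualEmb hτ m + dualEmb hτ m' := by
  refine LaurentPolynomial.ext fun n ↦ ?_
  rw [AddMonoidAlgebra.coeff_add, Finsupp.add_apply, coeff_dualEmb, coeff_dualEmb, coeff_dualEmb,
    traceMul_add]

theorem dualEmb_smul (f : Γ(curve k b, chart k b 0)) (m : Γ(ω, chart k b 0)) :
    dualEmb hτ (f • m) =
      torusEval k b _ (top_le_preimage_chart k b 0) f * dualEmb hτ m := by
  refine LaurentPolynomial.ext fun n ↦ ?_
  rw [coeff_dualEmb, traceMul_smul, traceMul_eq_coeff hτ, mul_left_comm, LaurentPolynomial.T_mul,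
    coeff_mul_T, sub_sub_cancel, mul_comm]

theorem coeff_dualEmb_eq_zero (m : Γ(ω, chart k b 0)) {n : ℤ} (hn : IsExponent b (3 * b + 2 - n)) :
    (dualEmb hτ m).coeff n = 0 :=
  traceMul_T_eq_zero hτ m hn

/-- If all traces `τ (g m)` vanish, let `m` be the image of a generator of a suitable line bundle
`F` under a morphism `F ⟶ ω`. This morphism pairs to zero with every section of `F` over the
overlap, so it is zero by duality, and then `m = 0`. -/
theorem dualEmb_injective : Function.Injective (dualEmb hτ) := by
  have hinj : ∀ m, dualEmb hτ m = 0 → m = 0 := by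
    intro m hm
    obtain ⟨K, m₁, h⟩ := exists_pow_smul_eq_res ω (isAffineOpen_chart k b 2) (coordRatio k b 2 0)
      (basicOpen_coordRatio k b 2 0) inf_le_right
      (res ω (inf_le_left : chart k b 0 ⊓ chart k b 2 ≤ _) m)
    have h1 : fnRes (inf_le_right : chart k b 0 ⊓ chart k b 2 ≤ _) (coordRatio k b 2 0) =
        torusFn k b (LaurentPolynomial.T (-((3 * b + 5 : ℕ) : ℤ))) :=
      (map_right_eq_torusFn k b _).trans (congrArg _ (torusEval_coordRatio_two_zero k b))
    have hc : IsUnit (fnRes (inf_le_right : chart k b 0 ⊓ chart k b 2 ≤ _)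
        (coordRatio k b 2 0) ^ K) := by
      rw [h1]
      exact ((LaurentPolynomial.isUnit_T _).map (torusFn k b)).pow K
    -- A power of `X₀ / X₂` serves as transition function: times `m` it extends to the section `m₁`
    -- on the second chart, so `e₀ ↦ m`, `e₁ ↦ m₁` define a morphism on all of `X`.
    obtain ⟨F, e₀, e₁, he₀, he₁, he⟩ := exists_glued _ hc
    obtain ⟨φ, hφ, -⟩ := exists_glueHom (chart_sup k b) he₀ he₁ he h.symm
    have hF := isCoherentSheaf_of_isFreeGenerator (isAffineOpen_chart k b 0)
      (isAffineOpen_chart k b 2) (chart_sup k b) he₀ he₁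
    have hφ0 : φ = 0 := by
      refine hτ.inj F hF φ 0 fun n ↦ ?_
      obtain ⟨a, rfl⟩ := (he₀ _ inf_le_left).2 n
      have e1 : secMap (curveToSpec k b) φ (chart k b 0 ⊓ chart k b 2)
          (a • res F inf_le_left e₀ : Γ(F, chart k b 0 ⊓ chart k b 2)) =
          (torusFn k b (torusEval k b _ (top_le_preimage_overlap k b) a) •
            res ω inf_le_left m : Γ(ω, chart k b 0 ⊓ chart k b 2)) := by
        rw [torusFn_torusEval, ← hφ]
        refine (φ.app_smul a _).trans ?_
        exact congrArg (a • ·) (secMap_secRes (curveToSpec k b) φ inf_le_left e₀)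
      have e2 : secMap (curveToSpec k b) (0 : F ⟶ ω) (chart k b 0 ⊓ chart k b 2)
        (a • res F inf_le_left e₀ : Γ(F, chart k b 0 ⊓ chart k b 2)) = 0 := rfl
      refine (congrArg τ e1).trans (Eq.trans ?_ (congrArg τ e2).symm)
      rw [map_zero]
      exact (traceMul_eq_coeff hτ m _).trans (by rw [hm, zero_mul]; rfl)
    rw [← hφ, hφ0]
    rfl
  intro m m' h
  rw [← sub_eq_zero]
  refine hinj _ ?_
  have := dualEmb_add hτ (m - m') m'
  rw [sub_add_cancel, h] at this
  exact right_eq_add.mp this |>.symm ▸ rfl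

/-- The coefficient of `T ^ j` is a functional on functions over the overlap. It vanishes on the
first chart because `j` is a gap and on the second because `j > 0`. By duality it comes from a
morphism `𝒪_X ⟶ ω`, and the image of `1` is the required section. -/
theorem exists_dualEmb_eq_T {j : ℤ} (hj : 0 < j) (hj' : ¬ IsExponent b j) :
    ∃ m, dualEmb hτ m = LaurentPolynomial.T (3 * b + 2 - j) := by
  -- The structure sheaf, as the line bundle with transition function `1`.
  obtain ⟨F, e₀, e₁, he₀, he₁, he⟩ := exists_glued (1 : Γ(curve k b, chart k b 0 ⊓ chart k b 2))
    isUnit_one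
  rw [one_smul] at he
  have hF := isCoherentSheaf_of_isFreeGenerator (isAffineOpen_chart k b 0)
    (isAffineOpen_chart k b 2) (chart_sup k b) he₀ he₁
  let E := Equiv.ofBijective _ (he₀ (chart k b 0 ⊓ chart k b 2) inf_le_left)
  have hE : ∀ a, E a = a • res F inf_le_left e₀ := fun _ ↦ rfl
  let l : Sections (curveToSpec k b) F (chart k b 0 ⊓ chart k b 2) →ₗ[k] k :=
    { toFun := fun s ↦ (torusEval k b _ (top_le_preimage_overlap k b) (E.symm s)).coeff j
      map_add' := by
        intro s s'
        obtain ⟨a, rfl⟩ := E.surjective s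
        obtain ⟨a', rfl⟩ := E.surjective s'
        have : E.symm (E a + E a') = a + a' := by
          rw [E.symm_apply_eq, hE, hE, hE, add_smul]
        refine (congrArg (fun z ↦ (torusEval k b _ (top_le_preimage_overlap k b) z).coeff j)
          this).trans ?_
        rw [E.symm_apply_apply, E.symm_apply_apply, map_add]
        rfl
      map_smul' := by
        intro r s
        obtain ⟨a, rfl⟩ := E.surjective s
        have : E.symm (scalarMap (curveToSpec k b) (chart k b 0 ⊓ chart k b 2) r • E a) =
            scalarMap (curveToSpec k b) (chart k b 0 ⊓ chart k b 2) r * a := by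
          rw [E.symm_apply_eq, hE, hE, mul_smul]
        refine (congrArg (fun z ↦ (torusEval k b _ (top_le_preimage_overlap k b) z).coeff j)
          this).trans ?_
        rw [E.symm_apply_apply, map_mul, torusEval_scalarMap, ← LaurentPolynomial.smul_eq_C_mul]
        rfl }
  have hl : ∀ a : Γ(curve k b, chart k b 0 ⊓ chart k b 2), l (a • res F inf_le_left e₀ : Γ(F, chart k b 0 ⊓ chart k b 2)) =
      (torusEval k b _ (top_le_preimage_overlap k b) a).coeff j := by
    intro a
    change (torusEval k b _ _ (E.symm (E a))).coeff j = _
    rw [E.symm_apply_apply]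
  have hleft : ∀ m, l (secRes (curveToSpec k b) F inf_le_left m) = 0 := by
    intro m
    obtain ⟨a, rfl⟩ := (he₀ _ le_rfl).2 m
    have h1 : res F (inf_le_left : chart k b 0 ⊓ chart k b 2 ≤ _) (a • res F le_rfl e₀) =
        fnRes (inf_le_left : chart k b 0 ⊓ chart k b 2 ≤ _) a •
          res F (inf_le_left : chart k b 0 ⊓ chart k b 2 ≤ _) e₀ := by
      rw [map_smulₛₗ, res_res]
    refine (congrArg l h1).trans ((hl _).trans ?_)
    have h2 : torusEval k b _ (top_le_preimage_overlap k b) (fnRes inf_le_left a) =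
      torusEval k b _ (top_le_preimage_chart k b 0) a := torusEval_map k b _ _ _
    obtain ⟨p, rfl⟩ := coordHom_surjective k b a
    rw [h2, torusEval_coordHom]
    exact coeff_paramHom_eq_zero k b p hj'
  have hright : ∀ m, l (secRes (curveToSpec k b) F inf_le_right m) = 0 := by
    intro m
    obtain ⟨a, rfl⟩ := (he₁ _ le_rfl).2 m
    have h1 : res F (inf_le_right : chart k b 0 ⊓ chart k b 2 ≤ _) (a • res F le_rfl e₁) =
        fnRes (inf_le_right : chart k b 0 ⊓ chart k b 2 ≤ _) a •
          res F (inf_le_left : chart k b 0 ⊓ chart k b 2 ≤ _) e₀ := by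
      rw [map_smulₛₗ, res_res, he]
    refine (congrArg l h1).trans ((hl _).trans ?_)
    have h2 : torusEval k b _ (top_le_preimage_overlap k b) (fnRes inf_le_right a) =
      torusEval k b _ (top_le_preimage_chart k b 2) a := torusEval_map k b _ _ _
    rw [h2]
    exact coeff_torusEval_eq_zero k b a hj
  obtain ⟨φ, hφ⟩ := hτ.surj F hF l hleft hright
  refine ⟨φ.app _ e₀, LaurentPolynomial.ext fun n ↦ ?_⟩
  rw [coeff_dualEmb, traceMul_apply]
  have h1 := hφ (torusFn k b (LaurentPolynomial.T (3 * b + 2 - n)) • res F inf_le_left e₀ :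
    Γ(F, chart k b 0 ⊓ chart k b 2))
  rw [hl, torusEval_torusFn] at h1
  refine Eq.trans (congrArg τ ?_) (h1.trans ?_)
  · refine Eq.symm ((φ.app_smul _ _).trans ?_)
    exact congrArg (_ • ·) (secMap_secRes (curveToSpec k b) φ inf_le_left e₀)
  · rw [LaurentPolynomial.T_apply, LaurentPolynomial.T_apply]
    congr 1
    apply propext
    constructor <;> intro h <;> omega

end curveTrace
end

noncomputable section
open LaurentPolynomial

/-! ### Standard affine charts of `Proj (Sym M)` -/

namespace SymAway
open SymGrading RelProj
variable {R M L : Type u} [CommRing R] [AddCommGroup M] [Module R M] [CommRing L]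

/-- The ring homomorphism `Sym_R M → L` induced by a semilinear map `M → L`. -/
def symLift {σ : R →+* L} (g : M →ₛₗ[σ] L) : SymmetricAlgebra R M →+* L :=
  letI : Algebra R L := σ.toAlgebra
  (SymmetricAlgebra.lift (R := R) (A := L)
    { toFun := g
      map_add' := map_add g
      map_smul' := fun r x ↦ map_smulₛₗ g r x }).toRingHom

theorem symLift_ι {σ : R →+* L} (g : M →ₛₗ[σ] L) (m : M) :
    symLift g (SymmetricAlgebra.ι R M m) = g m :=
  letI : Algebra R L := σ.toAlgebra
  SymmetricAlgebra.lift_ι_apply _ _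

theorem symLift_algebraMap {σ : R →+* L} (g : M →ₛₗ[σ] L) (r : R) :
    symLift g (algebraMap R _ r) = σ r :=
  letI : Algebra R L := σ.toAlgebra
  AlgHom.commutes _ _

/-- The quotient `m / e` of degree one elements. -/
def frac (e m : M) : Away (symPart R M) (SymmetricAlgebra.ι R M e) :=
  Away.mk _ (ι_mem e) 1 (SymmetricAlgebra.ι R M m) (by simpa using ι_mem m)

theorem val_frac (e m : M) : (frac (R := R) e m).val =
    Localization.mk (SymmetricAlgebra.ι R M m)
      ⟨SymmetricAlgebra.ι R M e, Submonoid.mem_powers _⟩ := by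
  rw [frac, Away.val_mk]
  congr 1
  exact Subtype.ext (pow_one _)

theorem frac_add (e m m' : M) : frac (R := R) e (m + m') = frac e m + frac e m' := by
  apply HomogeneousLocalization.val_injective
  rw [val_add, val_frac, val_frac, val_frac, map_add, Localization.add_mk_self]

theorem frac_smul (e : M) (r : R) (m : M) :
    frac e (r • m) = toAway (SymmetricAlgebra.ι R M e) r * frac e m := by
  apply HomogeneousLocalization.val_injective
  rw [val_mul, val_frac, val_frac, val_toAway, map_smul, Localization.mk_mul, one_mul,
    Algebra.smul_def]

theorem frac_self (e : M) : frac (R := R) e e = 1 := by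
  apply HomogeneousLocalization.val_injective
  rw [val_one, val_frac]
  exact Localization.mk_self (⟨_, _⟩ : Submonoid.powers (SymmetricAlgebra.ι R M e))

theorem frac_zero (e : M) : frac (R := R) e 0 = 0 := by
  rw [← zero_smul R (0 : M), frac_smul, map_zero, zero_mul]

/-- The map `Sym_R M → ((Sym_R M)_e)₀` sending `m` to `m / e`. -/
def dehom (e : M) : SymmetricAlgebra R M →+* Away (symPart R M) (SymmetricAlgebra.ι R M e) :=
  symLift (σ := toAway (SymmetricAlgebra.ι R M e))
    { toFun := frac e, map_add' := frac_add e, map_smul' := frac_smul e }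

theorem dehom_ι (e m : M) : dehom (R := R) e (SymmetricAlgebra.ι R M m) = frac e m :=
  symLift_ι _ _

theorem dehom_algebraMap (e : M) (r : R) : dehom e (algebraMap R _ r) = toAway _ r :=
  symLift_algebraMap _ _

/-- For `a` of degree `n` this identifies `dehom e a` with `a / e ^ n`; surjectivity of `dehom e` is
then immediate. -/
theorem algebraMap_pow_mul_val_dehom (e : M) {n : ℕ} {a : SymmetricAlgebra R M}
    (ha : a ∈ symPart R M n) :
    algebraMap _ (Localization.Away (SymmetricAlgebra.ι R M e)) (SymmetricAlgebra.ι R M e) ^ n *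
      (dehom e a).val = algebraMap _ _ a := by
  unfold symPart at ha
  induction ha using Submodule.pow_induction_on_left' with
  | algebraMap r =>
    rw [dehom_algebraMap, pow_zero, one_mul, val_toAway, Localization.mk_one_eq_algebraMap]
  | add x y i hx hy ihx ihy => rw [map_add, val_add, mul_add, ihx, ihy, map_add]
  | mem_mul m hm i x hx ih =>
    obtain ⟨m, rfl⟩ := hm
    have h : algebraMap _ (Localization.Away (SymmetricAlgebra.ι R M e))
        (SymmetricAlgebra.ι R M e) * (frac (R := R) e m).val =
        algebraMap _ _ (SymmetricAlgebra.ι R M m) := by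
      rw [val_frac, Localization.mk_eq_mk']
      exact IsLocalization.mk'_spec' (Localization.Away (SymmetricAlgebra.ι R M e))
        (SymmetricAlgebra.ι R M m) (⟨_, Submonoid.mem_powers _⟩ : Submonoid.powers _)
    rw [map_mul, val_mul, dehom_ι, map_mul, ← ih, ← h, Nat.succ_eq_add_one]
    ring

theorem dehom_surjective (e : M) : Function.Surjective (dehom (R := R) e) := by
  intro z
  obtain ⟨n, a, ha, rfl⟩ := Away.mk_surjective _ (ι_mem e) z
  refine ⟨a, HomogeneousLocalization.val_injective _ ?_⟩
  rw [smul_eq_mul, mul_one] at ha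
  have h := algebraMap_pow_mul_val_dehom e ha
  have hu : IsUnit (algebraMap _ (Localization.Away (SymmetricAlgebra.ι R M e))
      (SymmetricAlgebra.ι R M e) ^ n) :=
    (IsLocalization.Away.algebraMap_isUnit _).pow n
  refine hu.mul_left_cancel (h.trans ?_)
  rw [Away.val_mk, Localization.mk_eq_mk', ← map_pow]
  exact (IsLocalization.mk'_spec' (Localization.Away (SymmetricAlgebra.ι R M e)) a
    (⟨_, _⟩ : Submonoid.powers _)).symm

/-- If `M` is generated by `e` and `e'`, then `((Sym M)_e)₀` is generated by `e' / e`. -/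
theorem surjective_of_generators {e e' : M} (he : ∀ m : M, ∃ r s : R, m = r • e + s • e')
    (g : L →+* Away (symPart R M) (SymmetricAlgebra.ι R M e))
    (hr : ∀ r, ∃ l, g l = toAway _ r) (hv : ∃ l, g l = frac e e') : Function.Surjective g := by
  intro z
  obtain ⟨a, rfl⟩ := dehom_surjective e z
  change dehom e a ∈ g.range
  induction a using SymmetricAlgebra.induction with
  | algebraMap r => rw [dehom_algebraMap]; exact hr r
  | ι m =>
    obtain ⟨r, s, rfl⟩ := he m
    rw [dehom_ι, frac_add, frac_smul, frac_smul, frac_self, mul_one]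
    exact add_mem (hr r) (mul_mem (hr s) hv)
  | mul a b ha hb => rw [map_mul]; exact mul_mem ha hb
  | add a b ha hb => rw [map_add]; exact add_mem ha hb

theorem awayEval_frac {σ : R →+* L} (g : M →ₛₗ[σ] L) {e : M} (he : g e = 1)
    (hu : IsUnit (symLift g (SymmetricAlgebra.ι R M e))) (m : M) :
    ProjPoint.awayEval (symPart R M) (symLift g) _ hu (frac e m) = g m := by
  have h := ProjPoint.awayEval_mk (symPart R M) (symLift g) hu (ι_mem e) 1
    (SymmetricAlgebra.ι R M m) (by simpa using ι_mem m)
  rw [symLift_ι, symLift_ι, he, one_pow, one_mul] at h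
  exact h

theorem awayEval_toAway {σ : R →+* L} (g : M →ₛₗ[σ] L) {e : M}
    (hu : IsUnit (symLift g (SymmetricAlgebra.ι R M e))) (r : R) :
    ProjPoint.awayEval (symPart R M) (symLift g) _ hu (toAway _ r) = σ r := by
  rw [ProjPoint.awayEval_apply, val_toAway, Localization.mk_one_eq_algebraMap,
    IsLocalization.Away.lift_eq, symLift_algebraMap]

end SymAway

/-! ### The local model and the monomial map to it -/

section localModel
variable (k : Type u) [Field k] (b : ℕ)

/-- The coordinate `x` of the local model. -/
abbrev modelX : LocalModel k b := Ideal.Quotient.mk _ (MvPolynomial.X 0)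

/-- The coordinate `v` of the local model. -/
abbrev modelV : LocalModel k b := Ideal.Quotient.mk _ (MvPolynomial.X 1)

theorem modelX_pow_mul : modelX k b ^ (b + 1) * (modelX k b + modelV k b ^ 3) = 0 := by
  rw [← map_pow, ← map_pow, ← map_add, ← map_mul, Ideal.Quotient.eq_zero_iff_mem]
  exact Ideal.mem_span_singleton_self _

theorem localModelHom_X0 : localModelHom k b (MvPolynomial.X 0) = modelX k b := by
  simp [localModelHom]

theorem localModelHom_X1 :
    localModelHom k b (MvPolynomial.X 1) = modelV k b ^ 2 * modelX k b ^ (b + 1) := by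
  simp [localModelHom]

theorem localModelHom_X2 :
    localModelHom k b (MvPolynomial.X 2) = -(modelV k b * modelX k b ^ (b + 1)) := by
  simp [localModelHom]

/-- The minor `z ^ 2 - x ^ (b+1) y` maps to zero identically; the other two map to multiples of `x ^
(b+1) (x + v ^ 3)`. -/
theorem maximalMinors_le_ker_localModelHom :
    maximalMinors (hilbertBurchMatrix k b) ≤ RingHom.ker (localModelHom k b) := by
  rw [maximalMinors, Ideal.span_le]
  rintro _ ⟨i, rfl⟩
  rw [SetLike.mem_coe, RingHom.mem_ker]
  have h := modelX_pow_mul k b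
  fin_cases i
  · refine (congrArg _ (det_submatrix_zero k b)).trans ?_
    simp only [map_sub, map_mul, map_pow, localModelHom_X0, localModelHom_X1, localModelHom_X2]
    linear_combination (modelV k b * modelX k b ^ (b + 1)) * h
  · refine (congrArg _ (det_submatrix_one k b)).trans ?_
    simp only [map_sub, map_mul, map_pow, localModelHom_X0, localModelHom_X1, localModelHom_X2]
    linear_combination (-modelX k b ^ (b + 1)) * h
  · refine (congrArg _ (det_submatrix_two k b)).trans ?_
    simp only [map_sub, map_mul, map_pow, localModelHom_X0, localModelHom_X1, localModelHom_X2]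
    ring

/-- The value `x ^ i (-v) ^ j` of `T ^ (3 i + j)` in the local model. -/
def modelMonomial (n : ℤ) : LocalModel k b :=
  modelX k b ^ (n / 3).toNat * (-modelV k b) ^ (n % 3).toNat

/-- The `k`-linear map from Laurent polynomials to the local model with
`T ^ (3 i + j) ↦ x ^ i (-v) ^ j`. -/
def modelMap : k[T;T⁻¹] →ₗ[k] LocalModel k b :=
  Finsupp.linearCombination k (modelMonomial k b) ∘ₗ
    (AddMonoidAlgebra.coeffLinearEquiv k : k[T;T⁻¹] ≃ₗ[k] ℤ →₀ k).toLinearMap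

theorem modelMap_T (n : ℤ) : modelMap k b (LaurentPolynomial.T n) = modelMonomial k b n := by
  have : (LaurentPolynomial.T n : k[T;T⁻¹]).coeff = Finsupp.single n 1 := rfl
  change Finsupp.linearCombination k (modelMonomial k b) (LaurentPolynomial.T n : k[T;T⁻¹]).coeff = _
  rw [this, Finsupp.linearCombination_single, one_smul]

theorem eq_sum_coeff_smul_T (q : k[T;T⁻¹]) :
    q = ∑ n ∈ q.coeff.support, q.coeff n • LaurentPolynomial.T n := by
  refine LaurentPolynomial.ext fun m ↦ ?_
  simp [LaurentPolynomial.T_apply, AddMonoidAlgebra.coeff_sum, Finsupp.finsetSum_apply]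

variable {k} in
theorem linearMap_eq_of_nonneg {V : Type*} [AddCommGroup V] [Module k V] {f g : k[T;T⁻¹] →ₗ[k] V}
    (h : ∀ n : ℤ, 0 ≤ n → f (LaurentPolynomial.T n) = g (LaurentPolynomial.T n)) {q : k[T;T⁻¹]}
    (hq : ∀ n < 0, q.coeff n = 0) : f q = g q := by
  rw [eq_sum_coeff_smul_T k q, map_sum, map_sum]
  refine Finset.sum_congr rfl fun n hn ↦ ?_
  rw [map_smul, map_smul, h n]
  by_contra hneg
  exact (Finsupp.mem_support_iff.mp hn) (hq n (not_le.mp hneg))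

theorem modelMonomial_eq {n : ℤ} {i j : ℕ} (h : n = 3 * i + j) (hj : j < 3) :
    modelMonomial k b n = modelX k b ^ i * (-modelV k b) ^ j := by
  rw [modelMonomial, show (n / 3).toNat = i by omega, show (n % 3).toNat = j by omega]

theorem modelMonomial_three_add {n : ℤ} (hn : 0 ≤ n) :
    modelMonomial k b (3 + n) = modelX k b * modelMonomial k b n := by
  rw [modelMonomial, modelMonomial, show ((3 + n) / 3).toNat = (n / 3).toNat + 1 by omega,
    show (3 + n) % 3 = n % 3 by omega]
  ring

/-- A carry modulo `3` replaces `(-v) ^ 3` by `x`. This is not allowed in general, but it is after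
multiplication by `x ^ (b+1)`, by the defining relation of the model; and `z` brings that factor. -/
theorem modelMonomial_add_four {n : ℤ} (hn : 0 ≤ n) :
    modelMonomial k b (3 * b + 4 + n) =
      -(modelV k b * modelX k b ^ (b + 1)) * modelMonomial k b n := by
  have hx := modelX_pow_mul k b
  obtain ⟨i, rfl | rfl | rfl⟩ : ∃ i : ℕ, n = 3 * i ∨ n = 3 * i + 1 ∨ n = 3 * i + 2 :=
    ⟨(n / 3).toNat, by omega⟩
  · rw [modelMonomial_eq k b (i := b + 1 + i) (j := 1) (by push_cast; ring) (by norm_num),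
      modelMonomial_eq k b (i := i) (j := 0) (by push_cast; ring) (by norm_num)]
    ring
  · rw [modelMonomial_eq k b (i := b + 1 + i) (j := 2) (by push_cast; ring) (by norm_num),
      modelMonomial_eq k b (i := i) (j := 1) (by push_cast; ring) (by norm_num)]
    ring
  · rw [modelMonomial_eq k b (i := b + 2 + i) (j := 0) (by push_cast; ring) (by norm_num),
      modelMonomial_eq k b (i := i) (j := 2) (by push_cast; ring) (by norm_num)]
    linear_combination modelX k b ^ i * hx

theorem modelMonomial_add_five {n : ℤ} (hn : 0 ≤ n) :
    modelMonomial k b (3 * b + 5 + n) =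
      modelV k b ^ 2 * modelX k b ^ (b + 1) * modelMonomial k b n := by
  have hx := modelX_pow_mul k b
  obtain ⟨i, rfl | rfl | rfl⟩ : ∃ i : ℕ, n = 3 * i ∨ n = 3 * i + 1 ∨ n = 3 * i + 2 :=
    ⟨(n / 3).toNat, by omega⟩
  · rw [modelMonomial_eq k b (i := b + 1 + i) (j := 2) (by push_cast; ring) (by norm_num),
      modelMonomial_eq k b (i := i) (j := 0) (by push_cast; ring) (by norm_num)]
    ring
  · rw [modelMonomial_eq k b (i := b + 2 + i) (j := 0) (by push_cast; ring) (by norm_num),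
      modelMonomial_eq k b (i := i) (j := 1) (by push_cast; ring) (by norm_num)]
    linear_combination modelX k b ^ i * hx
  · rw [modelMonomial_eq k b (i := b + 2 + i) (j := 1) (by push_cast; ring) (by norm_num),
      modelMonomial_eq k b (i := i) (j := 2) (by push_cast; ring) (by norm_num)]
    linear_combination -modelV k b * modelX k b ^ i * hx

/-- Semilinearity is checked on the variables and on monomials `T ^ n`. Nonnegative exponents are
required because `modelMonomial` truncates negative quotients; multiplication by a variable
preserves the condition. -/
theorem modelMap_paramHom_mul (p : MvPolynomial (Fin 3) k) :
    ∀ {q : k[T;T⁻¹]}, (∀ n < 0, q.coeff n = 0) →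
      modelMap k b (paramHom k b p * q) = localModelHom k b p * modelMap k b q := by
  induction p using MvPolynomial.induction_on with
  | C a =>
    intro q _
    have h1 : paramHom k b (MvPolynomial.C a) = algebraMap k _ a := (paramHom k b).commutes a
    have h2 : localModelHom k b (MvPolynomial.C a) = algebraMap k _ a :=
      (localModelHom k b).commutes a
    rw [h1, h2, ← Algebra.smul_def, map_smul]
    exact Algebra.smul_def (A := LocalModel k b) a (modelMap k b q)
  | add p p' hp hp' =>
    intro q hq
    rw [map_add, add_mul, map_add, hp hq, hp' hq, map_add, add_mul]
  | mul_X p i hp =>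
    intro q hq
    obtain ⟨s, hs, hi, hm⟩ : ∃ s : ℤ, 0 ≤ s ∧ paramHom k b (MvPolynomial.X i) = T s ∧
        ∀ n, 0 ≤ n → modelMonomial k b (s + n) =
          localModelHom k b (MvPolynomial.X i) * modelMonomial k b n := by
      fin_cases i
      · exact ⟨3, by omega, paramHom_X0 k b, fun n hn ↦ (modelMonomial_three_add k b hn).trans
          (congrArg (· * _) (localModelHom_X0 k b).symm)⟩
      · exact ⟨3 * b + 5, by omega, (paramHom_X1 k b).trans (by push_cast; rfl),
          fun n hn ↦ (modelMonomial_add_five k b hn).trans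
            (congrArg (· * _) (localModelHom_X1 k b).symm)⟩
      · exact ⟨3 * b + 4, by omega, (paramHom_X2 k b).trans (by push_cast; rfl),
          fun n hn ↦ (modelMonomial_add_four k b hn).trans
            (congrArg (· * _) (localModelHom_X2 k b).symm)⟩
    rw [map_mul (paramHom k b), mul_assoc, hp, map_mul (localModelHom k b), mul_assoc]
    · congr 1
      rw [hi]
      refine linearMap_eq_of_nonneg (f := modelMap k b ∘ₗ LinearMap.mulLeft k (T s))
        (g := LinearMap.mulLeft k (localModelHom k b (MvPolynomial.X i)) ∘ₗ modelMap k b)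
        (fun n hn ↦ ?_) hq
      simp only [LinearMap.comp_apply, LinearMap.mulLeft_apply]
      rw [← T_add, modelMap_T, modelMap_T, hm n hn]
    · intro n hn
      rw [hi, mul_comm, coeff_mul_T]
      exact hq _ (by omega)

end localModel
end

noncomputable section
open LaurentPolynomial

/-! ### The first chart and the relations between the generators -/

section chartModel
variable (k : Type u) [Field k] (b : ℕ)

/-- The map from functions on the first chart to the local model. -/
def chartModelHom : Γ(curve k b, chart k b 0) →+* LocalModel k b :=
  (coordHom k b).liftOfSurjective (coordHom_surjective k b)
    ⟨(localModelHom k b).toRingHom, by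
      rw [ker_coordHom, ker_paramHom]
      exact maximalMinors_le_ker_localModelHom k b⟩

theorem chartModelHom_coordHom (p : MvPolynomial (Fin 3) k) :
    chartModelHom k b (coordHom k b p) = localModelHom k b p :=
  RingHom.liftOfRightInverse_comp_apply _ _ _ _ _

/-- The relations between `1` and `T` over the semigroup ring, one for each row of the Hilbert-Burch
matrix. -/
theorem paramHom_relations :
    paramHom k b (MvPolynomial.X 2) - paramHom k b (MvPolynomial.X 0 ^ (b + 1)) * T 1 = 0 ∧
    paramHom k b (MvPolynomial.X 1) - paramHom k b (MvPolynomial.X 2) * T 1 = 0 ∧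
    paramHom k b (MvPolynomial.X 0 ^ (b + 2)) - paramHom k b (MvPolynomial.X 1) * T 1 = 0 := by
  simp only [map_pow, paramHom_X0, paramHom_X1, paramHom_X2, T_pow, ← T_add, sub_eq_zero]
  refine ⟨?_, ?_, ?_⟩ <;> congr 1 <;> push_cast <;> ring

theorem localModel_ringHom_ext {S : Type*} [CommRing S] {f g : LocalModel k b →+* S}
    (hC : ∀ a : k, f (Ideal.Quotient.mk _ (MvPolynomial.C a)) =
      g (Ideal.Quotient.mk _ (MvPolynomial.C a)))
    (hx : f (modelX k b) = g (modelX k b)) (hv : f (modelV k b) = g (modelV k b)) : f = g := by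
  refine Ideal.Quotient.ringHom_ext (MvPolynomial.ringHom_ext hC fun i ↦ ?_)
  fin_cases i
  exacts [hx, hv]

end chartModel

/-! ### From the relations to the local model -/

section presentation
open RelProj SymGrading SymAway
variable {k : Type u} [Field k] {b : ℕ} {R M : Type u} [CommRing R] [AddCommGroup M] [Module R M]
  {e e' : M} {c : MvPolynomial (Fin 3) k →+* R} {σ : R →+* LocalModel k b}
  {Ψ : M →ₛₗ[σ] LocalModel k b}

theorem frac_relation {p q : MvPolynomial (Fin 3) k} (h : c p • e + c q • e' = 0) :
    toAway (SymmetricAlgebra.ι R M e) (c p) +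
      toAway (SymmetricAlgebra.ι R M e) (c q) * frac e e' = 0 := by
  have h2 := congrArg (frac (R := R) e) h
  rwa [frac_add, frac_smul, frac_smul, frac_self, mul_one, frac_zero] at h2

variable (b) in
theorem exists_modelHom {S : Type u} [CommRing S] (A : MvPolynomial (Fin 3) k →+* S) (w : S)
    (r0 : A (MvPolynomial.X 2) + A (MvPolynomial.X 0 ^ (b + 1)) * w = 0)
    (r1 : A (MvPolynomial.X 1) + A (MvPolynomial.X 2) * w = 0)
    (r2 : A (MvPolynomial.X 0 ^ (b + 2)) + A (MvPolynomial.X 1) * w = 0) :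
    ∃ g : LocalModel k b →+* S, (∀ p, g (localModelHom k b p) = A p) ∧ g (modelV k b) = w := by
  let g₀ : MvPolynomial (Fin 2) k →+* S :=
    MvPolynomial.eval₂Hom (A.comp MvPolynomial.C) ![A (MvPolynomial.X 0), w]
  rw [map_pow] at r0 r2
  have hg₀x : g₀ (MvPolynomial.X 0) = A (MvPolynomial.X 0) := by simp [g₀]
  have hg₀v : g₀ (MvPolynomial.X 1) = w := by simp [g₀]
  have hg₀C : ∀ a, g₀ (MvPolynomial.C a) = A (MvPolynomial.C a) := by simp [g₀]
  let g : LocalModel k b →+* S := Ideal.Quotient.lift _ g₀ (by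
    intro a ha
    rw [← RingHom.mem_ker]
    refine (Ideal.span_singleton_le_iff_mem _).mpr ?_ ha
    rw [RingHom.mem_ker, map_mul, map_add, map_pow, map_pow, hg₀x, hg₀v]
    -- Eliminating `y` and `z` from the three relations leaves `x ^ (b+2) + w ^ 3 x ^ (b+1) = 0`.
    linear_combination r2 - w * r1 + w ^ 2 * r0)
  have hgx : g (modelX k b) = A (MvPolynomial.X 0) := hg₀x
  have hgv : g (modelV k b) = w := hg₀v
  refine ⟨g, fun p ↦ ?_, hgv⟩
  have : g.comp (localModelHom k b).toRingHom = A := by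
    refine MvPolynomial.ringHom_ext (fun a ↦ ?_) fun i ↦ ?_
    · exact (congrArg g ((localModelHom k b).commutes a)).trans (hg₀C a)
    · fin_cases i
      · exact (congrArg g (localModelHom_X0 k b)).trans hgx
      · refine (congrArg g (localModelHom_X1 k b)).trans ?_
        rw [map_mul, map_pow, map_pow, hgx, hgv]
        change _ = A (MvPolynomial.X 1)
        linear_combination w * r0 - r1
      · refine (congrArg g (localModelHom_X2 k b)).trans ?_
        rw [map_neg, map_mul, map_pow, hgx, hgv]
        change _ = A (MvPolynomial.X 2)
        linear_combination - r0
  exact congr($this p)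

/-- The relations give `g` from the model to `S`, surjective because `S` is generated by `w`. The
given `Φ` satisfies `Φ ∘ g = id`, since both fix `x`, `v` and the constants. So `g` is also
injective, and no completeness of the relations is needed. -/
theorem exists_equiv_of_relations {S : Type u} [CommRing S] {t : R →+* S} {w : S}
    {Φ : S →+* LocalModel k b} (hc : Function.Surjective c)
    (hσ : ∀ p, σ (c p) = localModelHom k b p) (hΦ : ∀ r, Φ (t r) = σ r) (hw : Φ w = modelV k b)
    (hgen : ∀ g : LocalModel k b →+* S, (∀ r, ∃ l, g l = t r) → (∃ l, g l = w) →
      Function.Surjective g)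
    (r0 : t (c (MvPolynomial.X 2)) + t (c (MvPolynomial.X 0 ^ (b + 1))) * w = 0)
    (r1 : t (c (MvPolynomial.X 1)) + t (c (MvPolynomial.X 2)) * w = 0)
    (r2 : t (c (MvPolynomial.X 0 ^ (b + 2))) + t (c (MvPolynomial.X 1)) * w = 0) :
    ∃ Φ : S ≃+* LocalModel k b, ∀ r, Φ (t r) = σ r := by
  obtain ⟨g, hg, hgv⟩ := exists_modelHom b (t.comp c) w r0 r1 r2
  have hΦg' : ∀ p, Φ (g (localModelHom k b p)) = localModelHom k b p := fun p ↦ by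
    rw [hg, RingHom.comp_apply, hΦ, hσ]
  have hΦg : Φ.comp g = RingHom.id _ := by
    refine localModel_ringHom_ext k b (fun a ↦ ?_) ?_ ?_
    · have : localModelHom k b (MvPolynomial.C a) = Ideal.Quotient.mk _ (MvPolynomial.C a) :=
        (localModelHom k b).commutes a
      rw [← this]
      exact hΦg' _
    · rw [← localModelHom_X0]
      exact hΦg' _
    · rw [RingHom.comp_apply, hgv, hw, RingHom.id_apply]
  have hsurj : Function.Surjective g := by
    refine hgen g (fun r ↦ ?_) ⟨_, hgv⟩
    obtain ⟨p, rfl⟩ := hc r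
    exact ⟨_, hg p⟩
  have hgΦ : ∀ z, g (Φ z) = z := by
    intro z
    obtain ⟨l, rfl⟩ := hsurj z
    exact congrArg g congr($hΦg l)
  exact ⟨RingEquiv.ofRingHom Φ g hΦg (RingHom.ext hgΦ), hΦ⟩

theorem exists_away_equiv_of_relations (hc : Function.Surjective c)
    (hσ : ∀ p, σ (c p) = localModelHom k b p) (h1 : Ψ e = 1) (hv : Ψ e' = modelV k b)
    (hgen : ∀ m : M, ∃ r s : R, m = r • e + s • e')
    (r0 : c (MvPolynomial.X 2) • e + c (MvPolynomial.X 0 ^ (b + 1)) • e' = 0)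
    (r1 : c (MvPolynomial.X 1) • e + c (MvPolynomial.X 2) • e' = 0)
    (r2 : c (MvPolynomial.X 0 ^ (b + 2)) • e + c (MvPolynomial.X 1) • e' = 0) :
    ∃ Φ : Away (symPart R M) (SymmetricAlgebra.ι R M e) ≃+* LocalModel k b,
      ∀ r, Φ (toAway (SymmetricAlgebra.ι R M e) r) = σ r := by
  have hu : IsUnit (symLift Ψ (SymmetricAlgebra.ι R M e)) := by
    rw [symLift_ι, h1]
    exact isUnit_one
  have hw : ProjPoint.awayEval (symPart R M) (symLift Ψ) _ hu (frac e e') = modelV k b :=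
    (awayEval_frac Ψ h1 hu e').trans hv
  exact exists_equiv_of_relations hc hσ (awayEval_toAway Ψ hu) hw
    (surjective_of_generators hgen) (frac_relation r0) (frac_relation r1) (frac_relation r2)

end presentation


/-! ### Generators of the dualizing module -/

section generators
open RelProj SymGrading SymAway
variable {k : Type u} [Field k] {b : ℕ} {ω : (curve k b).Modules}
  {τ : Sections (curveToSpec k b) ω (chart k b 0 ⊓ chart k b 2) →ₗ[k] k} [ω.IsQuasicoherent]
  (hτ : IsTrace (curveToSpec k b) ω (chart k b 0) (chart k b 2) τ)

theorem dualEmb_coordHom_smul (p : MvPolynomial (Fin 3) k) (m : Γ(ω, chart k b 0)) :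
    dualEmb hτ (coordHom k b p • m) = paramHom k b p * dualEmb hτ m := by
  rw [dualEmb_smul, torusEval_coordHom]

theorem dualEmb_zero : dualEmb hτ 0 = 0 := by
  rw [← smul_zero (coordHom k b 0), dualEmb_coordHom_smul, map_zero, zero_mul]

theorem exists_dualEmb_eq_one : ∃ e, dualEmb hτ e = 1 := by
  -- The two largest gaps, `3b+2` here and `3b+1` in the next lemma, yield the generators `T ^ 0`
  -- and `T ^ 1`.
  obtain ⟨e, he⟩ := exists_dualEmb_eq_T hτ (j := 3 * b + 2) (by omega)
    (fun h ↦ (h.2 b le_rfl).2 rfl)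
  exact ⟨e, by rw [he, sub_self, T_zero]⟩

theorem exists_dualEmb_eq_neg_T : ∃ e, dualEmb hτ e = -T 1 := by
  obtain ⟨e, he⟩ := exists_dualEmb_eq_T hτ (j := 3 * b + 1) (by omega)
    (fun h ↦ (h.2 b le_rfl).1 rfl)
  -- The sign makes `e' / e` correspond to `v`, in accordance with `z = -v x ^ (b+1)`.
  refine ⟨coordHom k b (-1) • e, ?_⟩
  rw [dualEmb_coordHom_smul, he, map_neg, map_one, neg_one_mul]
  congr 2
  ring

theorem coeff_dualEmb_of_neg (m : Γ(ω, chart k b 0)) {n : ℤ} (hn : n < 0) :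
    (dualEmb hτ m).coeff n = 0 :=
  coeff_dualEmb_eq_zero hτ m (isExponent_of_lt (by omega))

/-- The semilinear map from the sections of the dualizing sheaf over the first chart to the local
model. -/
def dualModelMap : Γ(ω, chart k b 0) →ₛₗ[chartModelHom k b] LocalModel k b where
  toFun m := modelMap k b (dualEmb hτ m)
  map_add' m m' := by rw [dualEmb_add, map_add]
  map_smul' f m := by
    obtain ⟨p, rfl⟩ := coordHom_surjective k b f
    rw [dualEmb_coordHom_smul, modelMap_paramHom_mul k b p fun n hn ↦ coeff_dualEmb_of_neg hτ m hn,
      chartModelHom_coordHom, smul_eq_mul]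

theorem dualModelMap_of_eq_one {e : Γ(ω, chart k b 0)} (he : dualEmb hτ e = 1) :
    dualModelMap hτ e = 1 := by
  change modelMap k b (dualEmb hτ e) = 1
  rw [he, ← T_zero, modelMap_T, modelMonomial_eq k b (i := 0) (j := 0) (by simp) (by norm_num)]
  simp

theorem dualModelMap_of_eq_neg_T {e : Γ(ω, chart k b 0)} (he : dualEmb hτ e = -T 1) :
    dualModelMap hτ e = modelV k b := by
  change modelMap k b (dualEmb hτ e) = _
  rw [he, map_neg, modelMap_T, modelMonomial_eq k b (i := 0) (j := 1) (by simp) (by norm_num)]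
  simp

variable {e e' : Γ(ω, chart k b 0)}

/-- If `n` is in the semigroup, `T ^ n` is a multiple of `1`. Otherwise `n = 3i+1` with `i ≤ b`, and
`T ^ n` is `x ^ i` times `T`; the case `n = 3i+2` is excluded because then `3b+2-n = 3(b-i)` is in
the semigroup. -/
theorem exists_dualEmb_eq_smul_T (he : dualEmb hτ e = 1) (he' : dualEmb hτ e' = -T 1) {n : ℤ}
    (hn : ¬ IsExponent b (3 * b + 2 - n)) :
    ∃ p q, dualEmb hτ (coordHom k b p • e + coordHom k b q • e') = T n := by
  simp only [dualEmb_add, dualEmb_coordHom_smul, he, he']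
  by_cases h1 : IsExponent b n
  · obtain ⟨p, hp⟩ := exists_paramHom_eq_T k b h1
    exact ⟨p, 0, by rw [hp, map_zero, zero_mul, add_zero, mul_one]⟩
  · have h2 : IsExponent b (n - 1) := by
      have hn0 : 0 ≤ n := by
        by_contra h
        exact hn (isExponent_of_lt (by omega))
      have : ∃ i : ℕ, i ≤ b ∧ (n = 3 * i + 1 ∨ n = 3 * i + 2) := by
        by_contra! h
        exact h1 ⟨hn0, h⟩
      obtain ⟨i, hi, rfl | rfl⟩ := this
      · exact ⟨by omega, fun j hj ↦ by omega⟩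
      · exact absurd ⟨by omega, fun j hj ↦ by omega⟩ hn
    obtain ⟨p, hp⟩ := exists_paramHom_eq_T k b h2
    exact ⟨0, -p, by rw [map_neg, hp, map_zero, zero_mul, zero_add, neg_mul_neg, ← T_add,
      sub_add_cancel]⟩

theorem exists_eq_smul_add_smul (he : dualEmb hτ e = 1) (he' : dualEmb hτ e' = -T 1)
    (m : Γ(ω, chart k b 0)) :
    ∃ r s : Γ(curve k b, chart k b 0), m = r • e + s • e' := by
  have key : ∀ (s : Finset ℤ) (c : ℤ → k), (∀ n ∈ s, c n ≠ 0 → ¬ IsExponent b (3 * b + 2 - n)) →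
      ∃ p q, dualEmb hτ (coordHom k b p • e + coordHom k b q • e') = ∑ n ∈ s, c n • T n := by
    intro s c
    induction s using Finset.induction_on with
    | empty =>
      intro _
      refine ⟨0, 0, ?_⟩
      rw [map_zero, zero_smul, zero_smul, add_zero, dualEmb_zero, Finset.sum_empty]
    | insert a s ha ih =>
      intro h
      obtain ⟨p, q, hpq⟩ := ih fun n hn ↦ h n (Finset.mem_insert_of_mem hn)
      rw [Finset.sum_insert ha, ← hpq]
      by_cases hc : c a = 0
      · exact ⟨p, q, by rw [hc, zero_smul, zero_add]⟩
      · obtain ⟨p', q', h'⟩ := exists_dualEmb_eq_smul_T hτ he he'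
          (h a (Finset.mem_insert_self a s) hc)
        refine ⟨MvPolynomial.C (c a) * p' + p, MvPolynomial.C (c a) * q' + q, ?_⟩
        have hC : paramHom k b (MvPolynomial.C (c a)) = C (c a) := (paramHom k b).commutes (c a)
        rw [← h', smul_eq_C_mul]
        simp only [dualEmb_add, dualEmb_coordHom_smul, map_add (paramHom k b),
          map_mul (paramHom k b), hC]
        ring
  obtain ⟨p, q, h⟩ := key (dualEmb hτ m).coeff.support (dualEmb hτ m).coeff
    fun n _ hc hn ↦ hc (coeff_dualEmb_eq_zero hτ m hn)
  rw [← eq_sum_coeff_smul_T] at h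
  exact ⟨_, _, (dualEmb_injective hτ h).symm⟩

theorem smul_add_smul_eq_zero (he : dualEmb hτ e = 1) (he' : dualEmb hτ e' = -T 1)
    {p q : MvPolynomial (Fin 3) k} (h : paramHom k b p - paramHom k b q * T 1 = 0) :
    coordHom k b p • e + coordHom k b q • e' = 0 := by
  apply dualEmb_injective hτ
  rw [dualEmb_add, dualEmb_coordHom_smul, dualEmb_coordHom_smul, he, he', dualEmb_zero, ← h]
  ring

/-- The standard affine open of `Proj (Sym ω)` over the first chart on which the section `e` does
not vanish is the spectrum of the local model. -/
theorem exists_away_equiv (hτ : IsTrace (curveToSpec k b) ω (chart k b 0) (chart k b 2) τ) :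
    ∃ (e : Γ(ω, chart k b 0)) (Φ : Away (symPart Γ(curve k b, chart k b 0) Γ(ω, chart k b 0))
      (SymmetricAlgebra.ι _ _ e) ≃+* LocalModel k b),
      ∀ r, Φ (toAway (SymmetricAlgebra.ι _ _ e) r) = chartModelHom k b r := by
  obtain ⟨e, he⟩ := exists_dualEmb_eq_one hτ
  obtain ⟨e', he'⟩ := exists_dualEmb_eq_neg_T hτ
  obtain ⟨r0, r1, r2⟩ := paramHom_relations k b
  exact ⟨e, exists_away_equiv_of_relations (coordHom_surjective k b) (chartModelHom_coordHom k b)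
    (dualModelMap_of_eq_one hτ he) (dualModelMap_of_eq_neg_T hτ he')
    (exists_eq_smul_add_smul hτ he he') (smul_add_smul_eq_zero hτ he he' r0)
    (smul_add_smul_eq_zero hτ he he' r1) (smul_add_smul_eq_zero hτ he he' r2)⟩

end generators
end

noncomputable section

/-! ### Affine charts of the projectivization -/

section projChart
open RelProj SymGrading
variable {X : Scheme.{u}} (M : X.Modules) [M.IsQuasicoherent] {U : X.Opens} (hU : IsAffineOpen U)

/-- The open immersion of `Proj (Sym Γ(M, U))` in the projectivization of `M`. -/
def projChart : Proj (symPart Γ(X, U) Γ(M, U)) ⟶ projectivization M :=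
  (gluingData M).cover.f ⟨U, hU⟩

instance : IsOpenImmersion (projChart M hU) :=
  (gluingData M).cover.map_prop ⟨U, hU⟩

theorem projChart_projectivizationHom :
    projChart M hU ≫ projectivizationHom M = toSpec Γ(X, U) Γ(M, U) ≫ hU.fromSpec := by
  refine ((gluingData M).ι_toBase ⟨U, hU⟩).trans ?_
  have h : (gluingData M).natTrans.app ⟨U, hU⟩ = toSpec Γ(X, U) Γ(M, U) ≫ hU.isoSpec.inv := rfl
  refine (congrArg (· ≫ U.ι) h).trans ?_
  refine (Category.assoc _ _ _).trans (congrArg (toSpec Γ(X, U) Γ(M, U) ≫ ·) ?_)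
  exact hU.isoSpec_inv_ι

theorem specMap_fromSpec_appLE {L : Type u} [CommRing L] (σ : Γ(X, U) →+* L)
    (h : ⊤ ≤ (Spec.map (CommRingCat.ofHom σ) ≫ hU.fromSpec : Spec (.of L) ⟶ X) ⁻¹ᵁ U)
    (r : Γ(X, U)) :
    (Spec.map (CommRingCat.ofHom σ) ≫ hU.fromSpec : Spec (.of L) ⟶ X).appLE U ⊤ h r =
      (Scheme.ΓSpecIso (.of L)).inv (σ r) := by
  have h0 : ⊤ ≤ hU.fromSpec ⁻¹ᵁ U := by rw [hU.fromSpec_preimage_self]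
  have h1 : hU.fromSpec.appLE U ⊤ h0 = (Scheme.ΓSpecIso Γ(X, U)).inv := by
    rw [Scheme.Hom.appLE, hU.fromSpec_app_self, Category.assoc, ← Functor.map_comp]
    exact (congrArg _ (CategoryTheory.Functor.map_id _ _)).trans (Category.comp_id _)
  have h2 : (Spec.map (CommRingCat.ofHom σ) ≫ hU.fromSpec : Spec (.of L) ⟶ X).appLE U ⊤ h =
      CommRingCat.ofHom σ ≫ (Scheme.ΓSpecIso (.of L)).inv := by
    rw [Scheme.ΓSpecIso_inv_naturality, Scheme.Hom.appTop, Scheme.Hom.app_eq_appLE]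
    refine Eq.trans ?_ (congrArg (· ≫ (Spec.map (CommRingCat.ofHom σ)).appLE ⊤ ⊤ _) h1)
    exact (Scheme.Hom.appLE_comp_appLE (Spec.map (CommRingCat.ofHom σ)) hU.fromSpec U ⊤ ⊤ h0
      le_top).symm
  exact congr($h2 r)

theorem exists_openImmersion_of_away_equiv {L : Type u} [CommRing L] {e : Γ(M, U)}
    (Φ : Away (symPart Γ(X, U) Γ(M, U)) (SymmetricAlgebra.ι _ _ e) ≃+* L) {σ : Γ(X, U) →+* L}
    (hΦ : ∀ r, Φ (toAway (SymmetricAlgebra.ι _ _ e) r) = σ r) :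
    ∃ j : Spec (.of L) ⟶ projectivization M, IsOpenImmersion j ∧
      j ≫ projectivizationHom M = Spec.map (CommRingCat.ofHom σ) ≫ hU.fromSpec := by
  let i := Proj.awayι (symPart Γ(X, U) Γ(M, U)) (SymmetricAlgebra.ι _ _ e) (ι_mem e) one_pos
  let s : Spec (.of L) ⟶ Spec (.of (Away (symPart _ Γ(M, U)) (SymmetricAlgebra.ι _ _ e))) :=
    Spec.map Φ.toCommRingCatIso.hom
  refine ⟨s ≫ i ≫ projChart M hU, inferInstance, ?_⟩
  have h : s ≫ i ≫ toSpec Γ(X, U) Γ(M, U) = Spec.map (CommRingCat.ofHom σ) := by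
    refine (congrArg (s ≫ ·) (awayι_toSpec (ι_mem e) one_pos)).trans ?_
    refine (Spec.map_comp _ _).symm.trans (congrArg Spec.map ?_)
    ext r
    exact hΦ r
  rw [Category.assoc, Category.assoc, projChart_projectivizationHom, ← h, Category.assoc,
    Category.assoc]

end projChart

/-! ### The open immersion of the local model -/

section embedding
open RelProj
variable {k : Type u} [Field k] {b : ℕ} {ω : (curve k b).Modules} [ω.IsQuasicoherent]

theorem exists_localModel_embedding (hω : IsDualizingSheaf (curveToSpec k b) ω) :
    ∃ j : Spec (.of (LocalModel k b)) ⟶ projectivization ω, IsOpenImmersion j ∧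
      j ≫ projectivizationHom ω = Spec.map (CommRingCat.ofHom (chartModelHom k b)) ≫
        (isAffineOpen_chart k b 0).fromSpec := by
  obtain ⟨τ, hτ⟩ := exists_isTrace hω (isAffineOpen_chart k b 0) (isAffineOpen_chart k b 2)
    (chart_sup k b)
  obtain ⟨e, Φ, hΦ⟩ := exists_away_equiv hτ
  exact exists_openImmersion_of_away_equiv ω (isAffineOpen_chart k b 0) Φ hΦ

theorem top_le_preimage_of_eq {j : Spec (.of (LocalModel k b)) ⟶ projectivization ω}
    (hj : j ≫ projectivizationHom ω = Spec.map (CommRingCat.ofHom (chartModelHom k b)) ≫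
        (isAffineOpen_chart k b 0).fromSpec) :
    ⊤ ≤ (j ≫ projectivizationHom ω) ⁻¹ᵁ curveChart k b := by
  rw [hj, Scheme.Hom.comp_preimage]
  refine le_trans ?_ ((Spec.map (CommRingCat.ofHom (chartModelHom k b))).preimage_mono
    (isAffineOpen_chart k b 0).fromSpec_preimage_self.ge)
  exact le_top

theorem appLE_chartHom {j : Spec (.of (LocalModel k b)) ⟶ projectivization ω}
    (hj : j ≫ projectivizationHom ω = Spec.map (CommRingCat.ofHom (chartModelHom k b)) ≫
        (isAffineOpen_chart k b 0).fromSpec)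
    (h : ⊤ ≤ (j ≫ projectivizationHom ω) ⁻¹ᵁ curveChart k b) (p : MvPolynomial (Fin 3) k) :
    (j ≫ projectivizationHom ω).appLE (curveChart k b) ⊤ h (chartHom k b p) =
      (Scheme.ΓSpecIso (.of (LocalModel k b))).inv (localModelHom k b p) := by
  rw [← chartModelHom_coordHom]
  refine Eq.trans ?_ (specMap_fromSpec_appLE (isAffineOpen_chart k b 0) (chartModelHom k b)
    (hj ▸ h) (coordHom k b p))
  exact appLE_congr_hom hj _ _ _

end embedding
end

noncomputable section
attribute [local instance] MvPolynomial.gradedAlgebra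

/-! ### The point `[1, 0, 0, 0]` -/

section basePoint
variable (k : Type u) [Field k]

/-- A homogeneous prime ideal of `k[X₀, …, X₃]` which contains `X₁, X₂, X₃` but not `X₀` is
generated by `X₁, X₂, X₃`. -/
theorem toIdeal_eq_span (p : projSpace k 3)
    (h0 : MvPolynomial.X 0 ∉ p.asHomogeneousIdeal)
    (h : ∀ i : Fin 3, MvPolynomial.X i.succ ∈ p.asHomogeneousIdeal) :
    p.asHomogeneousIdeal.toIdeal =
      Ideal.span {MvPolynomial.X 1, MvPolynomial.X 2, MvPolynomial.X 3} := by
  set J : Ideal (MvPolynomial (Fin 4) k) :=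
    Ideal.span {MvPolynomial.X 1, MvPolynomial.X 2, MvPolynomial.X 3} with hJ
  have hle : J ≤ p.asHomogeneousIdeal.toIdeal := by
    rw [hJ, Ideal.span_le]
    rintro _ (rfl | rfl | rfl)
    exacts [h 0, h 1, h 2]
  have hX : ∀ i : Fin 4, i ≠ 0 → MvPolynomial.X i ∈ J := by
    intro i hi
    apply Ideal.subset_span
    fin_cases i
    · exact absurd rfl hi
    all_goals simp
  have hhom : ∀ (n : ℕ) (f : MvPolynomial (Fin 4) k), f.IsHomogeneous n →
      f ∈ p.asHomogeneousIdeal.toIdeal → f ∈ J := by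
    intro n f hf hfp
    set c := f.coeff (Finsupp.single 0 n) with hc
    -- Every monomial of degree `n` other than `X₀ ^ n` is divisible by one of the last three
    -- variables.
    have hd : f - MvPolynomial.monomial (Finsupp.single 0 n) c ∈ J := by
      rw [(f - _).as_sum]
      refine Ideal.sum_mem _ fun e he ↦ ?_
      rw [MvPolynomial.mem_support_iff, MvPolynomial.coeff_sub, MvPolynomial.coeff_monomial] at he
      have : ∃ i : Fin 4, i ≠ 0 ∧ e i ≠ 0 := by
        by_contra! h'
        have he' : e = Finsupp.single 0 (e 0) := by
          ext i
          by_cases hi : i = 0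
          · subst hi; simp
          · rw [h' i hi, Finsupp.single_eq_of_ne hi]
        have hn : f.coeff e ≠ 0 → e 0 = n := by
          intro hce
          by_contra hne
          refine hce (hf.coeff_eq_zero ?_)
          rw [he', Finsupp.degree_single]
          exact hne
        by_cases hce : f.coeff e = 0
        · rw [hce] at he
          split_ifs at he with h1
          · rw [hc, h1, hce] at he
            simp at he
          · simp at he
        · rw [he', hn hce] at he
          simp [hc] at he
      obtain ⟨i, hi, hei⟩ := this
      exact Ideal.mem_of_dvd _ ((MvPolynomial.X_dvd_monomial).mpr (Or.inr hei)) (hX i hi)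
    have hm : MvPolynomial.monomial (Finsupp.single 0 n) c ∈ p.asHomogeneousIdeal.toIdeal := by
      have := sub_mem hfp (hle hd)
      rwa [sub_sub_cancel] at this
    have hc0 : c = 0 := by
      by_contra hc0
      rw [← MvPolynomial.C_mul_X_pow_eq_monomial] at hm
      have hu : IsUnit (MvPolynomial.C c : MvPolynomial (Fin 4) k) :=
        (IsUnit.mk0 c hc0).map MvPolynomial.C
      exact h0 (p.isPrime.mem_of_pow_mem _ ((Ideal.unit_mul_mem_iff_mem _ hu).mp hm))
    rwa [hc0, map_zero, sub_zero] at hd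
  refine le_antisymm (fun f hf ↦ ?_) hle
  classical
  rw [← DirectSum.sum_support_decompose (MvPolynomial.homogeneousSubmodule (Fin 4) k) f]
  refine Ideal.sum_mem _ fun i _ ↦ hhom i _
    (DirectSum.decompose (MvPolynomial.homogeneousSubmodule (Fin 4) k) f i).2 ?_
  exact p.asHomogeneousIdeal.isHomogeneous i hf

variable (b : ℕ)

theorem isBasePoint_of_notMem {y : curve k b} (h0 : y ∈ chart k b 0)
    (h : ∀ i : Fin 3, y ∉ chart k b i.succ) : IsBasePoint k b y :=
  toIdeal_eq_span k (curveι k b y) h0 fun i ↦ not_not.mp (h i)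

theorem IsBasePoint.eq {x y : curve k b} (hx : IsBasePoint k b x) (hy : IsBasePoint k b y) :
    x = y := by
  refine (curveι k b).isClosedEmbedding.injective ?_
  refine ProjectiveSpectrum.ext (HomogeneousIdeal.toIdeal_injective ?_)
  exact hx.trans hy.symm

/-- In the model `y` and `z` are multiples of `x ^ (b+1)`, so all three affine coordinates vanish
where `x` does. -/
theorem isBasePoint_fromSpec {q : Spec (.of (LocalModel k b))} (hq : modelX k b ∈ q.asIdeal) :
    IsBasePoint k b ((Spec.map (CommRingCat.ofHom (chartModelHom k b)) ≫
        (isAffineOpen_chart k b 0).fromSpec) q) := by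
  set q' := Spec.map (CommRingCat.ofHom (chartModelHom k b)) q with hq'
  have h0 : (isAffineOpen_chart k b 0).fromSpec q' ∈ chart k b 0 := by
    have : q' ∈ (isAffineOpen_chart k b 0).fromSpec ⁻¹ᵁ chart k b 0 := by
      rw [(isAffineOpen_chart k b 0).fromSpec_preimage_self]
      trivial
    exact this
  refine isBasePoint_of_notMem k b h0 fun i hi ↦ ?_
  have h1 : (isAffineOpen_chart k b 0).fromSpec q' ∈
      (curve k b).basicOpen (coordRatio k b 0 i.succ) := by
    rw [basicOpen_coordRatio]
    exact ⟨hi, h0⟩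
  have h2 : q' ∈ (isAffineOpen_chart k b 0).fromSpec ⁻¹ᵁ
      (curve k b).basicOpen (coordRatio k b 0 i.succ) := h1
  rw [(isAffineOpen_chart k b 0).fromSpec_preimage_basicOpen, ← coordHom_X] at h2
  have h3 : chartModelHom k b (coordHom k b (MvPolynomial.X i)) ∉ q.asIdeal := h2
  apply h3
  rw [chartModelHom_coordHom]
  fin_cases i
  · exact (localModelHom_X0 k b).symm ▸ hq
  · refine (localModelHom_X1 k b).symm ▸ Ideal.mul_mem_left _ _ (Ideal.pow_mem_of_mem _ hq _ ?_)
    omega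
  · refine (localModelHom_X2 k b).symm ▸ neg_mem (Ideal.mul_mem_left _ _
      (Ideal.pow_mem_of_mem _ hq _ ?_))
    omega

end basePoint

/-! ### The open set where `x + v ^ 3` is invertible -/

section nilpotent
variable (k : Type u) [Field k] (b : ℕ)

/-- The function `x + v ^ 3` on the local model. -/
abbrev modelU : LocalModel k b := modelX k b + modelV k b ^ 3

theorem modelX_mem {q : Spec (.of (LocalModel k b))} (hq : modelU k b ∉ q.asIdeal) :
    modelX k b ∈ q.asIdeal := by
  have h : modelX k b ^ (b + 1) * modelU k b ∈ q.asIdeal := by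
    rw [modelX_pow_mul]
    exact zero_mem _
  exact q.isPrime.mem_of_pow_mem _ ((q.isPrime.mem_or_mem h).resolve_right hq)

/-- Lifted to `k[x, v]`, the hypothesis says that `s x ^ b` is a multiple of `x ^ (b+1) (x + v ^
3)`; cancel `x ^ b`. -/
theorem mem_span_modelX {s : LocalModel k b} (h : s * modelX k b ^ b = 0) :
    s ∈ Ideal.span {modelX k b} := by
  obtain ⟨s, rfl⟩ := Ideal.Quotient.mk_surjective s
  rw [← map_pow, ← map_mul, Ideal.Quotient.eq_zero_iff_mem, Ideal.mem_span_singleton] at h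
  obtain ⟨t, ht⟩ := h
  have : s = MvPolynomial.X 0 * ((MvPolynomial.X 0 + MvPolynomial.X 1 ^ 3) * t) := by
    refine mul_right_cancel₀ (pow_ne_zero b (MvPolynomial.X_ne_zero (0 : Fin 2))) (ht.trans ?_)
    ring
  rw [this, map_mul]
  exact Ideal.mul_mem_right _ _ (Ideal.mem_span_singleton_self _)

theorem exists_modelU_notMem : ∃ q : Spec (.of (LocalModel k b)), modelU k b ∉ q.asIdeal := by
  -- Evaluation at the point `x = 0`, `v = 1`, where `x + v ^ 3 = 1`.
  let g : LocalModel k b →+* k := Ideal.Quotient.lift _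
    (MvPolynomial.aeval ![(0 : k), 1]).toRingHom (by
      intro a ha
      rw [← RingHom.mem_ker]
      refine (Ideal.span_singleton_le_iff_mem _).mpr ?_ ha
      simp [RingHom.mem_ker])
  refine ⟨⟨RingHom.ker g, RingHom.ker_isPrime g⟩, fun h ↦ ?_⟩
  have h1 : g (modelU k b) = 0 := h
  have h2 : g (modelU k b) = 1 := by
    simp [g, modelU]
  exact one_ne_zero (h2.symm.trans h1)

/-- The open set on which `x + v ^ 3` is invertible. -/
def modelOpen : (Spec (.of (LocalModel k b))).Opens :=
  (Spec (.of (LocalModel k b))).basicOpen ((Scheme.ΓSpecIso (.of (LocalModel k b))).inv (modelU k b))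

theorem mem_modelOpen {q : Spec (.of (LocalModel k b))} :
    q ∈ modelOpen k b ↔ modelU k b ∉ q.asIdeal := by
  rw [modelOpen, basicOpen_eq_of_affine]
  rfl

/-- Elements of a ring as functions on an open subset of its spectrum. -/
def specFn {R : Type u} [CommRing R] (U : (Spec (.of R)).Opens) : R →+* Γ(Spec (.of R), U) :=
  ((Scheme.ΓSpecIso (.of R)).inv ≫ (Spec (.of R)).presheaf.map U.leTop.op).hom

theorem exists_mul_eq_zero_of_toStalk_eq_zero {R : Type u} [CommRing R] {x : PrimeSpectrum.Top R}
    {r : R} (h : StructureSheaf.toStalk R x r = 0) : ∃ s : R, s ∉ x.asIdeal ∧ s * r = 0 := by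
  have : x.asIdeal.IsPrime := PrimeSpectrum.isPrime x
  obtain ⟨⟨s, hs⟩, h'⟩ := (IsLocalization.map_eq_zero_iff x.asIdeal.primeCompl
    ((structurePresheafInCommRingCat R).stalk x) r).mp h
  exact ⟨s, hs, h'⟩

theorem germ_specFn_eq_zero {R : Type u} [CommRing R] {U : (Spec (.of R)).Opens}
    {q : Spec (.of R)} (hq : q ∈ U) {r : R}
    (h : (Spec (.of R)).presheaf.germ U q hq (specFn U r) = 0) :
    ∃ s : R, s ∉ q.asIdeal ∧ s * r = 0 := by
  have h1 : (Spec (.of R)).presheaf.germ U q hq (specFn U r) =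
      (Spec (.of R)).presheaf.germ ⊤ q trivial ((Scheme.ΓSpecIso (.of R)).inv r) :=
    (Spec (.of R)).presheaf.germ_res_apply (homOfLE le_top) q hq _
  exact exists_mul_eq_zero_of_toStalk_eq_zero (h1.symm.trans h)

theorem specFn_modelX_pow : specFn (modelOpen k b) (modelX k b) ^ (b + 1) = 0 := by
  have hu : IsUnit (specFn (modelOpen k b) (modelU k b)) :=
    RingedSpace.isUnit_res_basicOpen _ _
  rw [← hu.mul_left_inj, zero_mul, ← map_pow, ← map_mul, modelX_pow_mul, map_zero]

/-- The function is `x`. If the germ of `x ^ b` at `q` were zero, some `s ∉ q` would kill `x ^ b`;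
but such an `s` lies in `(x)`, and `x ∈ q` on this open set. -/
theorem isNilpotentOpen_image {P : Scheme.{u}} (j : Spec (.of (LocalModel k b)) ⟶ P)
    [IsOpenImmersion j] : IsNilpotentOpen b P (j ''ᵁ modelOpen k b) := by
  refine ⟨?_, (j.appIso (modelOpen k b)).inv (specFn (modelOpen k b) (modelX k b)), ?_, ?_⟩
  · obtain ⟨q, hq⟩ := exists_modelU_notMem k b
    exact ⟨j q, q, (mem_modelOpen k b).mpr hq, rfl⟩
  · rw [← map_pow, specFn_modelX_pow, map_zero]
  · rintro _ ⟨q, hq, rfl⟩ h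
    rw [← map_pow, ← map_pow] at h
    have h1 := (congrArg (j.stalkMap q) h).trans (map_zero (j.stalkMap q).hom)
    have h2 : (j.stalkMap q) (P.presheaf.germ (j ''ᵁ modelOpen k b) (j q) ⟨q, hq, rfl⟩
        ((j.appIso (modelOpen k b)).inv (specFn (modelOpen k b) (modelX k b ^ b)))) =
        (Spec (.of (LocalModel k b))).presheaf.germ (modelOpen k b) q hq
          (specFn (modelOpen k b) (modelX k b ^ b)) := by
      refine (j.germ_stalkMap_apply _ q _ _).trans ?_
      refine (congrArg _ (Scheme.Hom.appIso_inv_app_apply j (modelOpen k b) _)).trans ?_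
      exact (Spec (.of (LocalModel k b))).presheaf.germ_res_apply _ q _ _
    obtain ⟨s, hs, h3⟩ := germ_specFn_eq_zero hq (h2.symm.trans h1)
    refine hs ((Ideal.span_singleton_le_iff_mem _).mpr (modelX_mem k b ((mem_modelOpen k b).mp hq)) (mem_span_modelX k b h3))

end nilpotent
end

/-! ### The theorem -/

theorem mainTheorem2 {k : Type u} [Field k] [IsAlgClosed k] (b : ℕ) (hb : 0 < b)
    (ω : (curve k b).Modules) [ω.IsQuasicoherent] (hω : IsDualizingSheaf (curveToSpec k b) ω) :
    (∃ (x₀ : curve k b) (W : (projectivization ω).Opens),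
      IsBasePoint k b x₀ ∧ IsNilpotentOpen b (projectivization ω) W ∧
        ∀ p ∈ W, projectivizationHom ω p = x₀) ∧
    (∃ (j : Spec (.of (LocalModel k b)) ⟶ projectivization ω)
      (h : ⊤ ≤ (j ≫ projectivizationHom ω) ⁻¹ᵁ curveChart k b), IsOpenImmersion j ∧
        ∀ p : MvPolynomial (Fin 3) k,
          (j ≫ projectivizationHom ω).appLE (curveChart k b) ⊤ h (chartHom k b p) =
            (Scheme.ΓSpecIso (.of (LocalModel k b))).inv (localModelHom k b p)) ∧
    (IsAffineOpen (curveChart k b) ∧ Function.Surjective (chartHom k b) ∧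
      RingHom.ker (chartHom k b) = maximalMinors (hilbertBurchMatrix k b)) := by
  obtain ⟨j, hj, hjβ⟩ := exists_localModel_embedding hω
  have hbase : ∀ q ∈ modelOpen k b, IsBasePoint k b (projectivizationHom ω (j q)) := by
    intro q hq
    have h := isBasePoint_fromSpec k b (modelX_mem k b ((mem_modelOpen k b).mp hq))
    rw [← hjβ] at h
    exact h
  refine ⟨?_, ⟨j, top_le_preimage_of_eq hjβ, hj, appLE_chartHom hjβ _⟩,
    isAffineOpen_chart k b 0, coordHom_surjective k b,
    (ker_coordHom k b).trans (ker_paramHom k b)⟩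
  -- The base point is obtained as the image of a point of the nonempty open set; all other points
  -- of that set have the same image by `IsBasePoint.eq`.
  obtain ⟨q₀, hq₀⟩ := exists_modelU_notMem k b
  have h₀ := hbase q₀ ((mem_modelOpen k b).mpr hq₀)
  refine ⟨_, j ''ᵁ modelOpen k b, h₀, isNilpotentOpen_image k b j, ?_⟩
  rintro _ ⟨q, hq, rfl⟩
  exact IsBasePoint.eq k b (hbase q hq) h₀
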